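/- **Setting.** Let $d_1,d_2,r\ge 1$ be integers and let $M=U\Lambda V^{\mathsf T}\in\mathbb R^{d_1\times d_2}$, where $U\in\mathbb R^{d_1\times r}$, $V\in\mathbb R^{d_2\times r}$ satisfy $U^{\mathsf T}U=V^{\mathsf T}V=I_r$ and $\Lambda=\mathrm{diag}(\lambda_1,\dots,\lambda_r)$ with $\lambda_1\ge\dots\ge\lambda_r>0$. Let $\hat M=M+Z$, where $Z\in\mathbb R^{d_1\times d_2}$ is a random matrix with i.i.d. $N(0,1)$ entries, and let the random matrices $\hat U\in\mathbb R^{d_1\times r}$, $\hat V\in\mathbb R^{d_2\times r}$ consist of top-$r$ left and right singular vectors of $\hat M$ (the first $r$ columns of the orthogonal factors of a full singular value decomposition of $\hat M$ with non-increasing singular values). Put $$\mathrm{dist}^2[(\hat U,\hat V),(U,V)]=\|\hat U\hat U^{\mathsf T}-UU^{\mathsf T}\|_{\mathrm F}^2+\|\hat V\hat V^{\mathsf T}-VV^{\mathsf T}\|_{\mathrm F}^2,$$ $d_{\max}=\max\{d_1,d_2\}$, $d_\star=d_1+d_2-2r$, $\Delta_d=d_1-d_2$, and $$A=\begin{pmatrix}0&M\\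 M^{\mathsf T}&0\end{pmatrix},\qquad X=\begin{pmatrix}0&Z\\ Z^{\mathsf T}&0\end{pmatrix}.$$ With $u_i,v_i$ the columns of $U,V$, let $\theta_{\pm i}=\frac1{\sqrt2}\binom{u_i}{\pm v_i}$ and $\lambda_{-i}=-\lambda_i$ for $1\le i\le r$ (the eigenvectors and non-zero eigenvalues of $A$), let $\Theta$ be the $(d_1+d_2)\times 2r$ matrix with columns $\theta_{\pm i}$, and set $\mathfrak P^{0}=I-\Theta\Theta^{\mathsf T}$ and $\mathfrak P^{-k}=\sum_{1\le|j|\le r}\lambda_j^{-k}\theta_j\theta_j^{\mathsf T}$ for $k\ge1$. Finally, let $$\mathcal S_{A,4}(X)=\sum_{\substack{s_1,\dots,s_5\ge0\\ s_1+\dots+s_5=4}}(-1)^{1+\tau(s)}\,\mathfrak P^{-s_1}X\mathfrak P^{-s_2}X\mathfrak P^{-s_3}X\mathfrak P^{-s_4}X\mathfrak P^{-s_5},\qquad \tau(s)=\#\{j:s_j>0\},$$ and $\langle B,C\rangle=\mathrm{tr}(B^{\mathsf T}C)$. **Lemma 4.2 (second order approximation).** 1. There is an absolute constant $C_2>0$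 such that in every such setting $\langle\Theta\Theta^{\mathsf T},\mathcal S_{A,4}(X)\rangle$ is integrable and $$\Big|\mathbb E\langle\Theta\Theta^{\mathsf T},\mathcal S_{A,4}(X)\rangle-\Delta_d^2\|\Lambda^{-2}\|_{\mathrm F}^2\Big|\le C_2\,\frac{r^2d_{\max}}{\lambda_r^4}.$$ 2. There are absolute constants $C_1,C_2,C_3>0$ such that in every such setting with $\lambda_r\ge C_1\sqrt{d_{\max}}$ the variable $\mathrm{dist}^2[(\hat U,\hat V),(U,V)]$ is integrable and $$\Big|\mathbb E\,\mathrm{dist}^2[(\hat U,\hat V),(U,V)]-2\big(d_\star\|\Lambda^{-1}\|_{\mathrm F}^2-\Delta_d^2\|\Lambda^{-2}\|_{\mathrm F}^2\big)\Big|\le C_2\,\frac{r^2d_{\max}}{\lambda_r^4}+C_3\,r\Big(\frac{d_{\max}}{\lambda_r^2}\Big)^3 .$$ -/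

import Mathlib

open MeasureTheory ProbabilityTheory

noncomputable section

/-- Squared Frobenius norm of a real matrix. -/
def frobSq {m n : Type*} [Fintype m] [Fintype n] (A : Matrix m n ℝ) : ℝ :=
  ∑ i, ∑ j, A i j ^ 2

/-- Trace inner product of real matrices. -/
def frobInner {m n : Type*} [Fintype m] [Fintype n] (A B : Matrix m n ℝ) : ℝ :=
  (A.transpose * B).trace

/-- Entrywise negative power `D ^ (-k)` of the invertible diagonal matrix with diagonal `lam`. -/
def diagNegPow {ι : Type*} [DecidableEq ι] (lam : ι → ℝ) (k : ℕ) : Matrix ι ι ℝ :=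
  Matrix.diagonal fun i => (lam i ^ k)⁻¹

/-- For a symmetric matrix `Θ diag(lam) Θᵀ`, with orthonormal columns of `Θ` and nonzero `lam`:
`Θ diag(lam)^(-k) Θᵀ` for `k ≥ 1`, and for `k = 0` the projector onto the orthogonal complement
of the column space of `Θ`. -/
def specPow {n ι : Type*} [DecidableEq n] [Fintype ι] [DecidableEq ι]
    (Θ : Matrix n ι ℝ) (lam : ι → ℝ) : ℕ → Matrix n n ℝ
  | 0 => 1 - Θ * Θ.transpose
  | (k + 1) => Θ * diagNegPow lam (k + 1) * Θ.transpose

/-- Sanity check for the case `k = 0`: if the columns of `Θ` and `Θp` together form an orthonormal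
basis, then `specPow Θ lam 0` is `Θp Θpᵀ`. -/
theorem specPow_zero_eq {n ι κ : Type*} [Fintype n] [DecidableEq n] [Fintype ι] [DecidableEq ι]
    [Fintype κ] (Θ : Matrix n ι ℝ) (Θp : Matrix n κ ℝ) (lam : ι → ℝ)
    (h : Matrix.fromCols Θ Θp * (Matrix.fromCols Θ Θp).transpose = 1) :
    specPow Θ lam 0 = Θp * Θp.transpose := by
  rw [Matrix.transpose_fromCols, Matrix.fromCols_mul_fromRows] at h
  simp [specPow, ← h]

/-- The `k`-th order perturbation term: the sum over all tuples `s` of `k + 1` nonnegative integers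
with sum `k` of `(-1)^(1 + τ(s)) P^{-s₀} X P^{-s₁} X ⋯ X P^{-s_k}`, where `τ(s)` counts the positive
entries of `s` and `P^{-j} = specPow Θ lam j`. -/
def perturbTerm {n ι : Type*} [Fintype n] [DecidableEq n] [Fintype ι] [DecidableEq ι]
    (Θ : Matrix n ι ℝ) (lam : ι → ℝ) (k : ℕ) (X : Matrix n n ℝ) : Matrix n n ℝ :=
  ∑ s ∈ Finset.Nat.antidiagonalTuple (k + 1) k,
    (-1 : ℝ) ^ (1 + (Finset.univ.filter fun j => 0 < s j).card) •
      (specPow Θ lam (s 0) * (List.ofFn fun j : Fin k => X * specPow Θ lam (s j.succ)).prod)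

/-- The symmetric dilation `[[0, Z], [Zᵀ, 0]]`. -/
def dilation {d₁ d₂ : ℕ} (Z : Matrix (Fin d₁) (Fin d₂) ℝ) :
    Matrix (Fin d₁ ⊕ Fin d₂) (Fin d₁ ⊕ Fin d₂) ℝ :=
  Matrix.fromBlocks 0 Z Z.transpose 0

/-- The eigenvectors of the dilation of `U diag(lam) Vᵀ`: the columns `(uᵢ, vᵢ)/√2` (first block)
and `(uᵢ, -vᵢ)/√2` (second block). -/
def dilVec {d₁ d₂ r : ℕ} (U : Matrix (Fin d₁) (Fin r) ℝ) (V : Matrix (Fin d₂) (Fin r) ℝ) :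
    Matrix (Fin d₁ ⊕ Fin d₂) (Fin r ⊕ Fin r) ℝ :=
  (Real.sqrt 2)⁻¹ • Matrix.fromBlocks U U V (-V)

/-- The corresponding eigenvalues `lamᵢ` and `-lamᵢ`. -/
def dilVal {r : ℕ} (lam : Fin r → ℝ) : Fin r ⊕ Fin r → ℝ :=
  Sum.elim lam fun i => -lam i

/-- `M = U diag(lam) Vᵀ` is a compact singular value decomposition: orthonormal columns and
positive, non-increasing singular values. -/
structure IsCompactSVD {d₁ d₂ r : ℕ} (M : Matrix (Fin d₁) (Fin d₂) ℝ)
    (U : Matrix (Fin d₁) (Fin r) ℝ) (lam : Fin r → ℝ) (V : Matrix (Fin d₂) (Fin r) ℝ) : Prop where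
  left_orthonormal : U.transpose * U = 1
  right_orthonormal : V.transpose * V = 1
  pos : ∀ i, 0 < lam i
  antitone : Antitone lam
  eq : M = U * Matrix.diagonal lam * V.transpose

/-- `M = U Σ Vᵀ` is a full singular value decomposition: `U`, `V` are orthogonal matrices and `Σ` is
the rectangular diagonal matrix with non-increasing, nonnegative diagonal entries `sv 0, sv 1, …`
(values of `sv` beyond the diagonal are irrelevant). -/
structure IsFullSVD {d₁ d₂ : ℕ} (M : Matrix (Fin d₁) (Fin d₂) ℝ)
    (U : Matrix (Fin d₁) (Fin d₁) ℝ) (sv : ℕ → ℝ) (V : Matrix (Fin d₂) (Fin d₂) ℝ) : Prop where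
  left_orthogonal : U.transpose * U = 1
  right_orthogonal : V.transpose * V = 1
  nonneg : ∀ i, 0 ≤ sv i
  antitone : Antitone sv
  eq : M = U * Matrix.of (fun (i : Fin d₁) (j : Fin d₂) => if (i : ℕ) = j then sv i else 0) *
    V.transpose

/-- `Uh` and `Vh` collect top-`r` left and right singular vectors of `M`: they are the first `r`
columns of the orthogonal factors of some full singular value decomposition of `M`. -/
def IsTopSingularVectors {d₁ d₂ r : ℕ} (M : Matrix (Fin d₁) (Fin d₂) ℝ)
    (Uh : Matrix (Fin d₁) (Fin r) ℝ) (Vh : Matrix (Fin d₂) (Fin r) ℝ) : Prop :=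
  ∃ (U : Matrix (Fin d₁) (Fin d₁) ℝ) (sv : ℕ → ℝ) (V : Matrix (Fin d₂) (Fin d₂) ℝ)
    (h₁ : r ≤ d₁) (h₂ : r ≤ d₂), IsFullSVD M U sv V ∧
      Uh = U.submatrix id (Fin.castLE h₁) ∧ Vh = V.submatrix id (Fin.castLE h₂)

/-- Squared projection distance between the pairs of column spaces. -/
def distSq {d₁ d₂ r : ℕ} (Uh : Matrix (Fin d₁) (Fin r) ℝ) (Vh : Matrix (Fin d₂) (Fin r) ℝ)
    (U : Matrix (Fin d₁) (Fin r) ℝ) (V : Matrix (Fin d₂) (Fin r) ℝ) : ℝ :=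
  frobSq (Uh * Uh.transpose - U * U.transpose) + frobSq (Vh * Vh.transpose - V * V.transpose)

/-- A random matrix with i.i.d. standard normal entries. -/
structure IsStdGaussianMatrix {Ω : Type*} [MeasurableSpace Ω] {d₁ d₂ : ℕ}
    (Z : Ω → Matrix (Fin d₁) (Fin d₂) ℝ) (P : Measure Ω) : Prop where
  hasLaw : ∀ i j, HasLaw (fun ω => Z ω i j) (gaussianReal 0 1) P
  indep : iIndepFun (fun (p : Fin d₁ × Fin d₂) ω => Z ω p.1 p.2) P

end

/-! Write P = ΘΘᵀ and l = λ_r. The nonzero eigenvalues ±λᵢ of A lie outside |z| < l, so G(z) = z (z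
- A)⁻¹ is holomorphic there. If ‖Z‖ < l/2, Weyl's inequality puts exactly the top r singular values
of M + Z outside the circle |z| = l/2. Integrating tr(P (z - A - X)⁻¹)/(2πi) over this circle
therefore gives the trace of P against the complement of the perturbed projector, which is dist²/2.

The Neumann series expands the integrand into the terms z^(-k-1) tr(P G (X G)^k), and Cauchy's
formula extracts the k-th Taylor coefficient, which is exactly -⟨P, S_{A,k}(X)⟩. Cutting at k = 6
gives dist²/2 = -∑_{k<6} ⟨P, S_{A,k}(X)⟩ + O(r (‖Z‖/l)^6). For large Z the same bound is trivial,
because dist² ≤ 4r and each term is O(r (‖Z‖/l)^k). The expansion is thus deterministic and valid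
for every Z (`abs_distSq_add_le`), and no event needs to be excluded when taking expectations.

In expectation the order 0 term vanishes, and so do the odd orders, since Z and -Z have the same
law. The second order gives -d⋆ tr Λ⁻². The fourth order is computed exactly by Isserlis' formula:
it equals (Δ_d² - d⋆) tr Λ⁻⁴ (`hasExpectation_perturbTerm_four`), and d⋆ tr Λ⁻⁴ is the r² d_max/λ_r⁴
error of both parts. The remainder is controlled by E‖Z‖⁶ ≤ C d_max³, obtained from an exponential
moment of the operator norm by a volume argument (`lintegral_exp_norm_matOf_mul_le`). -/

open scoped Matrix

open scoped Matrix.Norms.L2Operator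

/-! ### Stability of nearly norming vectors -/

section OperatorNorm

variable {m n : Type*} [Fintype m] [Fintype n] [DecidableEq n]

/-- The continuous linear map between Euclidean spaces attached to a real matrix. -/
noncomputable def euclideanMap (A : Matrix m n ℝ) : EuclideanSpace ℝ n →L[ℝ] EuclideanSpace ℝ m :=
  (Matrix.toEuclideanLin (𝕜 := ℝ) (m := m) (n := n)).trans LinearMap.toContinuousLinearMap A

theorem norm_euclideanMap (A : Matrix m n ℝ) : ‖euclideanMap A‖ = ‖A‖ := rfl

theorem euclideanMap_apply (A : Matrix m n ℝ) (v : EuclideanSpace ℝ n) (i : m) :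
    euclideanMap A v i = ∑ j, A i j * v j := rfl

theorem inner_euclideanMap (A : Matrix m n ℝ) (u : EuclideanSpace ℝ m) (v : EuclideanSpace ℝ n) :
    inner ℝ u (euclideanMap A v) = ∑ i, ∑ j, u i * v j * A i j := by
  simp only [PiLp.inner_apply, euclideanMap_apply, RCLike.inner_apply, conj_trivial,
    Finset.sum_mul]
  exact Finset.sum_congr rfl fun i _ => Finset.sum_congr rfl fun j _ => by ring

theorem exists_near_norming_vectors (A : Matrix m n ℝ) :
    ∃ (u : EuclideanSpace ℝ m) (v : EuclideanSpace ℝ n), ‖u‖ ≤ 1 ∧ ‖v‖ ≤ 1 ∧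
      7 / 8 * ‖A‖ ≤ inner ℝ u (euclideanMap A v) := by
  rcases (norm_nonneg A).eq_or_lt with h | h
  · exact ⟨0, 0, by simp, by simp, by simp [← h]⟩
  obtain ⟨v, hv, hAv⟩ := (euclideanMap A).exists_lt_apply_of_lt_opNorm
    (r := 7 / 8 * ‖A‖) (by rw [norm_euclideanMap]; linarith)
  have hpos : 0 < ‖euclideanMap A v‖ := by linarith
  refine ⟨‖euclideanMap A v‖⁻¹ • euclideanMap A v, v, ?_, hv.le, ?_⟩
  · rw [norm_smul, norm_inv, norm_norm, inv_mul_cancel₀ hpos.ne']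
  · rw [real_inner_smul_left, real_inner_self_eq_norm_sq, sq, inv_mul_cancel_left₀ hpos.ne']
    exact hAv.le

/-- Moving both vectors by 1/4 costs at most 1/4 + (5/4)(1/4) of ‖A‖, and 7/8 - 1/4 - 5/16 = 5/16
still exceeds 1/4. Hence the bilinear form is large on a set of positive volume, not just at one
pair. -/
theorem norm_div_four_le_inner (A : Matrix m n ℝ) {u₀ u : EuclideanSpace ℝ m}
    {v₀ v : EuclideanSpace ℝ n} (hu₀ : ‖u₀‖ ≤ 1) (hv₀ : ‖v₀‖ ≤ 1)
    (h : 7 / 8 * ‖A‖ ≤ inner ℝ u₀ (euclideanMap A v₀))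
    (hu : dist u u₀ < 1 / 4) (hv : dist v v₀ < 1 / 4) :
    ‖A‖ / 4 ≤ inner ℝ u (euclideanMap A v) := by
  rw [dist_eq_norm] at hu hv
  have hA := norm_nonneg A
  have hun : ‖u‖ ≤ 5 / 4 := by
    calc ‖u‖ = ‖u₀ + (u - u₀)‖ := by simp
      _ ≤ _ := norm_add_le _ _
      _ ≤ _ := by linarith
  have key : inner ℝ u (euclideanMap A v) = inner ℝ u₀ (euclideanMap A v₀)
      + inner ℝ (u - u₀) (euclideanMap A v₀) + inner ℝ u (euclideanMap A (v - v₀)) := by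
    simp only [map_sub, inner_sub_left, inner_sub_right]; ring
  have hb : ∀ (x : EuclideanSpace ℝ m) (y : EuclideanSpace ℝ n),
      |inner ℝ x (euclideanMap A y)| ≤ ‖x‖ * (‖A‖ * ‖y‖) := fun x y =>
    (abs_real_inner_le_norm _ _).trans
      (mul_le_mul_of_nonneg_left ((euclideanMap A).le_opNorm y) (norm_nonneg _))
  have h1 := hb (u - u₀) v₀
  have h2 := hb u (v - v₀)
  have h1' : ‖u - u₀‖ * (‖A‖ * ‖v₀‖) ≤ 1 / 4 * (‖A‖ * 1) := by gcongr
  have h2' : ‖u‖ * (‖A‖ * ‖v - v₀‖) ≤ 5 / 4 * (‖A‖ * (1 / 4)) := by gcongr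
  have := (abs_le.1 (h1.trans h1')).1
  have := (abs_le.1 (h2.trans h2')).1
  rw [key]; linarith

end OperatorNorm

/-! ### Sixth moment of the operator norm of a Gaussian matrix -/

section Gaussian

/-- The joint law of independent standard normal variables. -/
noncomputable abbrev stdGaussianPi (ι : Type*) [Fintype ι] : Measure (ι → ℝ) :=
  Measure.pi fun _ => gaussianReal 0 1

theorem integrable_exp_sum_stdGaussianPi {ι : Type*} [Fintype ι] (c : ι → ℝ) :
    Integrable (fun z : ι → ℝ => Real.exp (∑ p, c p * z p)) (stdGaussianPi ι) := by
  simp_rw [Real.exp_sum]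
  exact Integrable.fintype_prod (f := fun p x => Real.exp (c p * x))
    fun p => integrable_exp_mul_gaussianReal (c p)

theorem integral_exp_sum_stdGaussianPi {ι : Type*} [Fintype ι] (c : ι → ℝ) :
    ∫ z : ι → ℝ, Real.exp (∑ p, c p * z p) ∂(stdGaussianPi ι) = Real.exp ((∑ p, c p ^ 2) / 2) := by
  simp_rw [Real.exp_sum]
  rw [integral_fintype_prod_eq_prod (f := fun p x => Real.exp (c p * x)), Finset.sum_div,
    Real.exp_sum]
  refine Finset.prod_congr rfl fun p _ => ?_
  have := congrFun (mgf_id_gaussianReal (μ := 0) (v := 1)) (c p)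
  simpa [mgf] using this

theorem lintegral_exp_sum_stdGaussianPi {ι : Type*} [Fintype ι] (c : ι → ℝ) :
    ∫⁻ z : ι → ℝ, ENNReal.ofReal (Real.exp (∑ p, c p * z p)) ∂(stdGaussianPi ι)
      = ENNReal.ofReal (Real.exp ((∑ p, c p ^ 2) / 2)) := by
  rw [← integral_exp_sum_stdGaussianPi, ofReal_integral_eq_lintegral_ofReal
    (integrable_exp_sum_stdGaussianPi c) (Filter.Eventually.of_forall fun z => (Real.exp_pos _).le)]

variable {d₁ d₂ : ℕ}

/-- The matrix with the given family of entries. -/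
def matOf (z : Fin d₁ × Fin d₂ → ℝ) : Matrix (Fin d₁) (Fin d₂) ℝ := Matrix.of fun i j => z (i, j)

theorem continuous_matOf : Continuous (matOf : (Fin d₁ × Fin d₂ → ℝ) → _) := by
  unfold matOf; fun_prop

theorem continuous_norm_matOf : Continuous fun z : Fin d₁ × Fin d₂ → ℝ => ‖matOf z‖ :=
  continuous_norm.comp continuous_matOf

theorem inner_euclideanMap_matOf (s : ℝ) (z : Fin d₁ × Fin d₂ → ℝ) (u : EuclideanSpace ℝ (Fin d₁))
    (v : EuclideanSpace ℝ (Fin d₂)) :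
    s * inner ℝ u (euclideanMap (matOf z) v) = ∑ p : Fin d₁ × Fin d₂, (s * u p.1 * v p.2) * z p := by
  rw [inner_euclideanMap, Fintype.sum_prod_type, Finset.mul_sum]
  refine Finset.sum_congr rfl fun i _ => ?_
  rw [Finset.mul_sum]
  refine Finset.sum_congr rfl fun j _ => ?_
  simp [matOf]; ring

theorem lintegral_exp_inner_le (s : ℝ) {u : EuclideanSpace ℝ (Fin d₁)}
    {v : EuclideanSpace ℝ (Fin d₂)} (hu : ‖u‖ ≤ 5 / 4) (hv : ‖v‖ ≤ 5 / 4) :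
    ∫⁻ z, ENNReal.ofReal (Real.exp (s * inner ℝ u (euclideanMap (matOf z) v)))
      ∂(stdGaussianPi (Fin d₁ × Fin d₂)) ≤ ENNReal.ofReal (Real.exp (2 * s ^ 2)) := by
  simp_rw [inner_euclideanMap_matOf]
  rw [lintegral_exp_sum_stdGaussianPi]
  apply ENNReal.ofReal_le_ofReal
  rw [Real.exp_le_exp]
  have : ∑ p : Fin d₁ × Fin d₂, (s * u p.1 * v p.2) ^ 2 = s ^ 2 * (‖u‖ ^ 2 * ‖v‖ ^ 2) := by
    rw [EuclideanSpace.real_norm_sq_eq, EuclideanSpace.real_norm_sq_eq, Fintype.sum_prod_type,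
      Finset.sum_mul_sum, Finset.mul_sum]
    refine Finset.sum_congr rfl fun i _ => ?_
    rw [Finset.mul_sum]
    exact Finset.sum_congr rfl fun j _ => by ring
  rw [this]
  have : s ^ 2 * (‖u‖ ^ 2 * ‖v‖ ^ 2) ≤ s ^ 2 * ((5 / 4) ^ 2 * (5 / 4) ^ 2) := by gcongr
  nlinarith [sq_nonneg s]

/-- A continuous substitute for a net. For each z, the function exp(s⟨u, Zv⟩) is at least
exp(s‖Z‖/4) on a product of balls of radius 1/4 around a nearly norming pair, and this product lies
inside the balls of radius 5/4. Integrating over the large balls and exchanging with the Gaussian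
integral leaves only moment generating functions of the linear forms ⟨u, Zv⟩. -/
theorem lintegral_exp_norm_matOf_mul_le (s : ℝ) (hs : 0 ≤ s) :
    (∫⁻ z, ENNReal.ofReal (Real.exp (s * (‖(matOf z : Matrix (Fin d₁) (Fin d₂) ℝ)‖ / 4)))
      ∂(stdGaussianPi (Fin d₁ × Fin d₂)))
      * (volume (Metric.ball (0 : EuclideanSpace ℝ (Fin d₁)) (1 / 4))
        * volume (Metric.ball (0 : EuclideanSpace ℝ (Fin d₂)) (1 / 4)))
    ≤ ENNReal.ofReal (Real.exp (2 * s ^ 2))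
      * (volume (Metric.ball (0 : EuclideanSpace ℝ (Fin d₁)) (5 / 4))
        * volume (Metric.ball (0 : EuclideanSpace ℝ (Fin d₂)) (5 / 4))) := by
  set B₁ := Metric.ball (0 : EuclideanSpace ℝ (Fin d₁)) (5 / 4)
  set B₂ := Metric.ball (0 : EuclideanSpace ℝ (Fin d₂)) (5 / 4)
  let μ := ((volume : Measure (EuclideanSpace ℝ (Fin d₁))).restrict B₁).prod
    ((volume : Measure (EuclideanSpace ℝ (Fin d₂))).restrict B₂)
  let F : (Fin d₁ × Fin d₂ → ℝ) → EuclideanSpace ℝ (Fin d₁) × EuclideanSpace ℝ (Fin d₂) → ENNReal :=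
    fun z w => ENNReal.ofReal (Real.exp (s * inner ℝ w.1 (euclideanMap (matOf z) w.2)))
  have hFc : Continuous (Function.uncurry F) := by
    refine ENNReal.continuous_ofReal.comp (Real.continuous_exp.comp ?_)
    simp_rw [inner_euclideanMap_matOf]
    fun_prop
  have hμ : μ = (volume.prod volume).restrict (B₁ ×ˢ B₂) := Measure.prod_restrict _ _
  have hB : MeasurableSet (B₁ ×ˢ B₂) := Metric.isOpen_ball.measurableSet.prod
    Metric.isOpen_ball.measurableSet
  have lower : ∀ z : Fin d₁ × Fin d₂ → ℝ,
      ENNReal.ofReal (Real.exp (s * (‖matOf z‖ / 4)))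
        * (volume (Metric.ball (0 : EuclideanSpace ℝ (Fin d₁)) (1 / 4))
          * volume (Metric.ball (0 : EuclideanSpace ℝ (Fin d₂)) (1 / 4))) ≤ ∫⁻ w, F z w ∂μ := by
    intro z
    obtain ⟨u₀, v₀, hu₀, hv₀, h⟩ := exists_near_norming_vectors (matOf z)
    set S := Metric.ball u₀ (1 / 4) ×ˢ Metric.ball v₀ (1 / 4)
    have hS : S ⊆ B₁ ×ˢ B₂ := by
      refine Set.prod_mono (fun u hu => ?_) (fun v hv => ?_)
      · rw [Metric.mem_ball] at *
        calc dist u 0 ≤ dist u u₀ + dist u₀ 0 := dist_triangle _ _ _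
          _ < 1 / 4 + 1 := by rw [dist_zero_right]; linarith
          _ = 5 / 4 := by norm_num
      · rw [Metric.mem_ball] at *
        calc dist v 0 ≤ dist v v₀ + dist v₀ 0 := dist_triangle _ _ _
          _ < 1 / 4 + 1 := by rw [dist_zero_right]; linarith
          _ = 5 / 4 := by norm_num
    have hSm : MeasurableSet S := Metric.isOpen_ball.measurableSet.prod
      Metric.isOpen_ball.measurableSet
    have hSv : μ S = volume (Metric.ball (0 : EuclideanSpace ℝ (Fin d₁)) (1 / 4))
          * volume (Metric.ball (0 : EuclideanSpace ℝ (Fin d₂)) (1 / 4)) := by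
      rw [hμ, Measure.restrict_apply hSm, Set.inter_eq_left.2 hS, Measure.prod_prod,
        Measure.addHaar_ball_center, Measure.addHaar_ball_center _ v₀]
    rw [← hSv, ← setLIntegral_const]
    refine (setLIntegral_mono' hSm fun w hw => ?_).trans (setLIntegral_le_lintegral S _)
    apply ENNReal.ofReal_le_ofReal
    rw [Real.exp_le_exp]
    exact mul_le_mul_of_nonneg_left (norm_div_four_le_inner _ hu₀ hv₀ h hw.1 hw.2) hs
  calc _ = ∫⁻ z, ENNReal.ofReal (Real.exp (s * (‖(matOf z : Matrix (Fin d₁) (Fin d₂) ℝ)‖ / 4)))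
        * (volume (Metric.ball (0 : EuclideanSpace ℝ (Fin d₁)) (1 / 4))
        * volume (Metric.ball (0 : EuclideanSpace ℝ (Fin d₂)) (1 / 4)))
        ∂(stdGaussianPi (Fin d₁ × Fin d₂)) := by
        rw [lintegral_mul_const']
        exact ENNReal.mul_ne_top measure_ball_lt_top.ne measure_ball_lt_top.ne
    _ ≤ ∫⁻ z, ∫⁻ w, F z w ∂μ ∂(stdGaussianPi (Fin d₁ × Fin d₂)) := lintegral_mono lower
    _ = ∫⁻ w, ∫⁻ z, F z w ∂(stdGaussianPi (Fin d₁ × Fin d₂)) ∂μ :=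
        lintegral_lintegral_swap hFc.measurable.aemeasurable
    _ ≤ ∫⁻ w, ENNReal.ofReal (Real.exp (2 * s ^ 2)) ∂μ := by
        rw [hμ]
        refine setLIntegral_mono' hB fun w hw => ?_
        exact lintegral_exp_inner_le s (mem_ball_zero_iff.1 hw.1).le (mem_ball_zero_iff.1 hw.2).le
    _ = _ := by rw [lintegral_const, hμ, Measure.restrict_apply_univ, Measure.prod_prod]

theorem lintegral_exp_norm_matOf_le (s : ℝ) (hs : 0 ≤ s) :
    ∫⁻ z, ENNReal.ofReal (Real.exp (s * (‖(matOf z : Matrix (Fin d₁) (Fin d₂) ℝ)‖ / 4)))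
      ∂(stdGaussianPi (Fin d₁ × Fin d₂))
    ≤ ENNReal.ofReal (Real.exp (2 * s ^ 2 + 2 * (d₁ + d₂))) := by
  have h := lintegral_exp_norm_matOf_mul_le (d₁ := d₁) (d₂ := d₂) s hs
  have hball : ∀ d : ℕ, volume (Metric.ball (0 : EuclideanSpace ℝ (Fin d)) (5 / 4))
      ≤ ENNReal.ofReal (Real.exp (2 * d))
        * volume (Metric.ball (0 : EuclideanSpace ℝ (Fin d)) (1 / 4)) := by
    intro d
    have h1 := Measure.addHaar_ball_mul_of_pos (volume : Measure (EuclideanSpace ℝ (Fin d))) 0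
      (r := 5) (by norm_num) (1 / 4)
    rw [show (5 : ℝ) * (1 / 4) = 5 / 4 by norm_num] at h1
    rw [h1]
    gcongr
    rw [finrank_euclideanSpace_fin, mul_comm, Real.exp_nat_mul]
    -- The volume ratio of the two balls is 5^d, and 5 = 1 + 2 + 2²/2 ≤ e².
    have : (5 : ℝ) ≤ Real.exp 2 := by
      have := Real.quadratic_le_exp_of_nonneg (x := 2) (by norm_num)
      linarith
    gcongr
  have hne : volume (Metric.ball (0 : EuclideanSpace ℝ (Fin d₁)) (1 / 4))
        * volume (Metric.ball (0 : EuclideanSpace ℝ (Fin d₂)) (1 / 4)) ≠ 0 :=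
    mul_ne_zero (Metric.measure_ball_pos _ _ (by norm_num)).ne'
      (Metric.measure_ball_pos _ _ (by norm_num)).ne'
  have hnt : volume (Metric.ball (0 : EuclideanSpace ℝ (Fin d₁)) (1 / 4))
        * volume (Metric.ball (0 : EuclideanSpace ℝ (Fin d₂)) (1 / 4)) ≠ ⊤ :=
    ENNReal.mul_ne_top measure_ball_lt_top.ne measure_ball_lt_top.ne
  rw [← ENNReal.mul_le_mul_iff_left hne hnt]
  refine h.trans ?_
  calc _ ≤ ENNReal.ofReal (Real.exp (2 * s ^ 2)) * ((ENNReal.ofReal (Real.exp (2 * d₁))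
        * volume (Metric.ball (0 : EuclideanSpace ℝ (Fin d₁)) (1 / 4)))
        * (ENNReal.ofReal (Real.exp (2 * d₂))
        * volume (Metric.ball (0 : EuclideanSpace ℝ (Fin d₂)) (1 / 4)))) := by
        gcongr
        · exact hball d₁
        · exact hball d₂
    _ = _ := by
        rw [mul_add 2 (d₁ : ℝ), Real.exp_add, Real.exp_add, ENNReal.ofReal_mul (by positivity),
          ENNReal.ofReal_mul (by positivity)]
        ring

/-- An absolute constant in the bound on the sixth moment of the operator norm of a standard
Gaussian matrix. -/
def sixthMomentConst : ℝ := 2 ^ 5 * 24 ^ 6 + 2 ^ 5 * 4 ^ 6 * 720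

/-- Used with x = ‖Z‖/√d, where the exponential has mean at most 1. The threshold 24 is where x/4 -
6 changes sign; beyond it x = 4y + 24 with y^6/720 ≤ e^y, and convexity of the sixth power gives the
factor 2^5. -/
theorem pow_six_le_exp {x d : ℝ} (hx : 0 ≤ x) (hd : 1 ≤ d) :
    x ^ 6 ≤ 2 ^ 5 * 24 ^ 6 + 2 ^ 5 * 4 ^ 6 * 720 * Real.exp (d * (x / 4) - 6 * d) := by
  have he := Real.exp_pos (d * (x / 4) - 6 * d)
  rcases le_total x 24 with h | h
  · have : x ^ 6 ≤ 24 ^ 6 := by gcongr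
    nlinarith
  · set y := x / 4 - 6 with hy
    have hy0 : 0 ≤ y := by rw [hy]; linarith
    have hxy : x = 4 * y + 24 := by rw [hy]; ring
    have h1 : y ^ 6 / 720 ≤ Real.exp y := by
      have := Real.pow_div_factorial_le_exp y hy0 6
      simpa [Nat.factorial] using this
    have h2 : Real.exp y ≤ Real.exp (d * (x / 4) - 6 * d) := by
      rw [Real.exp_le_exp, hy]; nlinarith
    have h3 : (4 * y + 24) ^ 6 ≤ 2 ^ (6 - 1) * ((4 * y) ^ 6 + 24 ^ 6) :=
      add_pow_le (by linarith) (by norm_num) 6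
    rw [hxy] at *
    rw [mul_pow] at h3
    norm_num at h3 ⊢
    linarith

theorem integrable_norm_matOf_pow_six_and_integral_le {d : ℕ} (hd : 0 < d) (h₁ : d₁ ≤ d)
    (h₂ : d₂ ≤ d) :
    Integrable (fun z => ‖(matOf z : Matrix (Fin d₁) (Fin d₂) ℝ)‖ ^ 6)
      (stdGaussianPi (Fin d₁ × Fin d₂)) ∧
    ∫ z, ‖(matOf z : Matrix (Fin d₁) (Fin d₂) ℝ)‖ ^ 6 ∂(stdGaussianPi (Fin d₁ × Fin d₂))
      ≤ sixthMomentConst * d ^ 3 := by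
  have hd1 : (1 : ℝ) ≤ d := by exact_mod_cast hd
  have hd0 : (0 : ℝ) < d := by linarith
  let G : (Fin d₁ × Fin d₂ → ℝ) → ℝ := fun z => Real.exp (√d * (‖matOf z‖ / 4))
  have hGc : Continuous G := by
    have := continuous_norm_matOf (d₁ := d₁) (d₂ := d₂)
    fun_prop
  have hlin : ∫⁻ z, ENNReal.ofReal (G z) ∂(stdGaussianPi (Fin d₁ × Fin d₂))
      ≤ ENNReal.ofReal (Real.exp (6 * d)) := by
    -- The choice s = √d makes 2s² of the same order as the entropy term: 2d + 2(d₁ + d₂) ≤ 6d.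
    refine (lintegral_exp_norm_matOf_le √d (Real.sqrt_nonneg _)).trans ?_
    apply ENNReal.ofReal_le_ofReal
    rw [Real.exp_le_exp, Real.sq_sqrt hd0.le]
    have : (d₁ : ℝ) ≤ d := by exact_mod_cast h₁
    have : (d₂ : ℝ) ≤ d := by exact_mod_cast h₂
    linarith
  have hGi : Integrable G (stdGaussianPi (Fin d₁ × Fin d₂)) := by
    refine ⟨hGc.aestronglyMeasurable, ?_⟩
    rw [hasFiniteIntegral_iff_ofReal (Filter.Eventually.of_forall fun z => (Real.exp_pos _).le)]
    exact hlin.trans_lt ENNReal.ofReal_lt_top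
  have hGle : ∫ z, G z ∂(stdGaussianPi (Fin d₁ × Fin d₂)) ≤ Real.exp (6 * d) := by
    rw [integral_eq_lintegral_of_nonneg_ae (Filter.Eventually.of_forall fun z => (Real.exp_pos _).le)
      hGc.aestronglyMeasurable]
    exact ENNReal.toReal_le_of_le_ofReal (Real.exp_pos _).le hlin
  let H : (Fin d₁ × Fin d₂ → ℝ) → ℝ := fun z =>
    d ^ 3 * (2 ^ 5 * 24 ^ 6 + 2 ^ 5 * 4 ^ 6 * 720 * (Real.exp (-(6 * d)) * G z))
  have hHi : Integrable H (stdGaussianPi (Fin d₁ × Fin d₂)) :=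
    ((integrable_const _).add ((hGi.const_mul _).const_mul _)).const_mul _
  have hle : ∀ z : Fin d₁ × Fin d₂ → ℝ, ‖matOf z‖ ^ 6 ≤ H z := by
    intro z
    have hs : 0 < √(d : ℝ) := Real.sqrt_pos.2 hd0
    have hss : √(d : ℝ) ^ 2 = d := Real.sq_sqrt hd0.le
    have h := pow_six_le_exp (x := ‖matOf z‖ / √d) (by positivity) hd1
    have e1 : (d : ℝ) * (‖matOf z‖ / √d / 4) = √d * (‖matOf z‖ / 4) := by
      nth_rewrite 1 [← hss]; field_simp
    rw [e1, sub_eq_add_neg, Real.exp_add, mul_comm (Real.exp _), div_pow,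
      div_le_iff₀ (by positivity), show √(d : ℝ) ^ 6 = (d : ℝ) ^ 3 by
        rw [show √(d : ℝ) ^ 6 = (√(d : ℝ) ^ 2) ^ 3 by ring, hss]] at h
    calc _ ≤ _ := h
      _ = H z := by simp only [H, G]; ring
  have hi : Integrable (fun z => ‖(matOf z : Matrix (Fin d₁) (Fin d₂) ℝ)‖ ^ 6)
      (stdGaussianPi (Fin d₁ × Fin d₂)) := by
    refine hHi.mono' (continuous_norm_matOf.pow 6).aestronglyMeasurable
      (Filter.Eventually.of_forall fun z => ?_)
    rw [Real.norm_of_nonneg (by positivity)]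
    exact hle z
  refine ⟨hi, (integral_mono hi hHi hle).trans ?_⟩
  simp only [H]
  rw [integral_const_mul, integral_add (integrable_const _) ((hGi.const_mul _).const_mul _),
    integral_const_mul, integral_const_mul, integral_const_mul, integral_const]
  have h1 : Real.exp (-(6 * d)) * ∫ z, G z ∂(stdGaussianPi (Fin d₁ × Fin d₂)) ≤ 1 := by
    calc _ ≤ Real.exp (-(6 * d)) * Real.exp (6 * d) := by gcongr
      _ = 1 := by rw [← Real.exp_add]; simp
  simp only [probReal_univ, one_smul, sixthMomentConst]
  rw [mul_comm]
  exact mul_le_mul_of_nonneg_right (by linarith) (by positivity)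

end Gaussian

/-! ### Gaussian moments and Isserlis' formula -/

section Moments

theorem integrable_pow_gaussianReal (k : ℕ) :
    Integrable (fun x : ℝ => x ^ k) (gaussianReal 0 1) := by
  have h := memLp_id_gaussianReal (μ := 0) (v := 1) k
  rcases Nat.eq_zero_or_pos k with rfl | hk
  · simp
  · have := h.integrable_norm_pow (by omega)
    refine (integrable_norm_iff (by fun_prop)).1 ?_
    simpa [norm_pow] using this

/-- Differentiating p(t) exp(t²/2) replaces p by p' + t p. Four applications starting from p = 1
give the first four moments as values at t = 0. -/
theorem hasDerivAt_mul_exp_sq_half (p : ℝ → ℝ) (p' t : ℝ) (hp : HasDerivAt p p' t) :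
    HasDerivAt (fun t => p t * Real.exp (t ^ 2 / 2)) ((p' + t * p t) * Real.exp (t ^ 2 / 2)) t := by
  have h : HasDerivAt (fun t : ℝ => Real.exp (t ^ 2 / 2)) (Real.exp (t ^ 2 / 2) * t) t := by
    have := ((hasDerivAt_pow 2 t).div_const 2).exp
    convert this using 2
    simp
  exact (hp.mul h).congr_deriv (by ring)

theorem integral_pow_gaussianReal_of_le_four :
    ∫ x, x ∂(gaussianReal 0 1) = 0 ∧ ∫ x, x ^ 2 ∂(gaussianReal 0 1) = 1 ∧
    ∫ x, x ^ 3 ∂(gaussianReal 0 1) = 0 ∧ ∫ x, x ^ 4 ∂(gaussianReal 0 1) = 3 := by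
  have hint : (0 : ℝ) ∈ interior (integrableExpSet id (gaussianReal 0 1)) := by
    simp [integrableExpSet_id_gaussianReal]
  have hm : mgf id (gaussianReal 0 1) = fun t => 1 * Real.exp (t ^ 2 / 2) := by
    rw [mgf_id_gaussianReal]; simp
  have d1 : deriv (mgf id (gaussianReal 0 1)) = fun t => t * Real.exp (t ^ 2 / 2) := by
    rw [hm]; funext t
    rw [(hasDerivAt_mul_exp_sq_half (fun _ => 1) 0 t (hasDerivAt_const _ _)).deriv]; ring
  have d2 : deriv (deriv (mgf id (gaussianReal 0 1)))
      = fun t => (1 + t ^ 2) * Real.exp (t ^ 2 / 2) := by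
    rw [d1]; funext t
    rw [(hasDerivAt_mul_exp_sq_half (fun t => t) 1 t (hasDerivAt_id _)).deriv]; ring
  have d3 : deriv (deriv (deriv (mgf id (gaussianReal 0 1))))
      = fun t => (3 * t + t ^ 3) * Real.exp (t ^ 2 / 2) := by
    rw [d2]; funext t
    rw [(hasDerivAt_mul_exp_sq_half (fun t => 1 + t ^ 2) (2 * t) t
      (by simpa using (hasDerivAt_pow 2 t).const_add 1)).deriv]; ring
  have d4 : deriv (deriv (deriv (deriv (mgf id (gaussianReal 0 1)))))
      = fun t => (3 + 6 * t ^ 2 + t ^ 4) * Real.exp (t ^ 2 / 2) := by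
    rw [d3]; funext t
    rw [(hasDerivAt_mul_exp_sq_half (fun t => 3 * t + t ^ 3) (3 + 3 * t ^ 2) t
      (((hasDerivAt_id t).const_mul 3).add (hasDerivAt_pow 3 t) |>.congr_deriv (by simp))).deriv]; ring
  have key := fun n => iteratedDeriv_mgf_zero hint n
  refine ⟨integral_id_gaussianReal, ?_, ?_, ?_⟩
  · have := key 2
    simp only [iteratedDeriv_succ, iteratedDeriv_zero, d2] at this
    simpa using this.symm
  · have := key 3
    simp only [iteratedDeriv_succ, iteratedDeriv_zero, d3] at this
    simpa using this.symm
  · have := key 4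
    simp only [iteratedDeriv_succ, iteratedDeriv_zero, d4] at this
    simpa using this.symm

variable {ι : Type*} [Fintype ι]

theorem integrable_prod_pow_stdGaussianPi (k : ι → ℕ) :
    Integrable (fun z : ι → ℝ => ∏ i, z i ^ k i) (stdGaussianPi ι) :=
  Integrable.fintype_prod (f := fun i x => x ^ k i) fun i => integrable_pow_gaussianReal (k i)

theorem integral_prod_pow_stdGaussianPi (k : ι → ℕ) :
    ∫ z : ι → ℝ, ∏ i, z i ^ k i ∂(stdGaussianPi ι) = ∏ i, ∫ x, x ^ k i ∂(gaussianReal 0 1) :=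
  integral_fintype_prod_eq_prod (f := fun i x => x ^ k i)

variable [DecidableEq ι]

theorem prod_pow_boole_eq (z : ι → ℝ) (p : ι) : ∏ i, z i ^ (if i = p then 1 else 0) = z p := by
  simp [pow_ite]

theorem mul_eq_prod_pow (z : ι → ℝ) (p q : ι) :
    z p * z q = ∏ i, z i ^ ((if i = p then 1 else 0) + (if i = q then 1 else 0)) := by
  simp only [pow_add, Finset.prod_mul_distrib, prod_pow_boole_eq]

theorem mul_four_eq_prod_pow (z : ι → ℝ) (p q s t : ι) :
    z p * z q * z s * z t = ∏ i, z i ^ ((if i = p then 1 else 0) + (if i = q then 1 else 0)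
      + (if i = s then 1 else 0) + (if i = t then 1 else 0)) := by
  simp only [pow_add, Finset.prod_mul_distrib, prod_pow_boole_eq]

theorem integrable_mul_stdGaussianPi (p q : ι) :
    Integrable (fun z : ι → ℝ => z p * z q) (stdGaussianPi ι) := by
  simp_rw [mul_eq_prod_pow]; exact integrable_prod_pow_stdGaussianPi _

theorem integrable_mul_four_stdGaussianPi (p q s t : ι) :
    Integrable (fun z : ι → ℝ => z p * z q * z s * z t) (stdGaussianPi ι) := by
  simp_rw [mul_four_eq_prod_pow]; exact integrable_prod_pow_stdGaussianPi _

theorem integral_mul_stdGaussianPi (p q : ι) :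
    ∫ z : ι → ℝ, z p * z q ∂(stdGaussianPi ι) = if p = q then 1 else 0 := by
  simp_rw [mul_eq_prod_pow]
  rw [integral_prod_pow_stdGaussianPi]
  obtain ⟨m1, m2, -, -⟩ := integral_pow_gaussianReal_of_le_four
  split_ifs with h
  · subst h
    refine Finset.prod_eq_one fun i _ => ?_
    split_ifs <;> simp [m2]
  · refine Finset.prod_eq_zero (Finset.mem_univ p) ?_
    simp [h, m1]

/-- Isserlis' formula for four coordinates. -/
theorem integral_mul_four_stdGaussianPi (p q s t : ι) :
    ∫ z : ι → ℝ, z p * z q * z s * z t ∂(stdGaussianPi ι) =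
      (if p = q then 1 else 0) * (if s = t then 1 else 0)
      + (if p = s then 1 else 0) * (if q = t then 1 else 0)
      + (if p = t then 1 else 0) * (if q = s then 1 else 0) := by
  simp_rw [mul_four_eq_prod_pow]
  rw [integral_prod_pow_stdGaussianPi]
  obtain ⟨m1, m2, m3, m4⟩ := integral_pow_gaussianReal_of_le_four
  -- A coordinate with an odd exponent kills the product, and exponents all 0 or 2 give 1. The only
  -- remaining case is four equal indices, where the moment 3 counts the three pairings.
  have zero : ∀ j : ι, ∀ k : ι → ℕ, k j = 1 ∨ k j = 3 →
      ∏ i, ∫ x, x ^ k i ∂(gaussianReal 0 1) = 0 := by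
    intro j k hk
    refine Finset.prod_eq_zero (Finset.mem_univ j) ?_
    rcases hk with hk | hk <;> simp [hk, m1, m3]
  have one : ∀ k : ι → ℕ, (∀ i, k i = 0 ∨ k i = 2) →
      ∏ i, ∫ x, x ^ k i ∂(gaussianReal 0 1) = 1 := by
    intro k hk
    refine Finset.prod_eq_one fun i _ => ?_
    rcases hk i with hk | hk <;> simp [hk, m2]
  by_cases hpq : p = q
  · subst hpq
    by_cases hst : s = t
    · subst hst
      by_cases hps : p = s
      · subst hps
        rw [Finset.prod_eq_single p]
        · simp [m4]; norm_num
        · intro b _ hb; simp [hb]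
        · simp
      · rw [one]
        · simp [hps]
        · intro i; split_ifs <;> simp_all
    · rw [zero t]
      · have := Ne.symm hst
        simp only [hst]; by_cases h : p = t <;> simp_all
      · by_cases h : t = p <;> by_cases h' : t = s <;> simp_all
  · by_cases hps : p = s
    · subst hps
      by_cases hqt : q = t
      · subst hqt
        rw [one]
        · simp [hpq]
        · intro i; split_ifs <;> simp_all
      · rw [zero q]
        · simp [hpq, hqt, Ne.symm hpq]
        · simp [Ne.symm hpq, hqt]
    · by_cases hpt : p = t
      · subst hpt
        by_cases hqs : q = s
        · subst hqs
          rw [one]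
          · simp [hpq]
          · intro i; split_ifs <;> simp_all
        · rw [zero q]
          · simp [hpq, hqs, hps]
          · simp [Ne.symm hpq, hqs]
      · rw [zero p]
        · simp [hpq, hps, hpt]
        · simp [hpq, hps, hpt]

theorem integrable_quartic_stdGaussianPi (T : ι → ι → ι → ι → ℝ) :
    Integrable (fun z : ι → ℝ => ∑ t, ∑ s, ∑ q, ∑ p, T p q s t * (z p * z q * z s * z t))
      (stdGaussianPi ι) :=
  integrable_finsetSum _ fun t _ => integrable_finsetSum _ fun s _ => integrable_finsetSum _
    fun q _ => integrable_finsetSum _ fun p _ => (integrable_mul_four_stdGaussianPi p q s t).const_mul _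

theorem integral_quartic_stdGaussianPi (T : ι → ι → ι → ι → ℝ) :
    ∫ z : ι → ℝ, (∑ t, ∑ s, ∑ q, ∑ p, T p q s t * (z p * z q * z s * z t)) ∂(stdGaussianPi ι) =
      ∑ p, ∑ q, (T p p q q + T p q p q + T p q q p) := by
  have hi : ∀ p q s t, Integrable (fun z : ι → ℝ => T p q s t * (z p * z q * z s * z t))
      (stdGaussianPi ι) := fun p q s t => (integrable_mul_four_stdGaussianPi p q s t).const_mul _
  have hi1 : ∀ q s t, Integrable (fun z : ι → ℝ => ∑ p, T p q s t * (z p * z q * z s * z t))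
      (stdGaussianPi ι) := fun q s t => integrable_finsetSum _ fun p _ => hi p q s t
  have hi2 : ∀ s t, Integrable (fun z : ι → ℝ => ∑ q, ∑ p, T p q s t * (z p * z q * z s * z t))
      (stdGaussianPi ι) := fun s t => integrable_finsetSum _ fun q _ => hi1 q s t
  have hi3 : ∀ t, Integrable (fun z : ι → ℝ => ∑ s, ∑ q, ∑ p, T p q s t * (z p * z q * z s * z t))
      (stdGaussianPi ι) := fun t => integrable_finsetSum _ fun s _ => hi2 s t
  rw [integral_finsetSum _ fun t _ => hi3 t]
  simp_rw [integral_finsetSum _ fun s _ => hi2 s _, integral_finsetSum _ fun q _ => hi1 q _ _,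
    integral_finsetSum _ fun p _ => hi p _ _ _, integral_const_mul, integral_mul_four_stdGaussianPi,
    mul_add, Finset.sum_add_distrib]
  have e1 : ∀ t s q, ∑ p, T p q s t * ((if p = q then 1 else 0) * (if s = t then 1 else 0))
      = if s = t then T q q s t else 0 := fun t s q => by
    rw [Finset.sum_eq_single q (fun b _ hb => by simp [hb]) (by simp)]; simp
  have e2 : ∀ t s q, ∑ p, T p q s t * ((if p = s then 1 else 0) * (if q = t then 1 else 0))
      = if q = t then T s q s t else 0 := fun t s q => by
    rw [Finset.sum_eq_single s (fun b _ hb => by simp [hb]) (by simp)]; simp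
  have e3 : ∀ t s q, ∑ p, T p q s t * ((if p = t then 1 else 0) * (if q = s then 1 else 0))
      = if q = s then T t q s t else 0 := fun t s q => by
    rw [Finset.sum_eq_single t (fun b _ hb => by simp [hb]) (by simp)]; simp
  have e4 : ∀ t, ∑ s, ∑ q, (if s = t then T q q s t else 0) = ∑ q, T q q t t := fun t => by
    rw [Finset.sum_comm]; simp
  simp only [e1, e2, e3, e4, Finset.sum_ite_eq', Finset.mem_univ, if_true]
  congr 1
  congr 1
  · rw [Finset.sum_comm]
  · rw [Finset.sum_comm]

theorem integrable_quadratic_stdGaussianPi (T : ι → ι → ℝ) :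
    Integrable (fun z : ι → ℝ => ∑ q, ∑ p, T p q * (z p * z q)) (stdGaussianPi ι) :=
  integrable_finsetSum _ fun q _ => integrable_finsetSum _
    fun p _ => (integrable_mul_stdGaussianPi p q).const_mul _

theorem integral_quadratic_stdGaussianPi (T : ι → ι → ℝ) :
    ∫ z : ι → ℝ, (∑ q, ∑ p, T p q * (z p * z q)) ∂(stdGaussianPi ι) = ∑ p, T p p := by
  have hi : ∀ p q, Integrable (fun z : ι → ℝ => T p q * (z p * z q)) (stdGaussianPi ι) :=
    fun p q => (integrable_mul_stdGaussianPi p q).const_mul _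
  rw [integral_finsetSum _ fun q _ => integrable_finsetSum _ fun p _ => hi p q]
  simp_rw [integral_finsetSum _ fun p _ => hi p _, integral_const_mul, integral_mul_stdGaussianPi]
  simp

end Moments

/-! ### Expected traces of words in a Gaussian matrix -/

section GaussianTrace

variable {d₁ d₂ : ℕ}

/-- Together with `Finset.sum_comm` on the outer pair, these adjacent interchanges produce the
reorderings of fourfold sums needed to recognise products of traces. -/
theorem sum_swap₂₃ {α β γ δ : Type*} [Fintype α] [Fintype β] [Fintype γ] [Fintype δ]
    (F : α → β → γ → δ → ℝ) :
    ∑ a, ∑ b, ∑ c, ∑ d, F a b c d = ∑ a, ∑ c, ∑ b, ∑ d, F a b c d :=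
  Finset.sum_congr rfl fun _ _ => Finset.sum_comm

theorem sum_swap₃₄ {α β γ δ : Type*} [Fintype α] [Fintype β] [Fintype γ] [Fintype δ]
    (F : α → β → γ → δ → ℝ) :
    ∑ a, ∑ b, ∑ c, ∑ d, F a b c d = ∑ a, ∑ b, ∑ d, ∑ c, F a b c d :=
  Finset.sum_congr rfl fun _ _ => Finset.sum_congr rfl fun _ _ => Finset.sum_comm

theorem trace_quadratic_eq (A : Matrix (Fin d₁) (Fin d₁) ℝ) (B : Matrix (Fin d₂) (Fin d₂) ℝ)
    (z : Fin d₁ × Fin d₂ → ℝ) :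
    (A * matOf z * B * (matOf z)ᵀ).trace =
      ∑ q, ∑ p, (A q.1 p.1 * B p.2 q.2) * (z p * z q) := by
  rw [Fintype.sum_prod_type]
  simp only [Matrix.trace, Matrix.diag, Matrix.mul_apply, Finset.sum_mul, matOf, Matrix.of_apply,
    Matrix.transpose_apply]
  refine Finset.sum_congr rfl fun _ _ => Finset.sum_congr rfl fun _ _ => ?_
  rw [Fintype.sum_prod_type_right]
  refine Finset.sum_congr rfl fun _ _ => Finset.sum_congr rfl fun _ _ => ?_
  ring

theorem integrable_trace_quadratic (A : Matrix (Fin d₁) (Fin d₁) ℝ)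
    (B : Matrix (Fin d₂) (Fin d₂) ℝ) :
    Integrable (fun z => (A * matOf z * B * (matOf z)ᵀ).trace)
      (stdGaussianPi (Fin d₁ × Fin d₂)) := by
  simp_rw [trace_quadratic_eq]
  exact integrable_quadratic_stdGaussianPi (fun p q : Fin d₁ × Fin d₂ => A q.1 p.1 * B p.2 q.2)

theorem integral_trace_quadratic (A : Matrix (Fin d₁) (Fin d₁) ℝ)
    (B : Matrix (Fin d₂) (Fin d₂) ℝ) :
    ∫ z, (A * matOf z * B * (matOf z)ᵀ).trace ∂(stdGaussianPi (Fin d₁ × Fin d₂)) =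
      A.trace * B.trace := by
  simp_rw [trace_quadratic_eq]
  rw [integral_quadratic_stdGaussianPi (fun p q : Fin d₁ × Fin d₂ => A q.1 p.1 * B p.2 q.2),
    Fintype.sum_prod_type]
  simp [Matrix.trace, Finset.sum_mul_sum]

theorem trace_alternating_eq (A C : Matrix (Fin d₁) (Fin d₁) ℝ) (B D : Matrix (Fin d₂) (Fin d₂) ℝ)
    (z : Fin d₁ × Fin d₂ → ℝ) :
    (A * matOf z * B * (matOf z)ᵀ * C * matOf z * D * (matOf z)ᵀ).trace =
      ∑ t, ∑ s, ∑ q, ∑ p, (A t.1 p.1 * B p.2 q.2 * C q.1 s.1 * D s.2 t.2)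
        * (z p * z q * z s * z t) := by
  rw [Fintype.sum_prod_type]
  simp only [Matrix.trace, Matrix.diag, Matrix.mul_apply, Finset.sum_mul, matOf, Matrix.of_apply,
    Matrix.transpose_apply]
  refine Finset.sum_congr rfl fun t₁ _ => Finset.sum_congr rfl fun t₂ _ => ?_
  rw [Fintype.sum_prod_type_right]
  refine Finset.sum_congr rfl fun _ _ => Finset.sum_congr rfl fun _ _ => ?_
  rw [Fintype.sum_prod_type]
  refine Finset.sum_congr rfl fun _ _ => Finset.sum_congr rfl fun _ _ => ?_
  rw [Fintype.sum_prod_type_right]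
  refine Finset.sum_congr rfl fun _ _ => Finset.sum_congr rfl fun _ _ => ?_
  ring

theorem trace_crossed_eq (A : Matrix (Fin d₁) (Fin d₂) ℝ) (B : Matrix (Fin d₁) (Fin d₁) ℝ)
    (C : Matrix (Fin d₂) (Fin d₁) ℝ) (D : Matrix (Fin d₂) (Fin d₂) ℝ)
    (z : Fin d₁ × Fin d₂ → ℝ) :
    (A * (matOf z)ᵀ * B * matOf z * C * matOf z * D * (matOf z)ᵀ).trace =
      ∑ t, ∑ s, ∑ q, ∑ p, (A t.1 p.2 * B p.1 q.1 * C q.2 s.1 * D s.2 t.2)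
        * (z p * z q * z s * z t) := by
  rw [Fintype.sum_prod_type]
  simp only [Matrix.trace, Matrix.diag, Matrix.mul_apply, Finset.sum_mul, matOf, Matrix.of_apply,
    Matrix.transpose_apply]
  refine Finset.sum_congr rfl fun t₁ _ => Finset.sum_congr rfl fun t₂ _ => ?_
  rw [Fintype.sum_prod_type_right]
  refine Finset.sum_congr rfl fun _ _ => Finset.sum_congr rfl fun _ _ => ?_
  rw [Fintype.sum_prod_type_right]
  refine Finset.sum_congr rfl fun _ _ => Finset.sum_congr rfl fun _ _ => ?_
  rw [Fintype.sum_prod_type]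
  refine Finset.sum_congr rfl fun _ _ => Finset.sum_congr rfl fun _ _ => ?_
  ring

theorem trace_unbalanced_eq (A : Matrix (Fin d₁) (Fin d₁) ℝ) (B C : Matrix (Fin d₂) (Fin d₁) ℝ)
    (D : Matrix (Fin d₂) (Fin d₂) ℝ) (z : Fin d₁ × Fin d₂ → ℝ) :
    (A * matOf z * B * matOf z * C * matOf z * D * (matOf z)ᵀ).trace =
      ∑ t, ∑ s, ∑ q, ∑ p, (A t.1 p.1 * B p.2 q.1 * C q.2 s.1 * D s.2 t.2)
        * (z p * z q * z s * z t) := by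
  rw [Fintype.sum_prod_type]
  simp only [Matrix.trace, Matrix.diag, Matrix.mul_apply, Finset.sum_mul, matOf, Matrix.of_apply,
    Matrix.transpose_apply]
  refine Finset.sum_congr rfl fun t₁ _ => Finset.sum_congr rfl fun t₂ _ => ?_
  rw [Fintype.sum_prod_type_right]
  refine Finset.sum_congr rfl fun _ _ => Finset.sum_congr rfl fun _ _ => ?_
  rw [Fintype.sum_prod_type_right]
  refine Finset.sum_congr rfl fun _ _ => Finset.sum_congr rfl fun _ _ => ?_
  rw [Fintype.sum_prod_type_right]
  refine Finset.sum_congr rfl fun _ _ => Finset.sum_congr rfl fun _ _ => ?_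
  ring

theorem integrable_trace_alternating (A C : Matrix (Fin d₁) (Fin d₁) ℝ)
    (B D : Matrix (Fin d₂) (Fin d₂) ℝ) :
    Integrable (fun z => (A * matOf z * B * (matOf z)ᵀ * C * matOf z * D * (matOf z)ᵀ).trace)
      (stdGaussianPi (Fin d₁ × Fin d₂)) := by
  simp_rw [trace_alternating_eq]
  exact integrable_quartic_stdGaussianPi
    (fun p q s t : Fin d₁ × Fin d₂ => A t.1 p.1 * B p.2 q.2 * C q.1 s.1 * D s.2 t.2)

theorem integrable_trace_crossed (A : Matrix (Fin d₁) (Fin d₂) ℝ) (B : Matrix (Fin d₁) (Fin d₁) ℝ)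
    (C : Matrix (Fin d₂) (Fin d₁) ℝ) (D : Matrix (Fin d₂) (Fin d₂) ℝ) :
    Integrable (fun z => (A * (matOf z)ᵀ * B * matOf z * C * matOf z * D * (matOf z)ᵀ).trace)
      (stdGaussianPi (Fin d₁ × Fin d₂)) := by
  simp_rw [trace_crossed_eq]
  exact integrable_quartic_stdGaussianPi
    (fun p q s t : Fin d₁ × Fin d₂ => A t.1 p.2 * B p.1 q.1 * C q.2 s.1 * D s.2 t.2)

theorem integrable_trace_unbalanced (A : Matrix (Fin d₁) (Fin d₁) ℝ)
    (B C : Matrix (Fin d₂) (Fin d₁) ℝ) (D : Matrix (Fin d₂) (Fin d₂) ℝ) :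
    Integrable (fun z => (A * matOf z * B * matOf z * C * matOf z * D * (matOf z)ᵀ).trace)
      (stdGaussianPi (Fin d₁ × Fin d₂)) := by
  simp_rw [trace_unbalanced_eq]
  exact integrable_quartic_stdGaussianPi
    (fun p q s t : Fin d₁ × Fin d₂ => A t.1 p.1 * B p.2 q.1 * C q.2 s.1 * D s.2 t.2)

/-- Here and in the two analogues below, the three terms come from pairing the first Gaussian factor
with the second, third and fourth, in that order. -/
theorem integral_trace_alternating (A C : Matrix (Fin d₁) (Fin d₁) ℝ)
    (B D : Matrix (Fin d₂) (Fin d₂) ℝ) :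
    ∫ z, (A * matOf z * B * (matOf z)ᵀ * C * matOf z * D * (matOf z)ᵀ).trace
      ∂(stdGaussianPi (Fin d₁ × Fin d₂)) =
    (A * C).trace * B.trace * D.trace + (A * Cᵀ).trace * (B * Dᵀ).trace
      + A.trace * C.trace * (B * D).trace := by
  simp_rw [trace_alternating_eq]
  rw [integral_quartic_stdGaussianPi
    (fun p q s t : Fin d₁ × Fin d₂ => A t.1 p.1 * B p.2 q.2 * C q.1 s.1 * D s.2 t.2)]
  simp only [Finset.sum_add_distrib, Fintype.sum_prod_type, Matrix.trace, Matrix.diag,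
    Matrix.mul_apply, Finset.sum_mul, Finset.mul_sum, Matrix.transpose_apply]
  congr 1
  congr 1
  · refine (sum_swap₃₄ _).trans ((sum_swap₂₃ _).trans (Finset.sum_comm.trans ((sum_swap₂₃ _).trans
      ((sum_swap₃₄ _).trans (Finset.sum_congr rfl fun _ _ =>
      Finset.sum_congr rfl fun _ _ => Finset.sum_congr rfl fun _ _ => Finset.sum_congr rfl
      fun _ _ => ?_)))))
    ring
  · refine Finset.sum_comm.trans ((sum_swap₃₄ _).trans ((sum_swap₂₃ _).trans ((sum_swap₃₄ _).trans
      (Finset.sum_congr rfl fun _ _ =>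
      Finset.sum_congr rfl fun _ _ => Finset.sum_congr rfl fun _ _ => Finset.sum_congr rfl
      fun _ _ => ?_))))
    ring
  · refine Finset.sum_comm.trans ((sum_swap₃₄ _).trans ((sum_swap₂₃ _).trans ((sum_swap₃₄ _).trans
      (Finset.sum_congr rfl fun _ _ =>
      Finset.sum_congr rfl fun _ _ => Finset.sum_congr rfl fun _ _ => Finset.sum_congr rfl
      fun _ _ => ?_))))
    ring

theorem integral_trace_crossed (A : Matrix (Fin d₁) (Fin d₂) ℝ) (B : Matrix (Fin d₁) (Fin d₁) ℝ)
    (C : Matrix (Fin d₂) (Fin d₁) ℝ) (D : Matrix (Fin d₂) (Fin d₂) ℝ) :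
    ∫ z, (A * (matOf z)ᵀ * B * matOf z * C * matOf z * D * (matOf z)ᵀ).trace
      ∂(stdGaussianPi (Fin d₁ × Fin d₂)) =
    (A * C).trace * B.trace * D.trace + (A * D * C * B).trace + (A * Dᵀ * C * Bᵀ).trace := by
  simp_rw [trace_crossed_eq]
  rw [integral_quartic_stdGaussianPi
    (fun p q s t : Fin d₁ × Fin d₂ => A t.1 p.2 * B p.1 q.1 * C q.2 s.1 * D s.2 t.2)]
  simp only [Finset.sum_add_distrib, Fintype.sum_prod_type, Matrix.trace, Matrix.diag,
    Matrix.mul_apply, Finset.sum_mul, Finset.mul_sum, Matrix.transpose_apply]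
  congr 1
  congr 1
  · refine (sum_swap₃₄ _).trans ((sum_swap₂₃ _).trans (Finset.sum_comm.trans ((sum_swap₃₄ _).trans
      (Finset.sum_congr rfl fun _ _ =>
      Finset.sum_congr rfl fun _ _ => Finset.sum_congr rfl fun _ _ => Finset.sum_congr rfl
      fun _ _ => ?_))))
    ring
  · refine (sum_swap₂₃ _).trans (Finset.sum_comm.trans ((sum_swap₃₄ _).trans
      (Finset.sum_congr rfl fun _ _ =>
      Finset.sum_congr rfl fun _ _ => Finset.sum_congr rfl fun _ _ => Finset.sum_congr rfl
      fun _ _ => ?_)))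
    ring
  · refine (sum_swap₂₃ _).trans ((sum_swap₃₄ _).trans (Finset.sum_congr rfl fun _ _ =>
      Finset.sum_congr rfl fun _ _ => Finset.sum_congr rfl fun _ _ => Finset.sum_congr rfl
      fun _ _ => ?_))
    ring

theorem integral_trace_unbalanced (A : Matrix (Fin d₁) (Fin d₁) ℝ)
    (B C : Matrix (Fin d₂) (Fin d₁) ℝ) (D : Matrix (Fin d₂) (Fin d₂) ℝ) :
    ∫ z, (A * matOf z * B * matOf z * C * matOf z * D * (matOf z)ᵀ).trace
      ∂(stdGaussianPi (Fin d₁ × Fin d₂)) =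
    (A * Bᵀ * C).trace * D.trace + (A * Cᵀ * Dᵀ * B).trace + A.trace * (B * Cᵀ * D).trace := by
  simp_rw [trace_unbalanced_eq]
  rw [integral_quartic_stdGaussianPi
    (fun p q s t : Fin d₁ × Fin d₂ => A t.1 p.1 * B p.2 q.1 * C q.2 s.1 * D s.2 t.2)]
  simp only [Finset.sum_add_distrib, Fintype.sum_prod_type, Matrix.trace, Matrix.diag,
    Matrix.mul_apply, Finset.sum_mul, Finset.mul_sum, Matrix.transpose_apply]
  congr 1
  congr 1
  · refine (sum_swap₃₄ _).trans ((sum_swap₂₃ _).trans (Finset.sum_comm.trans ((sum_swap₃₄ _).trans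
      ((sum_swap₂₃ _).trans ((sum_swap₃₄ _).trans (Finset.sum_congr rfl fun _ _ =>
      Finset.sum_congr rfl fun _ _ => Finset.sum_congr rfl fun _ _ => Finset.sum_congr rfl
      fun _ _ => ?_))))))
    ring
  · refine (sum_swap₂₃ _).trans (Finset.sum_comm.trans ((sum_swap₂₃ _).trans ((sum_swap₃₄ _).trans
      (Finset.sum_congr rfl fun _ _ =>
      Finset.sum_congr rfl fun _ _ => Finset.sum_congr rfl fun _ _ => Finset.sum_congr rfl
      fun _ _ => ?_))))
    ring
  · refine Finset.sum_comm.trans ((sum_swap₃₄ _).trans ((sum_swap₂₃ _).trans ((sum_swap₃₄ _).trans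
      (Finset.sum_congr rfl fun _ _ =>
      Finset.sum_congr rfl fun _ _ => Finset.sum_congr rfl fun _ _ => Finset.sum_congr rfl
      fun _ _ => ?_))))
    ring

end GaussianTrace

/-! ### The perturbation terms as Taylor coefficients -/

section PerturbationSeries

theorem frobInner_proj {n ι : Type*} [Fintype n] [Fintype ι] (Θ : Matrix n ι ℝ)
    (B : Matrix n n ℝ) : frobInner (Θ * Θᵀ) B = (Θ * Θᵀ * B).trace := by
  simp [frobInner, Matrix.transpose_mul]

variable {n ι : Type*} [Fintype n] [DecidableEq n] [Fintype ι] [DecidableEq ι]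

/-- The Taylor coefficients at `0` of `z ↦ z (z - A)⁻¹`, where `A = Θ diag(lam) Θᵀ`. -/
noncomputable def resolventCoeff (Θ : Matrix n ι ℝ) (lam : ι → ℝ) : ℕ → Matrix n n ℝ
  | 0 => specPow Θ lam 0
  | (k + 1) => -specPow Θ lam (k + 1)

/-- For a sequence `c` of matrices, viewed as a formal power series `G`, the coefficients of
`G * X * G * X * ⋯ * X * G` with `k` factors `X`. -/
noncomputable def interlacedCoeff (c : ℕ → Matrix n n ℝ) (X : Matrix n n ℝ) :
    ℕ → ℕ → Matrix n n ℝ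
  | 0, m => c m
  | (k + 1), m => ∑ p ∈ Finset.HasAntidiagonal.antidiagonal m, c p.1 * (X * interlacedCoeff c X k p.2)

theorem sum_antidiagonalTuple_succ {M : Type*} [AddCommMonoid M] (k m : ℕ)
    (f : (Fin (k + 1) → ℕ) → M) :
    ∑ s ∈ Finset.Nat.antidiagonalTuple (k + 1) m, f s =
      ∑ p ∈ Finset.HasAntidiagonal.antidiagonal m, ∑ t ∈ Finset.Nat.antidiagonalTuple k p.2,
        f (Fin.cons p.1 t) := by
  rw [Finset.sum_sigma' (Finset.HasAntidiagonal.antidiagonal m)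
    (fun p => Finset.Nat.antidiagonalTuple k p.2) (fun p t => f (Fin.cons p.1 t))]
  refine Finset.sum_bij' (fun s _ => ⟨(s 0, ∑ i : Fin k, s i.succ), fun i => s i.succ⟩)
    (fun x _ => Fin.cons x.1.1 x.2) ?_ ?_ ?_ ?_ ?_
  · intro s hs
    rw [Finset.Nat.mem_antidiagonalTuple, Fin.sum_univ_succ] at hs
    simp [Finset.Nat.mem_antidiagonalTuple, hs]
  · rintro ⟨⟨a, b⟩, t⟩ hx
    simp only [Finset.mem_sigma, Finset.HasAntidiagonal.mem_antidiagonal,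
      Finset.Nat.mem_antidiagonalTuple] at hx
    simp [Finset.Nat.mem_antidiagonalTuple, Fin.sum_univ_succ, hx.1, hx.2]
  · intro s _
    exact Fin.cons_self_tail s
  · rintro ⟨⟨a, b⟩, t⟩ hx
    simp only [Finset.mem_sigma, Finset.HasAntidiagonal.mem_antidiagonal,
      Finset.Nat.mem_antidiagonalTuple] at hx
    simp [hx.2]
  · intro s _
    exact congrArg f (Fin.cons_self_tail s).symm

theorem sum_antidiagonalTuple_eq_interlacedCoeff (c : ℕ → Matrix n n ℝ) (X : Matrix n n ℝ)
    (k m : ℕ) :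
    ∑ s ∈ Finset.Nat.antidiagonalTuple (k + 1) m,
      c (s 0) * (List.ofFn fun j : Fin k => X * c (s j.succ)).prod = interlacedCoeff c X k m := by
  induction k generalizing m with
  | zero => simp [interlacedCoeff]
  | succ k ih =>
    rw [sum_antidiagonalTuple_succ]
    simp only [interlacedCoeff, ← ih, Finset.mul_sum, List.ofFn_succ, List.prod_cons,
      Fin.cons_zero, Fin.cons_succ, mul_assoc]

theorem prod_ofFn_mul_smul (k : ℕ) (ε : Fin k → ℝ) (X : Matrix n n ℝ) (p : Fin k → Matrix n n ℝ) :
    (List.ofFn fun j => X * (ε j • p j)).prod = (∏ j, ε j) • (List.ofFn fun j => X * p j).prod := by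
  induction k with
  | zero => simp
  | succ k ih =>
    simp only [List.ofFn_succ, List.prod_cons, Fin.prod_univ_succ, ih]
    simp only [Matrix.mul_smul, Matrix.smul_mul, smul_smul]
    rw [mul_comm]

/-- The sign (-1)^τ(s) is absorbed by the coefficients of z (z - A)⁻¹, which carry a minus sign
exactly at positive orders; the remaining factor -1 is the global sign. This is the link between the
combinatorial sum and the contour integral. -/
theorem perturbTerm_eq_neg_interlacedCoeff (Θ : Matrix n ι ℝ) (lam : ι → ℝ) (k : ℕ)
    (X : Matrix n n ℝ) :
    perturbTerm Θ lam k X = -interlacedCoeff (resolventCoeff Θ lam) X k k := by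
  rw [← sum_antidiagonalTuple_eq_interlacedCoeff, perturbTerm, ← Finset.sum_neg_distrib]
  refine Finset.sum_congr rfl fun s _ => ?_
  have hc : ∀ m, resolventCoeff Θ lam m = (if 0 < m then (-1 : ℝ) else 1) • specPow Θ lam m := by
    intro m; cases m <;> simp [resolventCoeff]
  simp only [hc, prod_ofFn_mul_smul]
  simp only [Matrix.mul_smul, Matrix.smul_mul, smul_smul]
  rw [← neg_smul, pow_add, pow_one, neg_one_mul, mul_comm (∏ j, _) _,
    ← Fin.prod_univ_succ (fun j => if 0 < s j then (-1 : ℝ) else 1), Finset.prod_ite]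
  simp

theorem specPow_mul_specPow {Θ : Matrix n ι ℝ} (hΘ : Θᵀ * Θ = 1) (lam : ι → ℝ) (a b : ℕ) :
    specPow Θ lam (a + 1) * specPow Θ lam (b + 1) = specPow Θ lam (a + b + 2) := by
  simp only [specPow, diagNegPow]
  calc _ = Θ * Matrix.diagonal (fun i => (lam i ^ (a + 1))⁻¹) * (Θᵀ * Θ)
        * Matrix.diagonal (fun i => (lam i ^ (b + 1))⁻¹) * Θᵀ := by
          simp only [mul_assoc, Matrix.mul_assoc]
    _ = _ := by
      rw [hΘ, Matrix.mul_one, Matrix.mul_assoc Θ, Matrix.diagonal_mul_diagonal]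
      congr 3
      ext i
      rw [← mul_inv, ← pow_add]
      congr 2
      ring

theorem specPow_zero_mul {Θ : Matrix n ι ℝ} (hΘ : Θᵀ * Θ = 1) (lam : ι → ℝ) (a : ℕ) :
    specPow Θ lam 0 * specPow Θ lam (a + 1) = 0 := by
  simp only [specPow, sub_mul, one_mul]
  have : Θ * Θᵀ * (Θ * diagNegPow lam (a + 1) * Θᵀ)
      = Θ * (Θᵀ * Θ) * diagNegPow lam (a + 1) * Θᵀ := by simp only [Matrix.mul_assoc]
  rw [this, hΘ, Matrix.mul_one, sub_self]

theorem proj_mul_specPow_zero {Θ : Matrix n ι ℝ} (hΘ : Θᵀ * Θ = 1) (lam : ι → ℝ) :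
    Θ * Θᵀ * specPow Θ lam 0 = 0 := by
  simp only [specPow, mul_sub, mul_one]
  have : Θ * Θᵀ * (Θ * Θᵀ) = Θ * (Θᵀ * Θ) * Θᵀ := by simp only [Matrix.mul_assoc]
  rw [this, hΘ, Matrix.mul_one, sub_self]

theorem proj_mul_specPow_succ {Θ : Matrix n ι ℝ} (hΘ : Θᵀ * Θ = 1) (lam : ι → ℝ) (a : ℕ) :
    Θ * Θᵀ * specPow Θ lam (a + 1) = specPow Θ lam (a + 1) := by
  simp only [specPow]
  have : Θ * Θᵀ * (Θ * diagNegPow lam (a + 1) * Θᵀ)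
      = Θ * (Θᵀ * Θ) * diagNegPow lam (a + 1) * Θᵀ := by simp only [Matrix.mul_assoc]
  rw [this, hΘ, Matrix.mul_one]

/-- By cyclicity the two outer factors meet around the projector. It annihilates order 0, and for
positive orders the two minus signs cancel and the exponents add. -/
theorem trace_proj_mul_resolventCoeff {Θ : Matrix n ι ℝ} (hΘ : Θᵀ * Θ = 1) (lam : ι → ℝ)
    (Y : Matrix n n ℝ) (a b : ℕ) :
    (Θ * Θᵀ * (resolventCoeff Θ lam a * (Y * resolventCoeff Θ lam b))).trace =
      if a = 0 ∨ b = 0 then 0 else (specPow Θ lam (a + b) * Y).trace := by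
  have e : (Θ * Θᵀ * (resolventCoeff Θ lam a * (Y * resolventCoeff Θ lam b))).trace
      = (resolventCoeff Θ lam b * (Θ * Θᵀ * resolventCoeff Θ lam a) * Y).trace := by
    have := Matrix.trace_mul_comm (Θ * Θᵀ * resolventCoeff Θ lam a * Y) (resolventCoeff Θ lam b)
    simpa only [Matrix.mul_assoc] using this
  rw [e]
  rcases a with _ | a
  · simp [resolventCoeff, proj_mul_specPow_zero hΘ]
  · rw [resolventCoeff, Matrix.mul_neg, proj_mul_specPow_succ hΘ]
    rcases b with _ | b
    · simp [resolventCoeff, specPow_zero_mul hΘ]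
    · rw [resolventCoeff, neg_mul_neg, specPow_mul_specPow hΘ, if_neg (by simp),
        show a + 1 + (b + 1) = b + a + 2 by ring]

section
variable {M : Type*} [AddCommMonoid M] (f : ℕ × ℕ → M)

theorem sum_antidiagonal_zero : ∑ p ∈ Finset.HasAntidiagonal.antidiagonal 0, f p = f (0, 0) := by
  simp

theorem sum_antidiagonal_one :
    ∑ p ∈ Finset.HasAntidiagonal.antidiagonal 1, f p = f (0, 1) + f (1, 0) := by
  rw [Finset.Nat.sum_antidiagonal_eq_sum_range_succ_mk]; simp [Finset.sum_range_succ]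

theorem sum_antidiagonal_two :
    ∑ p ∈ Finset.HasAntidiagonal.antidiagonal 2, f p = f (0, 2) + f (1, 1) + f (2, 0) := by
  rw [Finset.Nat.sum_antidiagonal_eq_sum_range_succ_mk]; simp [Finset.sum_range_succ]

theorem sum_antidiagonal_three :
    ∑ p ∈ Finset.HasAntidiagonal.antidiagonal 3, f p =
      f (0, 3) + f (1, 2) + f (2, 1) + f (3, 0) := by
  rw [Finset.Nat.sum_antidiagonal_eq_sum_range_succ_mk]; simp [Finset.sum_range_succ]

theorem sum_antidiagonal_four :
    ∑ p ∈ Finset.HasAntidiagonal.antidiagonal 4, f p =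
      f (0, 4) + f (1, 3) + f (2, 2) + f (3, 1) + f (4, 0) := by
  rw [Finset.Nat.sum_antidiagonal_eq_sum_range_succ_mk]; simp [Finset.sum_range_succ]

end

theorem frobInner_perturbTerm_two {Θ : Matrix n ι ℝ} (hΘ : Θᵀ * Θ = 1) (lam : ι → ℝ)
    (X : Matrix n n ℝ) :
    frobInner (Θ * Θᵀ) (perturbTerm Θ lam 2 X) =
      -(specPow Θ lam 2 * (X * specPow Θ lam 0 * X)).trace := by
  have h := fun a b c => trace_proj_mul_resolventCoeff hΘ lam (X * resolventCoeff Θ lam b * X) a c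
  rw [frobInner_proj, perturbTerm_eq_neg_interlacedCoeff, Matrix.mul_neg, Matrix.trace_neg]
  simp only [interlacedCoeff, sum_antidiagonal_zero, sum_antidiagonal_one, sum_antidiagonal_two]
  simp only [Matrix.mul_assoc] at h ⊢
  simp [h, Matrix.mul_add, Matrix.trace_add]
  simp [resolventCoeff]

/-- The first index m of q is the sum of the two outer exponents, both positive, so it arises in m -
1 ways: hence the weights 3, 2, 1. Each positive inner exponent flips the sign. -/
theorem frobInner_perturbTerm_four {Θ : Matrix n ι ℝ} (hΘ : Θᵀ * Θ = 1) (lam : ι → ℝ)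
    (X : Matrix n n ℝ) (q : ℕ → ℕ → ℕ → ℕ → ℝ)
    (hq : ∀ m a b c, q m a b c = (specPow Θ lam m * (X * specPow Θ lam a * X * specPow Θ lam b * X *
      specPow Θ lam c * X)).trace) :
    frobInner (Θ * Θᵀ) (perturbTerm Θ lam 4 X) =
      -3 * q 4 0 0 0 + 2 * (q 3 1 0 0 + q 3 0 1 0 + q 3 0 0 1)
      + (q 2 2 0 0 + q 2 0 2 0 + q 2 0 0 2) - (q 2 1 1 0 + q 2 1 0 1 + q 2 0 1 1) := by
  have h := fun a b c d e => trace_proj_mul_resolventCoeff hΘ lam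
    (X * resolventCoeff Θ lam b * X * resolventCoeff Θ lam c * X * resolventCoeff Θ lam d * X) a e
  rw [frobInner_proj, perturbTerm_eq_neg_interlacedCoeff, Matrix.mul_neg, Matrix.trace_neg]
  simp only [interlacedCoeff, sum_antidiagonal_zero, sum_antidiagonal_one, sum_antidiagonal_two,
    sum_antidiagonal_three, sum_antidiagonal_four]
  simp only [Matrix.mul_assoc] at h hq ⊢
  simp [h, Matrix.mul_add, Matrix.trace_add]
  simp [resolventCoeff, hq]
  ring

end PerturbationSeries

/-! ### Traces of words in the dilation -/

section DilationWords

theorem trace_fromBlocks_eq {m n R : Type*} [Fintype m] [Fintype n] [AddCommMonoid R]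
    (A : Matrix m m R) (B : Matrix m n R) (C : Matrix n m R) (D : Matrix n n R) :
    (Matrix.fromBlocks A B C D).trace = A.trace + D.trace := by
  simp [Matrix.trace]

variable {d₁ d₂ : ℕ}

/-- The trace of `A Z B Zᵀ C Z D Zᵀ`. -/
def alternatingWord (A : Matrix (Fin d₁) (Fin d₁) ℝ) (B : Matrix (Fin d₂) (Fin d₂) ℝ)
    (C : Matrix (Fin d₁) (Fin d₁) ℝ) (D : Matrix (Fin d₂) (Fin d₂) ℝ)
    (Z : Matrix (Fin d₁) (Fin d₂) ℝ) : ℝ :=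
  (A * Z * B * Zᵀ * C * Z * D * Zᵀ).trace

/-- The trace of `A Zᵀ B Z C Z D Zᵀ`. -/
def crossedWord (A : Matrix (Fin d₁) (Fin d₂) ℝ) (B : Matrix (Fin d₁) (Fin d₁) ℝ)
    (C : Matrix (Fin d₂) (Fin d₁) ℝ) (D : Matrix (Fin d₂) (Fin d₂) ℝ)
    (Z : Matrix (Fin d₁) (Fin d₂) ℝ) : ℝ :=
  (A * Zᵀ * B * Z * C * Z * D * Zᵀ).trace

/-- The trace of `A Z B Z C Z D Zᵀ`. -/
def unbalancedWord (A : Matrix (Fin d₁) (Fin d₁) ℝ) (B C : Matrix (Fin d₂) (Fin d₁) ℝ)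
    (D : Matrix (Fin d₂) (Fin d₂) ℝ) (Z : Matrix (Fin d₁) (Fin d₂) ℝ) : ℝ :=
  (A * Z * B * Z * C * Z * D * Zᵀ).trace

variable (Z : Matrix (Fin d₁) (Fin d₂) ℝ)
  (p₁ s₁ t₁ w₁ : Matrix (Fin d₁) (Fin d₁) ℝ) (p₂ s₂ t₂ w₂ : Matrix (Fin d₂) (Fin d₂) ℝ)
  (x x' : Matrix (Fin d₁) (Fin d₂) ℝ) (y y' : Matrix (Fin d₂) (Fin d₁) ℝ)

/-- The letters record which spectral factors are block diagonal (D) and which are off-diagonal (O),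
beginning with the outermost factor. In the four-letter cases below, cyclicity, and transposition
for words with three factors Zᵀ, reduce every trace to the three shapes whose Gaussian expectations
are known. -/
theorem trace_dilation_DD :
    (Matrix.fromBlocks p₁ 0 0 p₂ * (dilation Z * Matrix.fromBlocks s₁ 0 0 s₂ * dilation Z)).trace =
      (p₁ * Z * s₂ * Zᵀ).trace + (s₁ * Z * p₂ * Zᵀ).trace := by
  have h2 := Matrix.trace_mul_comm (p₂ * Zᵀ) (s₁ * Z)
  simp only [Matrix.mul_assoc] at h2 ⊢
  simp [dilation, Matrix.fromBlocks_multiply, trace_fromBlocks_eq, h2]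

theorem trace_dilation_DDDD :
    (Matrix.fromBlocks p₁ 0 0 p₂ * (dilation Z * Matrix.fromBlocks s₁ 0 0 s₂ * dilation Z *
      Matrix.fromBlocks t₁ 0 0 t₂ * dilation Z * Matrix.fromBlocks w₁ 0 0 w₂ * dilation Z)).trace =
      alternatingWord p₁ s₂ t₁ w₂ Z + alternatingWord s₁ t₂ w₁ p₂ Z := by
  have h2 := Matrix.trace_mul_comm (p₂ * Zᵀ) (s₁ * Z * t₂ * Zᵀ * w₁ * Z)
  unfold alternatingWord
  simp only [Matrix.mul_assoc] at h2 ⊢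
  simp [dilation, Matrix.fromBlocks_multiply, trace_fromBlocks_eq, h2]

theorem trace_dilation_OODD :
    (Matrix.fromBlocks 0 x y 0 * (dilation Z * Matrix.fromBlocks 0 x' y' 0 * dilation Z *
      Matrix.fromBlocks p₁ 0 0 p₂ * dilation Z * Matrix.fromBlocks s₁ 0 0 s₂ * dilation Z)).trace =
      unbalancedWord p₁ᵀ x'ᵀ xᵀ s₂ᵀ Z + unbalancedWord s₁ y y' p₂ Z := by
  have h1 := Matrix.trace_transpose (x * Zᵀ * x' * Zᵀ * p₁ * Z * s₂ * Zᵀ)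
  have h1' := Matrix.trace_mul_comm (Z * s₂ᵀ * Zᵀ) (p₁ᵀ * Z * x'ᵀ * Z * xᵀ)
  have h2 := Matrix.trace_mul_comm (y * Z * y' * Z * p₂ * Zᵀ) (s₁ * Z)
  unfold unbalancedWord
  simp only [Matrix.mul_assoc, Matrix.transpose_mul, Matrix.transpose_transpose] at h1 h1' h2 ⊢
  simp [dilation, Matrix.fromBlocks_multiply, trace_fromBlocks_eq, h2, ← h1, h1']

theorem trace_dilation_ODOD :
    (Matrix.fromBlocks 0 x y 0 * (dilation Z * Matrix.fromBlocks p₁ 0 0 p₂ * dilation Z *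
      Matrix.fromBlocks 0 x' y' 0 * dilation Z * Matrix.fromBlocks s₁ 0 0 s₂ * dilation Z)).trace =
      crossedWord x p₁ y' s₂ Z + crossedWord x' s₁ y p₂ Z := by
  have h2 := Matrix.trace_mul_comm (y * Z * p₂ * Zᵀ) (x' * Zᵀ * s₁ * Z)
  unfold crossedWord
  simp only [Matrix.mul_assoc] at h2 ⊢
  simp [dilation, Matrix.fromBlocks_multiply, trace_fromBlocks_eq, h2]

theorem trace_dilation_ODDO :
    (Matrix.fromBlocks 0 x y 0 * (dilation Z * Matrix.fromBlocks p₁ 0 0 p₂ * dilation Z *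
      Matrix.fromBlocks s₁ 0 0 s₂ * dilation Z * Matrix.fromBlocks 0 x' y' 0 * dilation Z)).trace =
      unbalancedWord p₁ᵀ xᵀ x'ᵀ s₂ᵀ Z + unbalancedWord s₁ y' y p₂ Z := by
  have h1 := Matrix.trace_transpose (x * Zᵀ * p₁ * Z * s₂ * Zᵀ * x' * Zᵀ)
  have h1' := Matrix.trace_mul_comm (Z * x'ᵀ * Z * s₂ᵀ * Zᵀ) (p₁ᵀ * Z * xᵀ)
  have h2 := Matrix.trace_mul_comm (y * Z * p₂ * Zᵀ) (s₁ * Z * y' * Z)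
  unfold unbalancedWord
  simp only [Matrix.mul_assoc, Matrix.transpose_mul, Matrix.transpose_transpose] at h1 h1' h2 ⊢
  simp [dilation, Matrix.fromBlocks_multiply, trace_fromBlocks_eq, h2, ← h1, h1']

theorem trace_dilation_DOOD :
    (Matrix.fromBlocks p₁ 0 0 p₂ * (dilation Z * Matrix.fromBlocks 0 x y 0 * dilation Z *
      Matrix.fromBlocks 0 x' y' 0 * dilation Z * Matrix.fromBlocks s₁ 0 0 s₂ * dilation Z)).trace =
      unbalancedWord p₁ y y' s₂ Z + unbalancedWord s₁ᵀ x'ᵀ xᵀ p₂ᵀ Z := by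
  have h1 := Matrix.trace_transpose (p₂ * Zᵀ * x * Zᵀ * x' * Zᵀ * s₁ * Z)
  have h1' := Matrix.trace_mul_comm Zᵀ (s₁ᵀ * Z * x'ᵀ * Z * xᵀ * Z * p₂ᵀ)
  unfold unbalancedWord
  simp only [Matrix.mul_assoc, Matrix.transpose_mul, Matrix.transpose_transpose] at h1 h1' ⊢
  simp [dilation, Matrix.fromBlocks_multiply, trace_fromBlocks_eq, ← h1, h1']

theorem trace_dilation_DODO :
    (Matrix.fromBlocks p₁ 0 0 p₂ * (dilation Z * Matrix.fromBlocks 0 x y 0 * dilation Z *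
      Matrix.fromBlocks s₁ 0 0 s₂ * dilation Z * Matrix.fromBlocks 0 x' y' 0 * dilation Z)).trace =
      crossedWord x' p₁ y s₂ Z + crossedWord x s₁ y' p₂ Z := by
  have h1 := Matrix.trace_mul_comm (p₁ * Z * y * Z * s₂ * Zᵀ) (x' * Zᵀ)
  have h2 := Matrix.trace_mul_comm (p₂ * Zᵀ) (x * Zᵀ * s₁ * Z * y' * Z)
  unfold crossedWord
  simp only [Matrix.mul_assoc] at h1 h2 ⊢
  simp [dilation, Matrix.fromBlocks_multiply, trace_fromBlocks_eq, h1, h2]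

theorem trace_dilation_DDOO :
    (Matrix.fromBlocks p₁ 0 0 p₂ * (dilation Z * Matrix.fromBlocks s₁ 0 0 s₂ * dilation Z *
      Matrix.fromBlocks 0 x y 0 * dilation Z * Matrix.fromBlocks 0 x' y' 0 * dilation Z)).trace =
      unbalancedWord p₁ᵀ x'ᵀ xᵀ s₂ᵀ Z + unbalancedWord s₁ y y' p₂ Z := by
  have h1 := Matrix.trace_transpose (p₁ * Z * s₂ * Zᵀ * x * Zᵀ * x' * Zᵀ)
  have h1' := Matrix.trace_mul_comm (Z * x'ᵀ * Z * xᵀ * Z * s₂ᵀ * Zᵀ) p₁ᵀ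
  have h2 := Matrix.trace_mul_comm (p₂ * Zᵀ) (s₁ * Z * y * Z * y' * Z)
  unfold unbalancedWord
  simp only [Matrix.mul_assoc, Matrix.transpose_mul, Matrix.transpose_transpose] at h1 h1' h2 ⊢
  simp [dilation, Matrix.fromBlocks_multiply, trace_fromBlocks_eq, h2, ← h1, h1']

end DilationWords

/-! ### Block form of the spectral powers of the dilation -/

section DilationSpectrum

variable {d₁ d₂ r : ℕ} {U : Matrix (Fin d₁) (Fin r) ℝ} {V : Matrix (Fin d₂) (Fin r) ℝ}

theorem inv_sqrt_two_mul_self : (√2)⁻¹ * (√2)⁻¹ = (1 / 2 : ℝ) := by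
  rw [← mul_inv, Real.mul_self_sqrt (by norm_num)]; norm_num

theorem dilVec_transpose_mul_self (hU : Uᵀ * U = 1) (hV : Vᵀ * V = 1) :
    (dilVec U V)ᵀ * dilVec U V = 1 := by
  simp only [dilVec, Matrix.transpose_smul, Matrix.fromBlocks_transpose, Matrix.smul_mul,
    Matrix.mul_smul, smul_smul, inv_sqrt_two_mul_self, Matrix.fromBlocks_multiply,
    Matrix.transpose_neg, Matrix.mul_neg, Matrix.neg_mul, hU, hV, neg_neg]
  rw [← Matrix.fromBlocks_one, Matrix.fromBlocks_smul]
  congr 1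
  · rw [← two_smul ℝ (1 : Matrix (Fin r) (Fin r) ℝ), smul_smul]; norm_num
  · simp
  · simp
  · rw [← two_smul ℝ (1 : Matrix (Fin r) (Fin r) ℝ), smul_smul]; norm_num

theorem dilVec_mul_transpose (U : Matrix (Fin d₁) (Fin r) ℝ) (V : Matrix (Fin d₂) (Fin r) ℝ) :
    dilVec U V * (dilVec U V)ᵀ = Matrix.fromBlocks (U * Uᵀ) 0 0 (V * Vᵀ) := by
  simp only [dilVec, Matrix.transpose_smul, Matrix.fromBlocks_transpose, Matrix.smul_mul,
    Matrix.mul_smul, smul_smul, inv_sqrt_two_mul_self, Matrix.fromBlocks_multiply,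
    Matrix.transpose_neg, Matrix.mul_neg, Matrix.neg_mul, smul_neg, neg_neg,
    Matrix.fromBlocks_smul]
  congr 1 <;> module

theorem specPow_dil_zero (lam : Fin r → ℝ) : specPow (dilVec U V) (dilVal lam) 0 =
    Matrix.fromBlocks (1 - U * Uᵀ) 0 0 (1 - V * Vᵀ) := by
  rw [specPow, dilVec_mul_transpose, ← Matrix.fromBlocks_one, sub_eq_add_neg,
    Matrix.fromBlocks_neg, Matrix.fromBlocks_add]
  simp [sub_eq_add_neg]

theorem diagNegPow_dilVal (lam : Fin r → ℝ) (k : ℕ) : diagNegPow (dilVal lam) k =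
    Matrix.fromBlocks (diagNegPow lam k) 0 0 ((-1 : ℝ) ^ k • diagNegPow lam k) := by
  simp only [diagNegPow]
  rw [← Matrix.diagonal_smul, Matrix.fromBlocks_diagonal]
  congr 1
  ext i
  rcases i with i | i
  · simp [dilVal]
  · simp only [dilVal, Sum.elim_inr, Pi.smul_apply, smul_eq_mul]
    rw [neg_pow, mul_inv, ← inv_pow, inv_neg_one]

/-- The eigenvectors of λᵢ and -λᵢ have cross blocks of opposite sign and equal diagonal blocks.
Even powers weigh the two equally, so cross blocks cancel; odd powers weigh them oppositely, so
diagonal blocks cancel. -/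
theorem specPow_dil_even (lam : Fin r → ℝ) {k : ℕ} (hk : Even k) (hk0 : k ≠ 0) :
    specPow (dilVec U V) (dilVal lam) k =
      Matrix.fromBlocks (U * diagNegPow lam k * Uᵀ) 0 0 (V * diagNegPow lam k * Vᵀ) := by
  obtain ⟨k, rfl⟩ := Nat.exists_eq_succ_of_ne_zero hk0
  rw [Nat.succ_eq_add_one] at *
  rw [specPow, diagNegPow_dilVal, hk.neg_one_pow, one_smul]
  simp only [dilVec, Matrix.transpose_smul, Matrix.fromBlocks_transpose, Matrix.smul_mul,
    Matrix.mul_smul, smul_smul, inv_sqrt_two_mul_self, Matrix.fromBlocks_multiply,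
    Matrix.transpose_neg, Matrix.mul_neg, Matrix.neg_mul, smul_neg, neg_neg,
    Matrix.fromBlocks_smul,
    Matrix.mul_zero, add_zero, zero_add]
  congr 1 <;> module

theorem specPow_dil_odd (lam : Fin r → ℝ) {k : ℕ} (hk : Odd k) :
    specPow (dilVec U V) (dilVal lam) k =
      Matrix.fromBlocks 0 (U * diagNegPow lam k * Vᵀ) (V * diagNegPow lam k * Uᵀ) 0 := by
  obtain ⟨k, rfl⟩ := Nat.exists_eq_succ_of_ne_zero hk.pos.ne'
  rw [Nat.succ_eq_add_one] at *
  rw [specPow, diagNegPow_dilVal, hk.neg_one_pow, neg_one_smul]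
  simp only [dilVec, Matrix.transpose_smul, Matrix.fromBlocks_transpose, Matrix.smul_mul,
    Matrix.mul_smul, smul_smul, inv_sqrt_two_mul_self, Matrix.fromBlocks_multiply,
    Matrix.transpose_neg, Matrix.mul_neg, Matrix.neg_mul, smul_neg, neg_neg,
    Matrix.fromBlocks_smul,
    Matrix.mul_zero, add_zero, zero_add]
  congr 1 <;> module

end DilationSpectrum

/-! ### Exact expectations at second and fourth order -/

section Expectation

/-- `f` is integrable under `μ` with integral `c`. -/
def HasExpectation {α : Type*} [MeasurableSpace α] (f : α → ℝ) (c : ℝ) (μ : Measure α) : Prop :=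
  Integrable f μ ∧ ∫ x, f x ∂μ = c

theorem HasExpectation.add {α : Type*} [MeasurableSpace α] {μ : Measure α} {f g : α → ℝ} {a b : ℝ}
    (hf : HasExpectation f a μ) (hg : HasExpectation g b μ) :
    HasExpectation (fun x => f x + g x) (a + b) μ :=
  ⟨hf.1.add hg.1, by rw [integral_add hf.1 hg.1, hf.2, hg.2]⟩

theorem HasExpectation.sub {α : Type*} [MeasurableSpace α] {μ : Measure α} {f g : α → ℝ} {a b : ℝ}
    (hf : HasExpectation f a μ) (hg : HasExpectation g b μ) :
    HasExpectation (fun x => f x - g x) (a - b) μ :=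
  ⟨hf.1.sub hg.1, by rw [integral_sub hf.1 hg.1, hf.2, hg.2]⟩

theorem HasExpectation.const_mul {α : Type*} [MeasurableSpace α] {μ : Measure α} {f : α → ℝ}
    {a : ℝ} (hf : HasExpectation f a μ) (c : ℝ) : HasExpectation (fun x => c * f x) (c * a) μ :=
  ⟨hf.1.const_mul c, by rw [integral_const_mul, hf.2]⟩

variable {d₁ d₂ r : ℕ}

theorem hasExpectation_alternatingWord (A C : Matrix (Fin d₁) (Fin d₁) ℝ)
    (B D : Matrix (Fin d₂) (Fin d₂) ℝ) :
    HasExpectation (fun z => alternatingWord A B C D (matOf z))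
      ((A * C).trace * B.trace * D.trace + (A * Cᵀ).trace * (B * Dᵀ).trace
        + A.trace * C.trace * (B * D).trace) (stdGaussianPi (Fin d₁ × Fin d₂)) :=
  ⟨integrable_trace_alternating A C B D, integral_trace_alternating A C B D⟩

theorem hasExpectation_crossedWord (A : Matrix (Fin d₁) (Fin d₂) ℝ)
    (B : Matrix (Fin d₁) (Fin d₁) ℝ) (C : Matrix (Fin d₂) (Fin d₁) ℝ)
    (D : Matrix (Fin d₂) (Fin d₂) ℝ) :
    HasExpectation (fun z => crossedWord A B C D (matOf z))
      ((A * C).trace * B.trace * D.trace + (A * D * C * B).trace + (A * Dᵀ * C * Bᵀ).trace)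
      (stdGaussianPi (Fin d₁ × Fin d₂)) :=
  ⟨integrable_trace_crossed A B C D, integral_trace_crossed A B C D⟩

theorem hasExpectation_unbalancedWord (A : Matrix (Fin d₁) (Fin d₁) ℝ)
    (B C : Matrix (Fin d₂) (Fin d₁) ℝ) (D : Matrix (Fin d₂) (Fin d₂) ℝ) :
    HasExpectation (fun z => unbalancedWord A B C D (matOf z))
      ((A * Bᵀ * C).trace * D.trace + (A * Cᵀ * Dᵀ * B).trace + A.trace * (B * Cᵀ * D).trace)
      (stdGaussianPi (Fin d₁ × Fin d₂)) :=
  ⟨integrable_trace_unbalanced A B C D, integral_trace_unbalanced A B C D⟩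

theorem diagNegPow_mul_diagNegPow_mul {κ : Type*} (lam : Fin r → ℝ) (a b : ℕ)
    (M : Matrix (Fin r) κ ℝ) :
    diagNegPow lam a * (diagNegPow lam b * M) = diagNegPow lam (a + b) * M := by
  rw [← Matrix.mul_assoc, diagNegPow, diagNegPow, Matrix.diagonal_mul_diagonal, diagNegPow]
  congr 2
  ext i
  rw [← mul_inv, ← pow_add]

theorem transpose_diagNegPow (lam : Fin r → ℝ) (a : ℕ) :
    (diagNegPow lam a)ᵀ = diagNegPow lam a := Matrix.diagonal_transpose _

theorem trace_isometry_mul {d : ℕ} {W : Matrix (Fin d) (Fin r) ℝ} (hW : Wᵀ * W = 1)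
    (D : Matrix (Fin r) (Fin r) ℝ) : (W * (D * Wᵀ)).trace = D.trace := by
  rw [Matrix.trace_mul_comm, Matrix.mul_assoc, hW, Matrix.mul_one]

theorem transpose_mul_isometry_mul {d : ℕ} {W : Matrix (Fin d) (Fin r) ℝ} (hW : Wᵀ * W = 1)
    {κ : Type*} (M : Matrix (Fin r) κ ℝ) : Wᵀ * (W * M) = M := by
  rw [← Matrix.mul_assoc, hW, Matrix.one_mul]

theorem transpose_mul_complement {d : ℕ} {W : Matrix (Fin d) (Fin r) ℝ} (hW : Wᵀ * W = 1) :
    Wᵀ * (1 - W * Wᵀ) = 0 := by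
  rw [Matrix.mul_sub, Matrix.mul_one, transpose_mul_isometry_mul hW, sub_self]

theorem complement_mul {d : ℕ} {W : Matrix (Fin d) (Fin r) ℝ} (hW : Wᵀ * W = 1) :
    (1 - W * Wᵀ) * W = 0 := by
  rw [Matrix.sub_mul, Matrix.one_mul, Matrix.mul_assoc, hW, Matrix.mul_one, sub_self]

theorem transpose_complement {d : ℕ} (W : Matrix (Fin d) (Fin r) ℝ) :
    (1 - W * Wᵀ)ᵀ = 1 - W * Wᵀ := by
  simp [Matrix.transpose_sub, Matrix.transpose_mul]

theorem complement_mul_self {d : ℕ} {W : Matrix (Fin d) (Fin r) ℝ} (hW : Wᵀ * W = 1) :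
    (1 - W * Wᵀ) * (1 - W * Wᵀ) = 1 - W * Wᵀ := by
  rw [Matrix.mul_sub, Matrix.mul_one, ← Matrix.mul_assoc, complement_mul hW, Matrix.zero_mul,
    sub_zero]

theorem trace_complement {d : ℕ} {W : Matrix (Fin d) (Fin r) ℝ} (hW : Wᵀ * W = 1) :
    (1 - W * Wᵀ).trace = (d : ℝ) - (r : ℝ) := by
  rw [Matrix.trace_sub, Matrix.trace_mul_comm, hW]; simp

variable {U : Matrix (Fin d₁) (Fin r) ℝ} {V : Matrix (Fin d₂) (Fin r) ℝ}

/-- Since E tr(A Z B Zᵀ) = tr A tr B, the two blocks contribute (d₂ - r) tr Λ⁻² and (d₁ - r) tr Λ⁻².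
-/
theorem hasExpectation_perturbTerm_two (hU : Uᵀ * U = 1) (hV : Vᵀ * V = 1) (lam : Fin r → ℝ) :
    HasExpectation (fun z => frobInner (dilVec U V * (dilVec U V)ᵀ)
      (perturbTerm (dilVec U V) (dilVal lam) 2 (dilation (matOf z))))
      (-((d₁ + d₂ - 2 * r) * (diagNegPow lam 2).trace)) (stdGaussianPi (Fin d₁ × Fin d₂)) := by
  simp only [frobInner_perturbTerm_two (dilVec_transpose_mul_self hU hV),
    specPow_dil_even lam even_two two_ne_zero, specPow_dil_zero, trace_dilation_DD]
  have h1 : HasExpectation (fun z => (U * diagNegPow lam 2 * Uᵀ * matOf z * (1 - V * Vᵀ)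
      * (matOf z)ᵀ).trace) _ (stdGaussianPi (Fin d₁ × Fin d₂)) :=
    ⟨integrable_trace_quadratic _ _, integral_trace_quadratic _ _⟩
  have h2 : HasExpectation (fun z => ((1 - U * Uᵀ) * matOf z * (V * diagNegPow lam 2 * Vᵀ)
      * (matOf z)ᵀ).trace) _ (stdGaussianPi (Fin d₁ × Fin d₂)) :=
    ⟨integrable_trace_quadratic _ _, integral_trace_quadratic _ _⟩
  have h := (h1.add h2).const_mul (-1)
  simp only [Matrix.mul_assoc U, Matrix.mul_assoc V, trace_isometry_mul hU, trace_isometry_mul hV,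
    trace_complement hU, trace_complement hV, neg_one_mul] at h ⊢
  convert h using 1
  ring

set_option linter.unusedSimpArgs false in
-- Put a = d₁ - r, b = d₂ - r. The words 4000 and 3010 contribute (-3 + 2)·2ab S, the word 2020
-- contributes (a² + b² + a + b) S + (a + b) T², and the words 2110, 2011, 2101 subtract 2(a + b) S
-- + (a + b) T². The T² terms cancel and the rest is ((a - b)² - (a + b)) S.
theorem hasExpectation_perturbTerm_four (hU : Uᵀ * U = 1) (hV : Vᵀ * V = 1) (lam : Fin r → ℝ) :
    HasExpectation (fun z => frobInner (dilVec U V * (dilVec U V)ᵀ)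
      (perturbTerm (dilVec U V) (dilVal lam) 4 (dilation (matOf z))))
      (((d₁ - d₂) ^ 2 - (d₁ + d₂ - 2 * r)) * (diagNegPow lam 4).trace)
      (stdGaussianPi (Fin d₁ × Fin d₂)) := by
  set T := (diagNegPow lam 2).trace with hT
  set S := (diagNegPow lam 4).trace with hS
  have e1 := @specPow_dil_odd d₁ d₂ r U V lam 1 (by decide)
  have e2 := @specPow_dil_even d₁ d₂ r U V lam 2 (by decide) (by decide)
  have e3 := @specPow_dil_odd d₁ d₂ r U V lam 3 (by decide)
  have e4 := @specPow_dil_even d₁ d₂ r U V lam 4 (by decide) (by decide)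
  have e0 := @specPow_dil_zero d₁ d₂ r U V lam
  have hUQ := transpose_mul_complement hU
  have hQU := complement_mul hU
  have hQQ := complement_mul_self hU
  have hQT := transpose_complement U
  have hQt := trace_complement hU
  have hVQ := transpose_mul_complement hV
  have hQV := complement_mul hV
  have hRR := complement_mul_self hV
  have hRT := transpose_complement V
  have hRt := trace_complement hV
  have hUU := fun (κ : Type) (M : Matrix (Fin r) κ ℝ) => transpose_mul_isometry_mul hU M
  have hVV := fun (κ : Type) (M : Matrix (Fin r) κ ℝ) => transpose_mul_isometry_mul hV M
  have htU := trace_isometry_mul hU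
  have htV := trace_isometry_mul hV
  -- Only the products of the complements with U, V and themselves, their symmetry and their traces
  -- matter from here on; hiding their form keeps `simp` from expanding them.
  generalize 1 - U * Uᵀ = Q at *
  generalize 1 - V * Vᵀ = R at *
  have hQU' : ∀ (κ : Type) (M : Matrix (Fin r) κ ℝ), Q * (U * M) = 0 := fun κ M => by
    rw [← Matrix.mul_assoc, hQU, Matrix.zero_mul]
  have hQV' : ∀ (κ : Type) (M : Matrix (Fin r) κ ℝ), R * (V * M) = 0 := fun κ M => by
    rw [← Matrix.mul_assoc, hQV, Matrix.zero_mul]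
  have hUQ' : ∀ (κ : Type) (M : Matrix (Fin d₁) κ ℝ), Uᵀ * (Q * M) = 0 := fun κ M => by
    rw [← Matrix.mul_assoc, hUQ, Matrix.zero_mul]
  have hVQ' : ∀ (κ : Type) (M : Matrix (Fin d₂) κ ℝ), Vᵀ * (R * M) = 0 := fun κ M => by
    rw [← Matrix.mul_assoc, hVQ, Matrix.zero_mul]
  let q : ℕ → ℕ → ℕ → ℕ → (Fin d₁ × Fin d₂ → ℝ) → ℝ := fun m a b c z =>
    (specPow (dilVec U V) (dilVal lam) m * (dilation (matOf z) *
      specPow (dilVec U V) (dilVal lam) a * dilation (matOf z) *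
      specPow (dilVec U V) (dilVal lam) b * dilation (matOf z) *
      specPow (dilVec U V) (dilVal lam) c * dilation (matOf z))).trace
  have q4000 : HasExpectation (q 4 0 0 0) (2 * (d₁ - r) * (d₂ - r) * S) (stdGaussianPi _) := by
    simp only [q, e0, e1, e2, e3, e4, trace_dilation_DDDD]
    have h := (hasExpectation_alternatingWord (U * diagNegPow lam 4 * Uᵀ) Q R R).add
      (hasExpectation_alternatingWord Q Q R (V * diagNegPow lam 4 * Vᵀ))
    convert h using 1
    simp [Matrix.mul_assoc, Matrix.transpose_mul, diagNegPow_mul_diagNegPow_mul, transpose_diagNegPow,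
      hUQ, hQU, hQQ, hQT, hQt, hVQ, hQV, hRR, hRT, hRt, hUU, hVV, htU, htV, hQU', hQV', hUQ', hVQ',
      ← hS, ← hT]
    ring
  have q3100 : HasExpectation (q 3 1 0 0) 0 (stdGaussianPi _) := by
    simp only [q, e0, e1, e2, e3, e4, trace_dilation_OODD]
    have h := (hasExpectation_unbalancedWord Qᵀ (U * diagNegPow lam 1 * Vᵀ)ᵀ
      (U * diagNegPow lam 3 * Vᵀ)ᵀ Rᵀ).add (hasExpectation_unbalancedWord Q
      (V * diagNegPow lam 3 * Uᵀ) (V * diagNegPow lam 1 * Uᵀ) R)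
    convert h using 1
    simp [Matrix.mul_assoc, Matrix.transpose_mul, diagNegPow_mul_diagNegPow_mul, transpose_diagNegPow,
      hUQ, hQU, hQQ, hQT, hQt, hVQ, hQV, hRR, hRT, hRt, hUU, hVV, htU, htV, hQU', hQV', hUQ', hVQ',
      ← hS, ← hT]
  have q3001 : HasExpectation (q 3 0 0 1) 0 (stdGaussianPi _) := by
    simp only [q, e0, e1, e2, e3, e4, trace_dilation_ODDO]
    have h := (hasExpectation_unbalancedWord Qᵀ (U * diagNegPow lam 3 * Vᵀ)ᵀ
      (U * diagNegPow lam 1 * Vᵀ)ᵀ Rᵀ).add (hasExpectation_unbalancedWord Q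
      (V * diagNegPow lam 1 * Uᵀ) (V * diagNegPow lam 3 * Uᵀ) R)
    convert h using 1
    simp [Matrix.mul_assoc, Matrix.transpose_mul, diagNegPow_mul_diagNegPow_mul, transpose_diagNegPow,
      hUQ, hQU, hQQ, hQT, hQt, hVQ, hQV, hRR, hRT, hRt, hUU, hVV, htU, htV, hQU', hQV', hUQ', hVQ',
      ← hS, ← hT]
  have q3010 : HasExpectation (q 3 0 1 0) (2 * (d₁ - r) * (d₂ - r) * S) (stdGaussianPi _) := by
    simp only [q, e0, e1, e2, e3, e4, trace_dilation_ODOD]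
    have h := (hasExpectation_crossedWord (U * diagNegPow lam 3 * Vᵀ) Q
      (V * diagNegPow lam 1 * Uᵀ) R).add (hasExpectation_crossedWord (U * diagNegPow lam 1 * Vᵀ) Q
      (V * diagNegPow lam 3 * Uᵀ) R)
    convert h using 1
    simp [Matrix.mul_assoc, Matrix.transpose_mul, diagNegPow_mul_diagNegPow_mul, transpose_diagNegPow,
      hUQ, hQU, hQQ, hQT, hQt, hVQ, hQV, hRR, hRT, hRt, hUU, hVV, htU, htV, hQU', hQV', hUQ', hVQ',
      ← hS, ← hT]
    ring
  have q2200 : HasExpectation (q 2 2 0 0) 0 (stdGaussianPi _) := by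
    simp only [q, e0, e1, e2, e3, e4, trace_dilation_DDDD]
    have h := (hasExpectation_alternatingWord (U * diagNegPow lam 2 * Uᵀ) Q
      (V * diagNegPow lam 2 * Vᵀ) R).add (hasExpectation_alternatingWord
      (U * diagNegPow lam 2 * Uᵀ) Q R (V * diagNegPow lam 2 * Vᵀ))
    convert h using 1
    simp [Matrix.mul_assoc, Matrix.transpose_mul, diagNegPow_mul_diagNegPow_mul, transpose_diagNegPow,
      hUQ, hQU, hQQ, hQT, hQt, hVQ, hQV, hRR, hRT, hRt, hUU, hVV, htU, htV, hQU', hQV', hUQ', hVQ',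
      ← hS, ← hT]
  have q2002 : HasExpectation (q 2 0 0 2) 0 (stdGaussianPi _) := by
    simp only [q, e0, e1, e2, e3, e4, trace_dilation_DDDD]
    have h := (hasExpectation_alternatingWord (U * diagNegPow lam 2 * Uᵀ) Q R
      (V * diagNegPow lam 2 * Vᵀ)).add (hasExpectation_alternatingWord Q
      (U * diagNegPow lam 2 * Uᵀ) R (V * diagNegPow lam 2 * Vᵀ))
    convert h using 1
    simp [Matrix.mul_assoc, Matrix.transpose_mul, diagNegPow_mul_diagNegPow_mul, transpose_diagNegPow,
      hUQ, hQU, hQQ, hQT, hQt, hVQ, hQV, hRR, hRT, hRt, hUU, hVV, htU, htV, hQU', hQV', hUQ', hVQ',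
      ← hS, ← hT]
  have q2020 : HasExpectation (q 2 0 2 0) (((d₁ - r) ^ 2 + (d₂ - r) ^ 2 + (d₁ - r) + (d₂ - r)) * S
      + ((d₁ - r) + (d₂ - r)) * T ^ 2) (stdGaussianPi _) := by
    simp only [q, e0, e1, e2, e3, e4, trace_dilation_DDDD]
    have h := (hasExpectation_alternatingWord (U * diagNegPow lam 2 * Uᵀ)
      (U * diagNegPow lam 2 * Uᵀ) R R).add (hasExpectation_alternatingWord Q Q
      (V * diagNegPow lam 2 * Vᵀ) (V * diagNegPow lam 2 * Vᵀ))
    convert h using 1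
    simp [Matrix.mul_assoc, Matrix.transpose_mul, diagNegPow_mul_diagNegPow_mul, transpose_diagNegPow,
      hUQ, hQU, hQQ, hQT, hQt, hVQ, hQV, hRR, hRT, hRt, hUU, hVV, htU, htV, hQU', hQV', hUQ', hVQ',
      ← hS, ← hT]
    ring
  have q2110 : HasExpectation (q 2 1 1 0) (((d₁ - r) + (d₂ - r)) * S) (stdGaussianPi _) := by
    simp only [q, e0, e1, e2, e3, e4, trace_dilation_DOOD]
    have h := (hasExpectation_unbalancedWord (U * diagNegPow lam 2 * Uᵀ)
      (V * diagNegPow lam 1 * Uᵀ) (V * diagNegPow lam 1 * Uᵀ) R).add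
      (hasExpectation_unbalancedWord Qᵀ (U * diagNegPow lam 1 * Vᵀ)ᵀ
      (U * diagNegPow lam 1 * Vᵀ)ᵀ (V * diagNegPow lam 2 * Vᵀ)ᵀ)
    convert h using 1
    simp [Matrix.mul_assoc, Matrix.transpose_mul, diagNegPow_mul_diagNegPow_mul, transpose_diagNegPow,
      hUQ, hQU, hQQ, hQT, hQt, hVQ, hQV, hRR, hRT, hRt, hUU, hVV, htU, htV, hQU', hQV', hUQ', hVQ',
      ← hS, ← hT]
    ring
  have q2011 : HasExpectation (q 2 0 1 1) (((d₁ - r) + (d₂ - r)) * S) (stdGaussianPi _) := by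
    simp only [q, e0, e1, e2, e3, e4, trace_dilation_DDOO]
    have h := (hasExpectation_unbalancedWord (U * diagNegPow lam 2 * Uᵀ)ᵀ
      (U * diagNegPow lam 1 * Vᵀ)ᵀ (U * diagNegPow lam 1 * Vᵀ)ᵀ Rᵀ).add
      (hasExpectation_unbalancedWord Q (V * diagNegPow lam 1 * Uᵀ)
      (V * diagNegPow lam 1 * Uᵀ) (V * diagNegPow lam 2 * Vᵀ))
    convert h using 1
    simp [Matrix.mul_assoc, Matrix.transpose_mul, diagNegPow_mul_diagNegPow_mul, transpose_diagNegPow,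
      hUQ, hQU, hQQ, hQT, hQt, hVQ, hQV, hRR, hRT, hRt, hUU, hVV, htU, htV, hQU', hQV', hUQ', hVQ',
      ← hS, ← hT]
    ring
  have q2101 : HasExpectation (q 2 1 0 1) (((d₁ - r) + (d₂ - r)) * T ^ 2) (stdGaussianPi _) := by
    simp only [q, e0, e1, e2, e3, e4, trace_dilation_DODO]
    have h := (hasExpectation_crossedWord (U * diagNegPow lam 1 * Vᵀ) (U * diagNegPow lam 2 * Uᵀ)
      (V * diagNegPow lam 1 * Uᵀ) R).add (hasExpectation_crossedWord (U * diagNegPow lam 1 * Vᵀ) Q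
      (V * diagNegPow lam 1 * Uᵀ) (V * diagNegPow lam 2 * Vᵀ))
    convert h using 1
    simp [Matrix.mul_assoc, Matrix.transpose_mul, diagNegPow_mul_diagNegPow_mul, transpose_diagNegPow,
      hUQ, hQU, hQQ, hQT, hQt, hVQ, hQV, hRR, hRT, hRt, hUU, hVV, htU, htV, hQU', hQV', hUQ', hVQ',
      ← hS, ← hT]
    ring
  have h := (((q4000.const_mul (-3)).add (((q3100.add q3010).add q3001).const_mul 2)).add
    ((q2200.add q2020).add q2002)).sub ((q2110.add q2101).add q2011)
  have hf : ∀ z : Fin d₁ × Fin d₂ → ℝ, _ := fun z => frobInner_perturbTerm_four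
    (dilVec_transpose_mul_self hU hV) (dilVal lam) (dilation (matOf z))
    (fun m a b c => q m a b c z) fun _ _ _ _ => rfl
  simp only [hf]
  convert h using 1
  ring

end Expectation

/-! ### Cauchy's coefficient formula through Taylor tails -/

section ScalarContour

theorem ne_zero_of_mem_sphere_zero {ρ : ℝ} (hρ : 0 < ρ) {z : ℂ} (hz : z ∈ Metric.sphere (0 : ℂ) ρ) :
    z ≠ 0 := by
  rintro rfl
  simp at hz; linarith

theorem circleIntegrable_zpow_mul {ρ l : ℝ} (hρ : 0 < ρ) (hl : ρ < l) (k : ℤ) {f : ℂ → ℂ}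
    (hf : DifferentiableOn ℂ f (Metric.ball 0 l)) :
    CircleIntegrable (fun z => z ^ k * f z) 0 ρ := by
  refine ContinuousOn.circleIntegrable hρ.le (ContinuousOn.mul (fun z hz => ?_) ?_)
  · exact (continuousAt_zpow₀ z k (Or.inl (ne_zero_of_mem_sphere_zero hρ hz))).continuousWithinAt
  · exact hf.continuousOn.mono
      (Metric.sphere_subset_closedBall.trans (Metric.closedBall_subset_ball hl))

/-- Peeling off a 0 leaves a pure power z^(-m-1), which integrates to zero unless m = 0, and the
next tail with the pole order lowered by one. At m = 0 the holomorphic tail integrates to zero.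
Describing a function by its tails avoids derivatives and power series of matrix products. -/
theorem circleIntegral_zpow_mul_of_tails {ρ l : ℝ} (hρ : 0 < ρ) (hl : ρ < l) (m : ℕ)
    (t : ℕ → ℂ → ℂ) (a : ℕ → ℂ) (hd : ∀ k, DifferentiableOn ℂ (t k) (Metric.ball 0 l))
    (ht : ∀ k, ∀ z ∈ Metric.ball (0 : ℂ) l, t k z = a k + z * t (k + 1) z) :
    (∮ z in C(0, ρ), z ^ (-(m + 1 : ℤ)) * t 0 z) = 2 * Real.pi * Complex.I * a m := by
  have hsub : Metric.closedBall (0 : ℂ) ρ ⊆ Metric.ball 0 l := Metric.closedBall_subset_ball hl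
  have hsph : Metric.sphere (0 : ℂ) ρ ⊆ Metric.ball 0 l :=
    Metric.sphere_subset_closedBall.trans hsub
  induction m generalizing t a with
  | zero =>
    have h1 : (∮ z in C(0, ρ), z⁻¹) = 2 * Real.pi * Complex.I := by
      simpa using circleIntegral.integral_sub_center_inv (0 : ℂ) hρ.ne'
    have h0 : (∮ z in C(0, ρ), t 1 z) = 0 :=
      Complex.circleIntegral_eq_zero_of_differentiable_on_off_countable hρ.le
        Set.countable_empty ((hd 1).continuousOn.mono hsub) fun z hz =>
        (hd 1).differentiableAt (Metric.isOpen_ball.mem_nhds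
          (hsub (Metric.ball_subset_closedBall hz.1)))
    have hi : CircleIntegrable (fun z : ℂ => a 0 * z⁻¹) 0 ρ := by
      have := circleIntegrable_zpow_mul hρ hl (-1) (f := fun _ => a 0) (differentiableOn_const _)
      simpa [mul_comm] using this
    have hi1 : CircleIntegrable (t 1) 0 ρ := by
      simpa using circleIntegrable_zpow_mul hρ hl 0 (hd 1)
    calc (∮ z in C(0, ρ), z ^ (-((0 : ℕ) + 1 : ℤ)) * t 0 z)
        = ∮ z in C(0, ρ), (a 0 * z⁻¹ + t 1 z) := by
          refine circleIntegral.integral_congr hρ.le fun z hz => ?_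
          have hz0 := ne_zero_of_mem_sphere_zero hρ hz
          simp only [Nat.cast_zero, zero_add, zpow_neg_one]
          rw [ht 0 z (hsph hz)]
          field_simp
      _ = _ := by
          rw [circleIntegral.integral_add hi hi1, circleIntegral.integral_const_mul, h1, h0]
          ring
  | succ m ih =>
    have h1 : (∮ z in C(0, ρ), z ^ (-((m + 1 : ℕ) + 1 : ℤ))) = 0 := by
      have := circleIntegral.integral_sub_zpow_of_ne (n := -((m + 1 : ℕ) + 1 : ℤ))
        (by push_cast; omega) (0 : ℂ) 0 ρ
      simpa using this
    have h2 := ih (fun k => t (k + 1)) (fun k => a (k + 1)) (fun k => hd _) (fun k => ht _)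
    have hi : CircleIntegrable (fun z : ℂ => a 0 * z ^ (-((m + 1 : ℕ) + 1 : ℤ))) 0 ρ := by
      have := circleIntegrable_zpow_mul hρ hl (-((m + 1 : ℕ) + 1 : ℤ)) (f := fun _ => a 0)
        (differentiableOn_const _)
      simpa only [mul_comm] using this
    calc (∮ z in C(0, ρ), z ^ (-((m + 1 : ℕ) + 1 : ℤ)) * t 0 z)
        = ∮ z in C(0, ρ), (a 0 * z ^ (-((m + 1 : ℕ) + 1 : ℤ)) + z ^ (-(m + 1 : ℤ)) * t 1 z) := by
          refine circleIntegral.integral_congr hρ.le fun z hz => ?_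
          have hz0 := ne_zero_of_mem_sphere_zero hρ hz
          rw [ht 0 z (hsph hz), show (-(m + 1 : ℤ)) = -((m + 1 : ℕ) + 1 : ℤ) + 1 by push_cast; ring,
            zpow_add_one₀ hz0]
          ring
      _ = _ := by
          rw [circleIntegral.integral_add hi (circleIntegrable_zpow_mul hρ hl _ (hd 1)),
            circleIntegral.integral_const_mul, h1, h2]
          ring

end ScalarContour

/-! ### Taylor tails of products of resolvents -/

section TaylorTails

/-- The spectral projector onto the span of the `j`-th column of `Θ`. -/
def columnProj {n ι : Type*} (Θ : Matrix n ι ℝ) (j : ι) : Matrix n n ℝ :=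
  Matrix.vecMulVec (fun a => Θ a j) (fun a => Θ a j)

theorem mul_diagonal_mul_transpose_eq_sum {n ι : Type*} [Fintype ι] [DecidableEq ι]
    (Θ : Matrix n ι ℝ) (f : ι → ℝ) :
    Θ * Matrix.diagonal f * Θᵀ = ∑ j, f j • columnProj Θ j := by
  ext a b
  rw [Matrix.mul_apply]
  simp only [Matrix.mul_diagonal, Matrix.sum_apply, Matrix.smul_apply, columnProj,
    Matrix.vecMulVec_apply, Matrix.transpose_apply, smul_eq_mul]
  exact Finset.sum_congr rfl fun j _ => by ring

variable {n : Type*} [Fintype n] [DecidableEq n]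

/-- The complexification of a real square matrix. -/
noncomputable def complexify : Matrix n n ℝ →+* Matrix n n ℂ := Complex.ofRealHom.mapMatrix

theorem complexify_apply (A : Matrix n n ℝ) (i j : n) : complexify A i j = (A i j : ℂ) := rfl

theorem trace_complexify (A : Matrix n n ℝ) : (complexify A).trace = ((A.trace : ℝ) : ℂ) := by
  simp [Matrix.trace, complexify_apply]

/-- `T 0, T 1, …` are the successive Taylor tails at `0` of an analytic matrix function on the disc
of radius `l`, with real Taylor coefficients `c`. -/
structure IsTaylorTails (l : ℝ) (T : ℕ → ℂ → Matrix n n ℂ) (c : ℕ → Matrix n n ℝ) : Prop where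
  diff : ∀ m i j, DifferentiableOn ℂ (fun z => T m z i j) (Metric.ball 0 l)
  eq : ∀ m, ∀ z ∈ Metric.ball (0 : ℂ) l, T m z = complexify (c m) + z • T (m + 1) z

theorem IsTaylorTails.const_mul {l : ℝ} {T : ℕ → ℂ → Matrix n n ℂ} {c : ℕ → Matrix n n ℝ}
    (h : IsTaylorTails l T c) (X : Matrix n n ℝ) :
    IsTaylorTails l (fun m z => complexify X * T m z) (fun m => X * c m) where
  diff m i j := by
    simp only [Matrix.mul_apply]
    exact DifferentiableOn.fun_sum fun k _ => (h.diff m k j).const_mul _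
  eq m z hz := by
    rw [h.eq m z hz, mul_add, map_mul, Matrix.mul_smul]

/-- Write the first factor as its Taylor polynomial of degree below m plus z^m times its tail. The
tail multiplies the whole second factor, while c i z^i needs the second factor's tail of order m -
i. -/
theorem IsTaylorTails.mul {l : ℝ} {T T' : ℕ → ℂ → Matrix n n ℂ} {c c' : ℕ → Matrix n n ℝ}
    (h : IsTaylorTails l T c) (h' : IsTaylorTails l T' c') :
    IsTaylorTails l
      (fun m z => T m z * T' 0 z + ∑ i ∈ Finset.range m, complexify (c i) * T' (m - i) z)
      (fun m => ∑ p ∈ Finset.HasAntidiagonal.antidiagonal m, c p.1 * c' p.2) where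
  diff m i j := by
    simp only [Matrix.add_apply, Matrix.sum_apply, Matrix.mul_apply]
    refine DifferentiableOn.fun_add (DifferentiableOn.fun_sum fun k _ =>
      (h.diff m i k).mul (h'.diff 0 k j)) (DifferentiableOn.fun_sum fun k _ =>
      DifferentiableOn.fun_sum fun k' _ => (h'.diff _ k' j).const_mul _)
  eq m z hz := by
    rw [Finset.Nat.sum_antidiagonal_eq_sum_range_succ (fun a b => c a * c' b), map_sum,
      Finset.sum_range_succ, Finset.sum_range_succ, h.eq m z hz, Nat.sub_self, add_mul,
      Nat.add_sub_cancel_left, Matrix.smul_mul]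
    have e : ∀ i ∈ Finset.range m, complexify (c i) * T' (m - i) z
        = complexify (c i * c' (m - i)) + z • (complexify (c i) * T' (m + 1 - i) z) := by
      intro i hi
      rw [h'.eq _ z hz, mul_add, map_mul, Matrix.mul_smul,
        Nat.sub_add_comm (Finset.mem_range.1 hi).le]
    have e0 : complexify (c m) * T' 0 z
        = complexify (c m * c' 0) + z • (complexify (c m) * T' 1 z) := by
      rw [h'.eq 0 z hz, mul_add, map_mul, Matrix.mul_smul]
    rw [Finset.sum_congr rfl e, Finset.sum_add_distrib, e0, ← Finset.smul_sum]
    simp only [smul_add]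
    abel

theorem sub_ofReal_ne_zero_of_mem_ball {ι : Type*} {lam : ι → ℝ} {l : ℝ}
    (hlam : ∀ j, l ≤ |lam j|) {z : ℂ}
    (hz : z ∈ Metric.ball (0 : ℂ) l) (j : ι) : z - lam j ≠ 0 := by
  intro h
  have hzj : z = lam j := sub_eq_zero.1 h
  rw [mem_ball_zero_iff, hzj, Complex.norm_real, Real.norm_eq_abs] at hz
  exact absurd (hlam j) (not_le.2 hz)

variable {ι : Type*} [Fintype ι] [DecidableEq ι]

theorem map_mul_diagonal_mul_transpose_eq_sum (Θ : Matrix n ι ℝ) (f : ι → ℂ) :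
    Θ.map Complex.ofReal * Matrix.diagonal f * (Θ.map Complex.ofReal)ᵀ
      = ∑ j, f j • complexify (columnProj Θ j) := by
  ext a b
  rw [Matrix.mul_apply]
  simp only [Matrix.mul_diagonal, Matrix.sum_apply, Matrix.smul_apply, columnProj,
    Matrix.vecMulVec_apply, Matrix.transpose_apply, smul_eq_mul, complexify_apply, Matrix.map_apply,
    Complex.ofReal_mul]
  exact Finset.sum_congr rfl fun j _ => by ring

/-- The Taylor tails of `z ↦ z (z - A)⁻¹`, where `A = Θ diag(lam) Θᵀ`. -/
noncomputable def resolventTail (Θ : Matrix n ι ℝ) (lam : ι → ℝ) : ℕ → ℂ → Matrix n n ℂ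
  | 0, z => complexify (specPow Θ lam 0) + z • ∑ j, (z - lam j)⁻¹ • complexify (columnProj Θ j)
  | (k + 1), z => ∑ j, ((lam j : ℂ) ^ k * (z - lam j))⁻¹ • complexify (columnProj Θ j)

variable {lam : ι → ℝ} {l : ℝ}

/-- For each eigenvalue λ the recursion is the partial fraction identity 1/(λ^m (z - λ)) =
-1/λ^(m+1) + z/(λ^(m+1) (z - λ)). -/
theorem isTaylorTails_resolventTail (Θ : Matrix n ι ℝ) (hl : 0 < l) (hlam : ∀ j, l ≤ |lam j|) :
    IsTaylorTails l (resolventTail Θ lam) (resolventCoeff Θ lam) := by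
  have hlam0 : ∀ j, (lam j : ℂ) ≠ 0 := fun j h => by
    have := hlam j
    rw [Complex.ofReal_eq_zero.1 h, abs_zero] at this
    linarith
  have hd : ∀ (k : ℕ) (a b : n), DifferentiableOn ℂ (fun z : ℂ => (∑ j,
      ((lam j : ℂ) ^ k * (z - lam j))⁻¹ • complexify (columnProj Θ j)) a b) (Metric.ball 0 l) := by
    intro k a b
    simp only [Matrix.sum_apply, Matrix.smul_apply, smul_eq_mul]
    refine DifferentiableOn.fun_sum fun j _ => DifferentiableOn.mul_const
      (DifferentiableOn.inv (by fun_prop) fun z hz => ?_) _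
    exact mul_ne_zero (pow_ne_zero _ (hlam0 j)) (sub_ofReal_ne_zero_of_mem_ball hlam hz j)
  constructor
  · intro m a b
    rcases m with _ | m
    · have h := hd 0 a b
      simp only [pow_zero, one_mul] at h
      have e : ∀ z, resolventTail Θ lam 0 z a b = complexify (specPow Θ lam 0) a b + z * (∑ j,
          (z - lam j)⁻¹ • complexify (columnProj Θ j)) a b := fun z => by
        rw [resolventTail, Matrix.add_apply, Matrix.smul_apply, smul_eq_mul]
      simp only [e]
      exact (differentiableOn_const _).add (differentiableOn_id.mul h)
    · exact hd m a b
  · intro m z hz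
    rcases m with _ | m
    · simp [resolventTail, resolventCoeff]
    · have e : ∀ j, ((lam j : ℂ) ^ m * (z - lam j))⁻¹ = -((lam j : ℂ) ^ (m + 1))⁻¹
          + z * ((lam j : ℂ) ^ (m + 1) * (z - lam j))⁻¹ := fun j => by
        have h1 := hlam0 j
        have h2 := sub_ofReal_ne_zero_of_mem_ball hlam hz j
        field_simp
        ring
      have e2 : complexify (resolventCoeff Θ lam (m + 1))
          = ∑ j, (-((lam j : ℂ) ^ (m + 1))⁻¹) • complexify (columnProj Θ j) := by
        rw [resolventCoeff, specPow, diagNegPow, mul_diagonal_mul_transpose_eq_sum, map_neg,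
          map_sum, ← Finset.sum_neg_distrib]
        refine Finset.sum_congr rfl fun j _ => ?_
        ext a b
        simp [complexify_apply]
      rw [e2]
      simp only [resolventTail, e, add_smul, Finset.sum_add_distrib, Finset.smul_sum, smul_smul]

/-- The Taylor tails of `G X G X ⋯ X G`, where `G z = z (z - A)⁻¹` and `A = Θ diag(lam) Θᵀ`. -/
theorem exists_isTaylorTails_interlaced (Θ : Matrix n ι ℝ) (hl : 0 < l) (hlam : ∀ j, l ≤ |lam j|)
    (X : Matrix n n ℝ) (k : ℕ) : ∃ T : ℕ → ℂ → Matrix n n ℂ,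
      IsTaylorTails l T (interlacedCoeff (resolventCoeff Θ lam) X k) ∧
      ∀ z, T 0 z = resolventTail Θ lam 0 z * (complexify X * resolventTail Θ lam 0 z) ^ k := by
  induction k with
  | zero => exact ⟨resolventTail Θ lam, isTaylorTails_resolventTail Θ hl hlam, fun z => by simp⟩
  | succ k ih =>
    obtain ⟨T, hT, hT0⟩ := ih
    refine ⟨_, (isTaylorTails_resolventTail Θ hl hlam).mul (hT.const_mul X), fun z => ?_⟩
    simp only [Finset.range_zero, Finset.sum_empty, add_zero, hT0]
    rw [pow_succ', ← mul_assoc (complexify X)]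

end TaylorTails

/-! ### Operator norm bounds for the perturbation terms -/

section OperatorNormBounds

theorem l2_opNorm_one_le {ι : Type*} [Fintype ι] [DecidableEq ι] : ‖(1 : Matrix ι ι ℂ)‖ ≤ 1 := by
  rw [← Matrix.diagonal_one, Matrix.l2_opNorm_diagonal]
  exact (pi_norm_le_iff_of_nonneg zero_le_one).2 fun i => by simp

theorem l2_opNorm_le_one_of_isometry {n ι : Type*} [Fintype n] [Fintype ι] [DecidableEq ι]
    {W : Matrix n ι ℂ} (h : Wᴴ * W = 1) : ‖W‖ ≤ 1 := by
  have := Matrix.l2_opNorm_conjTranspose_mul_self W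
  rw [h] at this
  nlinarith [l2_opNorm_one_le (ι := ι), norm_nonneg W]

theorem norm_entry_le_l2_opNorm {n ι : Type*} [Fintype n] [Fintype ι] [DecidableEq ι]
    (A : Matrix n ι ℂ) (i : n) (j : ι) : ‖A i j‖ ≤ ‖A‖ := by
  have h := A.l2_opNorm_mulVec (EuclideanSpace.single j 1)
  rw [PiLp.norm_single, norm_one, mul_one] at h
  refine le_trans ?_ h
  have h2 := PiLp.norm_apply_le ((EuclideanSpace.equiv n ℂ).symm
    (A *ᵥ (EuclideanSpace.single j (1 : ℂ)))) i
  refine le_trans (le_of_eq ?_) h2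
  simp

/-- The entrywise complexification of a real matrix. -/
noncomputable abbrev mapC {n ι : Type*} (Θ : Matrix n ι ℝ) : Matrix n ι ℂ := Θ.map Complex.ofReal

theorem complexify_mul_transpose {n ι : Type*} [Fintype n] [DecidableEq n] [Fintype ι]
    (Θ : Matrix n ι ℝ) : complexify (Θ * Θᵀ) = mapC Θ * (mapC Θ)ᵀ := by
  ext a b
  simp [complexify_apply, Matrix.mul_apply]

theorem mapC_transpose_mul_self {n ι : Type*} [Fintype n] [DecidableEq ι]
    {Θ : Matrix n ι ℝ} (hΘ : Θᵀ * Θ = 1) :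
    (mapC Θ)ᵀ * mapC Θ = 1 := by
  have : (mapC Θ)ᵀ * mapC Θ = (Θᵀ * Θ).map Complex.ofReal := by
    ext a b
    simp [Matrix.mul_apply]
  rw [this, hΘ]
  ext a b
  by_cases h : a = b
  · subst h; simp
  · simp [h]

theorem mapC_conjTranspose {n ι : Type*} (Θ : Matrix n ι ℝ) : (mapC Θ)ᴴ = (mapC Θ)ᵀ := by
  ext a b
  simp

variable {n ι : Type*} [Fintype n] [DecidableEq n] [Fintype ι] [DecidableEq ι]

theorem l2_opNorm_diagonal_le {f : ι → ℂ} {C : ℝ} (hC : 0 ≤ C) (hf : ∀ j, ‖f j‖ ≤ C) :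
    ‖Matrix.diagonal f‖ ≤ C := by
  rw [Matrix.l2_opNorm_diagonal]
  exact (pi_norm_le_iff_of_nonneg hC).2 hf

theorem complexify_mul_diagonal_mul_transpose (Θ : Matrix n ι ℝ) (f : ι → ℝ) :
    complexify (Θ * Matrix.diagonal f * Θᵀ)
      = mapC Θ * Matrix.diagonal (fun j => (f j : ℂ)) * (mapC Θ)ᵀ := by
  rw [mul_diagonal_mul_transpose_eq_sum, map_mul_diagonal_mul_transpose_eq_sum, map_sum]
  refine Finset.sum_congr rfl fun j _ => ?_
  ext a b
  simp [complexify_apply]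

theorem norm_mapC_le_one {n ι : Type*} [Fintype n] [Fintype ι] [DecidableEq ι]
    {Θ : Matrix n ι ℝ} (hΘ : Θᵀ * Θ = 1) : ‖mapC Θ‖ ≤ 1 :=
  l2_opNorm_le_one_of_isometry (by rw [mapC_conjTranspose, mapC_transpose_mul_self hΘ])

theorem norm_mapC_transpose_le_one {Θ : Matrix n ι ℝ} (hΘ : Θᵀ * Θ = 1) : ‖(mapC Θ)ᵀ‖ ≤ 1 := by
  rw [← mapC_conjTranspose, Matrix.l2_opNorm_conjTranspose]
  exact norm_mapC_le_one hΘ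

theorem norm_conj_le {Θ : Matrix n ι ℝ} (hΘ : Θᵀ * Θ = 1) (D : Matrix ι ι ℂ) :
    ‖mapC Θ * D * (mapC Θ)ᵀ‖ ≤ ‖D‖ := by
  calc _ ≤ ‖mapC Θ * D‖ * ‖(mapC Θ)ᵀ‖ := Matrix.l2_opNorm_mul _ _
    _ ≤ ‖mapC Θ‖ * ‖D‖ * ‖(mapC Θ)ᵀ‖ := by
      gcongr; exact Matrix.l2_opNorm_mul _ _
    _ ≤ 1 * ‖D‖ * 1 := by
      gcongr
      · exact norm_mapC_le_one hΘ
      · exact norm_mapC_transpose_le_one hΘ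
    _ = ‖D‖ := by ring

/-- By cyclicity the trace is that of ΘᵀBΘ, whose diagonal has only as many entries as Θ has
columns. This is what makes the errors scale with the rank rather than the dimension. -/
theorem norm_trace_proj_mul_le {Θ : Matrix n ι ℝ} (hΘ : Θᵀ * Θ = 1) (B : Matrix n n ℂ) :
    ‖(complexify (Θ * Θᵀ) * B).trace‖ ≤ Fintype.card ι * ‖B‖ := by
  rw [complexify_mul_transpose, Matrix.mul_assoc, Matrix.trace_mul_comm]
  calc _ ≤ ∑ j : ι, ‖((mapC Θ)ᵀ * B * mapC Θ) j j‖ := norm_sum_le _ _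
    _ ≤ ∑ _j : ι, ‖B‖ := by
      refine Finset.sum_le_sum fun j _ => (norm_entry_le_l2_opNorm _ _ _).trans ?_
      calc _ ≤ ‖(mapC Θ)ᵀ * B‖ * ‖mapC Θ‖ := Matrix.l2_opNorm_mul _ _
        _ ≤ ‖(mapC Θ)ᵀ‖ * ‖B‖ * ‖mapC Θ‖ := by
          gcongr; exact Matrix.l2_opNorm_mul _ _
        _ ≤ 1 * ‖B‖ * 1 := by
          gcongr
          · exact norm_mapC_transpose_le_one hΘ
          · exact norm_mapC_le_one hΘ
        _ = ‖B‖ := by ring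
    _ = _ := by simp

variable {lam : ι → ℝ} {l : ℝ}

theorem norm_complexify_specPow_zero_le {Θ : Matrix n ι ℝ} (hΘ : Θᵀ * Θ = 1) :
    ‖complexify (specPow Θ lam 0)‖ ≤ 2 := by
  rw [specPow, map_sub, map_one, complexify_mul_transpose]
  refine (norm_sub_le _ _).trans ?_
  have h1 := l2_opNorm_one_le (ι := n)
  have h2 := norm_conj_le hΘ (1 : Matrix ι ι ℂ)
  have h3 := l2_opNorm_one_le (ι := ι)
  rw [Matrix.mul_one] at h2
  linarith

theorem norm_complexify_resolventCoeff_le {Θ : Matrix n ι ℝ} (hΘ : Θᵀ * Θ = 1) (hl : 0 < l)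
    (hlam : ∀ j, l ≤ |lam j|) (m : ℕ) : ‖complexify (resolventCoeff Θ lam m)‖ ≤ 2 * (l⁻¹) ^ m := by
  rcases m with _ | m
  · simpa [resolventCoeff] using norm_complexify_specPow_zero_le hΘ
  · rw [resolventCoeff, map_neg, norm_neg, specPow, diagNegPow,
      complexify_mul_diagonal_mul_transpose]
    refine (norm_conj_le hΘ _).trans ((l2_opNorm_diagonal_le (C := (l⁻¹) ^ (m + 1)) (by positivity)
      fun j => ?_).trans ?_)
    · rw [Complex.norm_real, norm_inv, norm_pow, Real.norm_eq_abs, inv_pow]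
      have := hlam j
      gcongr
    · have : 0 ≤ (l⁻¹) ^ (m + 1) := by positivity
      linarith

/-- Each of the k + 1 coefficients costs a factor 2, and each convolution has at most m + 1 terms.
The bound is crude; it serves only for integrability and for large perturbations. -/
theorem norm_complexify_interlacedCoeff_le {Θ : Matrix n ι ℝ} (hΘ : Θᵀ * Θ = 1) (hl : 0 < l)
    (hlam : ∀ j, l ≤ |lam j|) (X : Matrix n n ℝ) (k m : ℕ) :
    ‖complexify (interlacedCoeff (resolventCoeff Θ lam) X k m)‖ ≤
      2 ^ (k + 1) * (m + 1) ^ k * ‖complexify X‖ ^ k * (l⁻¹) ^ m := by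
  induction k generalizing m with
  | zero => simpa [interlacedCoeff] using norm_complexify_resolventCoeff_le hΘ hl hlam m
  | succ k ih =>
    rw [interlacedCoeff, map_sum]
    refine (norm_sum_le _ _).trans ?_
    have h : ∀ p ∈ Finset.HasAntidiagonal.antidiagonal m,
        ‖complexify (resolventCoeff Θ lam p.1 *
          (X * interlacedCoeff (resolventCoeff Θ lam) X k p.2))‖ ≤
        2 ^ (k + 2) * (m + 1) ^ k * ‖complexify X‖ ^ (k + 1) * (l⁻¹) ^ m := by
      intro p hp
      have hpm := Finset.HasAntidiagonal.mem_antidiagonal.1 hp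
      rw [map_mul, map_mul]
      calc _ ≤ ‖complexify (resolventCoeff Θ lam p.1)‖ * (‖complexify X‖ *
            ‖complexify (interlacedCoeff (resolventCoeff Θ lam) X k p.2)‖) :=
            (norm_mul_le _ _).trans (by gcongr; exact norm_mul_le _ _)
        _ ≤ (2 * (l⁻¹) ^ p.1) * (‖complexify X‖ *
            (2 ^ (k + 1) * (p.2 + 1) ^ k * ‖complexify X‖ ^ k * (l⁻¹) ^ p.2)) := by
            gcongr
            · exact norm_complexify_resolventCoeff_le hΘ hl hlam _
            · exact ih _
        _ ≤ (2 * (l⁻¹) ^ p.1) * (‖complexify X‖ *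
            (2 ^ (k + 1) * (m + 1) ^ k * ‖complexify X‖ ^ k * (l⁻¹) ^ p.2)) := by
            have : (p.2 : ℝ) ≤ m := by exact_mod_cast (by omega : p.2 ≤ m)
            gcongr
        _ = _ := by rw [← hpm]; ring
    refine (Finset.sum_le_sum h).trans (le_of_eq ?_)
    rw [Finset.sum_const, Finset.Nat.card_antidiagonal, nsmul_eq_mul]
    push_cast
    ring

theorem abs_frobInner_perturbTerm_le {Θ : Matrix n ι ℝ} (hΘ : Θᵀ * Θ = 1) (hl : 0 < l)
    (hlam : ∀ j, l ≤ |lam j|) (X : Matrix n n ℝ) (k : ℕ) :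
    |frobInner (Θ * Θᵀ) (perturbTerm Θ lam k X)| ≤
      Fintype.card ι * (2 ^ (k + 1) * (k + 1) ^ k) * (‖complexify X‖ / l) ^ k := by
  rw [frobInner_proj, ← Real.norm_eq_abs, ← Complex.norm_real, ← trace_complexify, map_mul,
    perturbTerm_eq_neg_interlacedCoeff, map_neg, mul_neg, Matrix.trace_neg, norm_neg]
  refine (norm_trace_proj_mul_le hΘ _).trans ?_
  rw [mul_assoc]
  gcongr
  refine (norm_complexify_interlacedCoeff_le hΘ hl hlam X k k).trans (le_of_eq ?_)
  rw [div_pow, inv_pow, div_eq_mul_inv]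
  ring

end OperatorNormBounds

/-! ### The resolvent of the unperturbed matrix -/

section ResolventExpansion

variable {n ι : Type*} [Fintype n] [DecidableEq n] [Fintype ι] [DecidableEq ι]
  {Θ : Matrix n ι ℝ} {lam : ι → ℝ} {l : ℝ}

theorem resolventTail_zero_eq (Θ : Matrix n ι ℝ) (lam : ι → ℝ) (z : ℂ) :
    resolventTail Θ lam 0 z = (1 - mapC Θ * (mapC Θ)ᵀ)
      + z • (mapC Θ * Matrix.diagonal (fun j => (z - lam j)⁻¹) * (mapC Θ)ᵀ) := by
  rw [resolventTail, specPow, map_sub, map_one, complexify_mul_transpose,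
    map_mul_diagonal_mul_transpose_eq_sum]

/-- On the column space of Θ the factors z - λ and z/(z - λ) multiply to z; on the complement A
vanishes and the second factor is the identity. The form G = z (z - A)⁻¹ stays regular at z = 0. -/
theorem sub_mul_resolventTail (hΘ : Θᵀ * Θ = 1) (hlam : ∀ j, l ≤ |lam j|) {z : ℂ}
    (hz : z ∈ Metric.ball (0 : ℂ) l) :
    (z • 1 - complexify (Θ * Matrix.diagonal lam * Θᵀ)) * resolventTail Θ lam 0 z = z • 1 := by
  have hW := mapC_transpose_mul_self hΘ
  rw [resolventTail_zero_eq, complexify_mul_diagonal_mul_transpose]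
  set W := mapC Θ
  set D := Matrix.diagonal fun j => (z - lam j)⁻¹
  set L := Matrix.diagonal fun j => (lam j : ℂ)
  have h1 : W * L * Wᵀ * (1 - W * Wᵀ) = 0 := by
    rw [mul_sub, mul_one, show W * L * Wᵀ * (W * Wᵀ) = W * L * (Wᵀ * W) * Wᵀ by
      simp only [Matrix.mul_assoc], hW, Matrix.mul_one, sub_self]
  have h2 : W * L * Wᵀ * (W * D * Wᵀ) = W * (L * D) * Wᵀ := by
    rw [show W * L * Wᵀ * (W * D * Wᵀ) = W * L * (Wᵀ * W) * D * Wᵀ by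
      simp only [Matrix.mul_assoc], hW, Matrix.mul_one, Matrix.mul_assoc W L D]
  have h3 : z • D - L * D = 1 := by
    rw [Matrix.diagonal_mul_diagonal, ← Matrix.diagonal_smul, Matrix.diagonal_sub,
      ← Matrix.diagonal_one]
    congr 1
    funext j
    have := sub_ofReal_ne_zero_of_mem_ball hlam hz j
    simp only [Pi.smul_apply, smul_eq_mul]
    rw [← sub_mul, mul_inv_cancel₀ this]
  have h4 : z • (W * D * Wᵀ) - W * (L * D) * Wᵀ = W * Wᵀ := by
    rw [← Matrix.smul_mul, ← Matrix.mul_smul, ← Matrix.sub_mul, ← Matrix.mul_sub, h3,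
      Matrix.mul_one]
  rw [sub_mul, mul_add, mul_add, h1, zero_add, Matrix.mul_smul (W * L * Wᵀ), h2, smul_mul_assoc,
    smul_mul_assoc, one_mul, one_mul, add_sub_assoc, ← smul_sub, h4, ← smul_add, sub_add_cancel]

end ResolventExpansion

/-! ### Contour integral of the perturbed resolvent -/

section ContourBound

variable {n ι : Type*} [Fintype n] [DecidableEq n] [Fintype ι] [DecidableEq ι]
  {Θ : Matrix n ι ℝ} {lam : ι → ℝ} {l : ℝ}

/-- On |z| = l/2 the complement contributes at most 2 · 2/l, and the eigenvalues, being at distance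
at least l/2, contribute 2/l. -/
theorem norm_resolvent_le (hΘ : Θᵀ * Θ = 1) (hl : 0 < l) (hlam : ∀ j, l ≤ |lam j|) {z : ℂ}
    (hz : z ∈ Metric.sphere (0 : ℂ) (l / 2)) : ‖z⁻¹ • resolventTail Θ lam 0 z‖ ≤ 6 / l := by
  have hzn : ‖z‖ = l / 2 := by simpa using hz
  have hz0 : z ≠ 0 := ne_zero_of_mem_sphere_zero (half_pos hl) hz
  rw [resolventTail_zero_eq, smul_add, inv_smul_smul₀ hz0]
  have h1 : ‖z⁻¹ • (1 - mapC Θ * (mapC Θ)ᵀ)‖ ≤ 4 / l := by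
    rw [norm_smul, norm_inv, hzn]
    have := norm_complexify_specPow_zero_le (lam := lam) hΘ
    rw [specPow, map_sub, map_one, complexify_mul_transpose] at this
    calc (l / 2)⁻¹ * _ ≤ (l / 2)⁻¹ * 2 := by gcongr
      _ = 4 / l := by field_simp; norm_num
  have h2 : ‖mapC Θ * Matrix.diagonal (fun j => (z - lam j)⁻¹) * (mapC Θ)ᵀ‖ ≤ 2 / l := by
    refine (norm_conj_le hΘ _).trans (l2_opNorm_diagonal_le (by positivity) fun j => ?_)
    have h := norm_sub_norm_le (lam j : ℂ) z
    rw [Complex.norm_real, Real.norm_eq_abs, hzn, norm_sub_rev] at h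
    rw [norm_inv, show 2 / l = (l / 2)⁻¹ by rw [inv_div]]
    have := hlam j
    exact inv_anti₀ (by positivity) (by linarith)
  refine (norm_add_le _ _).trans ((add_le_add h1 h2).trans (le_of_eq ?_))
  ring

theorem eq_sum_pow_mul_add_pow_mul {R : Type*} [Ring R] {a b c : R} (h : b = a + c * b) (N : ℕ) :
    b = ∑ k ∈ Finset.range N, c ^ k * a + c ^ N * b := by
  induction N with
  | zero => simp
  | succ N ih =>
    rw [Finset.sum_range_succ, add_assoc, pow_succ, mul_assoc, ← mul_add, ← h]
    exact ih

/-- The k-th Neumann term is z^(-k-1) G (X G)^k, so its contour integral picks the k-th Taylor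
coefficient of G (X G)^k. -/
theorem circleIntegral_trace_interlaced (hl : 0 < l) (hlam : ∀ j, l ≤ |lam j|)
    (X : Matrix n n ℝ) (k : ℕ) :
    CircleIntegrable (fun z => z ^ (-(k + 1 : ℤ)) * (complexify (Θ * Θᵀ) *
      (resolventTail Θ lam 0 z * (complexify X * resolventTail Θ lam 0 z) ^ k)).trace) 0 (l / 2) ∧
    (∮ z in C(0, l / 2), z ^ (-(k + 1 : ℤ)) * (complexify (Θ * Θᵀ) *
      (resolventTail Θ lam 0 z * (complexify X * resolventTail Θ lam 0 z) ^ k)).trace)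
      = 2 * Real.pi * Complex.I * (-frobInner (Θ * Θᵀ) (perturbTerm Θ lam k X) : ℝ) := by
  obtain ⟨T, hT, hT0⟩ := exists_isTaylorTails_interlaced Θ hl hlam X k
  have hT' := hT.const_mul (Θ * Θᵀ)
  simp only [← hT0]
  have hd : ∀ m, DifferentiableOn ℂ (fun z => (complexify (Θ * Θᵀ) * T m z).trace)
      (Metric.ball 0 l) := fun m => by
    simp only [Matrix.trace, Matrix.diag_apply]
    exact DifferentiableOn.fun_sum fun i _ => hT'.diff m i i
  refine ⟨circleIntegrable_zpow_mul (half_pos hl) (half_lt_self hl) _ (hd 0), ?_⟩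
  have := circleIntegral_zpow_mul_of_tails (half_pos hl) (half_lt_self hl) k
    (fun m z => (complexify (Θ * Θᵀ) * T m z).trace)
    (fun m => (complexify (Θ * Θᵀ * interlacedCoeff (resolventCoeff Θ lam) X k m)).trace) hd
    (fun m z hz => by
      rw [hT'.eq m z hz, Matrix.trace_add, Matrix.trace_smul, smul_eq_mul])
  rw [this, trace_complexify, perturbTerm_eq_neg_interlacedCoeff, frobInner_proj, Matrix.mul_neg,
    Matrix.trace_neg, neg_neg]

/-- S is the perturbed resolvent on the circle and w its contour value against the projector; both
stay abstract here and are computed later from singular values. The error is the integral of the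
Neumann remainder. As ‖X‖ ≤ l/12, the Neumann ratio is at most 1/2 and ‖S‖ ≤ 12/l; multiplied by the
radius l/2 this gives the constant 6. -/
theorem abs_add_sum_perturbTerm_le (hΘ : Θᵀ * Θ = 1) (hl : 0 < l) (hlam : ∀ j, l ≤ |lam j|)
    (X : Matrix n n ℝ) (hX : ‖complexify X‖ ≤ l / 12) (S : ℂ → Matrix n n ℂ)
    (hS : ∀ z ∈ Metric.sphere (0 : ℂ) (l / 2),
      (z • 1 - complexify (Θ * Matrix.diagonal lam * Θᵀ + X)) * S z = 1) (w : ℝ)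
    (hi : CircleIntegrable (fun z => (complexify (Θ * Θᵀ) * S z).trace) 0 (l / 2))
    (hw : (∮ z in C(0, l / 2), (complexify (Θ * Θᵀ) * S z).trace) = 2 * Real.pi * Complex.I * w)
    (N : ℕ) :
    |w + ∑ k ∈ Finset.range N, frobInner (Θ * Θᵀ) (perturbTerm Θ lam k X)| ≤
      Fintype.card ι * 6 * (6 * ‖complexify X‖ / l) ^ N := by
  set P := complexify (Θ * Θᵀ)
  set G := resolventTail Θ lam 0 with hG
  set Y := complexify X with hY
  have hl2 := half_pos hl
  -- the resolvent identity on the circle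
  have hres : ∀ z ∈ Metric.sphere (0 : ℂ) (l / 2),
      S z = z⁻¹ • G z + (z⁻¹ • G z * Y) * S z := by
    intro z hz
    have hz0 : z ≠ 0 := ne_zero_of_mem_sphere_zero hl2 hz
    have hzb : z ∈ Metric.ball (0 : ℂ) l := by
      have hzn : ‖z‖ = l / 2 := by simpa using hz
      rw [mem_ball_zero_iff, hzn]; linarith
    have h1 : (z • 1 - complexify (Θ * Matrix.diagonal lam * Θᵀ)) * (z⁻¹ • G z) = 1 := by
      rw [Matrix.mul_smul, sub_mul_resolventTail hΘ hlam hzb, inv_smul_smul₀ hz0]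
    -- The right inverse of a square matrix is also a left inverse, so the resolvent can be
    -- multiplied on the left of the defining equation of S.
    have h2 := mul_eq_one_comm.1 h1
    have h3 := congrArg (fun B => z⁻¹ • G z * B) (hS z hz)
    simp only [map_add, ← sub_sub] at h3
    rw [sub_mul, mul_sub, ← mul_assoc, h2, one_mul, mul_one, ← hY, ← mul_assoc] at h3
    exact sub_eq_iff_eq_add.1 h3
  have hRn : ∀ z ∈ Metric.sphere (0 : ℂ) (l / 2), ‖z⁻¹ • G z * Y‖ ≤ 6 * ‖Y‖ / l := fun z hz =>
    calc _ ≤ ‖z⁻¹ • G z‖ * ‖Y‖ := norm_mul_le _ _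
      _ ≤ 6 / l * ‖Y‖ := by gcongr; exact norm_resolvent_le hΘ hl hlam hz
      _ = _ := by ring
  have hSn : ∀ z ∈ Metric.sphere (0 : ℂ) (l / 2), ‖S z‖ ≤ 12 / l := by
    intro z hz
    have h1 : ‖S z‖ ≤ 6 / l + 1 / 2 * ‖S z‖ := by
      calc ‖S z‖ = ‖z⁻¹ • G z + (z⁻¹ • G z * Y) * S z‖ := congrArg _ (hres z hz)
        _ ≤ ‖z⁻¹ • G z‖ + ‖z⁻¹ • G z * Y‖ * ‖S z‖ :=
          (norm_add_le _ _).trans (by gcongr; exact norm_mul_le _ _)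
        _ ≤ 6 / l + 1 / 2 * ‖S z‖ := by
          gcongr
          · exact norm_resolvent_le hΘ hl hlam hz
          · refine (hRn z hz).trans ?_
            rw [div_le_iff₀ hl]; linarith
    have : 12 / l = 2 * (6 / l) := by ring
    linarith
  set V : ℕ → ℂ → ℂ := fun k z => z ^ (-(k + 1 : ℤ)) * (P * (G z * (Y * G z) ^ k)).trace with hV
  have hVi := fun k => (circleIntegral_trace_interlaced (Θ := Θ) hl hlam X k)
  have hsum : (∮ z in C(0, l / 2), ((P * S z).trace - ∑ k ∈ Finset.range N, V k z)) =
      2 * Real.pi * Complex.I *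
        ((w + ∑ k ∈ Finset.range N, frobInner (Θ * Θᵀ) (perturbTerm Θ lam k X) : ℝ) : ℂ) := by
    rw [circleIntegral.integral_sub hi (CircleIntegrable.fun_sum _ fun k _ => (hVi k).1), hw,
      circleIntegral.integral_fun_sum fun k _ => (hVi k).1,
      Finset.sum_congr rfl fun k _ => (hVi k).2, ← Finset.mul_sum]
    push_cast
    rw [Finset.sum_neg_distrib]
    ring
  have hterm : ∀ z ∈ Metric.sphere (0 : ℂ) (l / 2), ‖(P * S z).trace - ∑ k ∈ Finset.range N, V k z‖
      ≤ Fintype.card ι * ((6 * ‖Y‖ / l) ^ N * (12 / l)) := by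
    intro z hz
    have hz0 : z ≠ 0 := ne_zero_of_mem_sphere_zero hl2 hz
    have h1 := eq_sum_pow_mul_add_pow_mul (hres z hz) N
    have h2 : (P * S z).trace - ∑ k ∈ Finset.range N, V k z
        = (P * ((z⁻¹ • G z * Y) ^ N * S z)).trace := by
      have : ∀ k, V k z = (P * ((z⁻¹ • G z * Y) ^ k * (z⁻¹ • G z))).trace := fun k => by
        rw [Matrix.smul_mul, smul_pow, Matrix.smul_mul, Matrix.mul_smul, Matrix.mul_smul,
          Matrix.mul_smul, smul_smul, Matrix.trace_smul, smul_eq_mul, mul_pow_mul, ← pow_succ, inv_pow,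
          ← zpow_natCast, ← zpow_neg]
        push_cast
        rfl
      simp only [this]
      nth_rewrite 1 [h1]
      rw [mul_add, Finset.mul_sum, Matrix.trace_add, Matrix.trace_sum, add_sub_cancel_left]
    rw [h2]
    refine (norm_trace_proj_mul_le hΘ _).trans ?_
    gcongr
    refine (norm_mul_le _ _).trans ?_
    gcongr
    -- The identity matrix has norm 1 only over a nonempty index type, which matters for the zeroth
    -- power.
    · rcases isEmpty_or_nonempty n with h | h
      · have : (z⁻¹ • G z * Y) ^ N = 0 := Subsingleton.elim _ _
        rw [this, norm_zero]; positivity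
      · exact (norm_pow_le _ _).trans (pow_le_pow_left₀ (norm_nonneg _) (hRn z hz) _)
    · exact hSn z hz
  have hfin := circleIntegral.norm_integral_le_of_norm_le_const hl2.le hterm
  rw [hsum, norm_mul, Complex.norm_real, Real.norm_eq_abs] at hfin
  have hpi : ‖(2 * Real.pi * Complex.I : ℂ)‖ = 2 * Real.pi := by
    simp [abs_of_pos Real.pi_pos]
  rw [hpi] at hfin
  have h2pi : 0 < 2 * Real.pi := by positivity
  refine le_of_mul_le_mul_left (hfin.trans (le_of_eq ?_)) h2pi
  field_simp
  ring

end ContourBound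

/-! ### Singular values and a dimension count -/

section SingularValues

theorem IsCompactSVD.transpose {d₁ d₂ r : ℕ} {M : Matrix (Fin d₁) (Fin d₂) ℝ}
    {U : Matrix (Fin d₁) (Fin r) ℝ} {lam : Fin r → ℝ} {V : Matrix (Fin d₂) (Fin r) ℝ}
    (h : IsCompactSVD M U lam V) : IsCompactSVD Mᵀ V lam U where
  left_orthonormal := h.right_orthonormal
  right_orthonormal := h.left_orthonormal
  pos := h.pos
  antitone := h.antitone
  eq := by simp [h.eq, Matrix.transpose_mul, Matrix.mul_assoc]

theorem IsFullSVD.transpose {d₁ d₂ : ℕ} {M : Matrix (Fin d₁) (Fin d₂) ℝ}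
    {U : Matrix (Fin d₁) (Fin d₁) ℝ} {sv : ℕ → ℝ} {V : Matrix (Fin d₂) (Fin d₂) ℝ}
    (h : IsFullSVD M U sv V) : IsFullSVD Mᵀ V sv U where
  left_orthogonal := h.right_orthogonal
  right_orthogonal := h.left_orthogonal
  nonneg := h.nonneg
  antitone := h.antitone
  eq := by
    rw [h.eq]
    simp only [Matrix.transpose_mul, Matrix.transpose_transpose, Matrix.mul_assoc]
    congr 2
    ext i j
    simp only [Matrix.transpose_apply, Matrix.of_apply]
    by_cases hij : (i : ℕ) = j
    · rw [if_pos hij, if_pos hij.symm, hij]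
    · rw [if_neg hij, if_neg (Ne.symm hij)]

/-- The singular values of a `d₁ × d₂` matrix, extended by `0` to the indices of its columns. -/
noncomputable def columnSV (d₁ : ℕ) {d₂ : ℕ} (sv : ℕ → ℝ) (j : Fin d₂) : ℝ :=
  if (j : ℕ) < d₁ then sv j else 0

theorem IsFullSVD.transpose_mul_self {d₁ d₂ : ℕ} {M : Matrix (Fin d₁) (Fin d₂) ℝ}
    {U : Matrix (Fin d₁) (Fin d₁) ℝ} {sv : ℕ → ℝ} {V : Matrix (Fin d₂) (Fin d₂) ℝ}
    (h : IsFullSVD M U sv V) :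
    Mᵀ * M = V * Matrix.diagonal (fun j => columnSV d₁ sv j ^ 2) * Vᵀ := by
  set D : Matrix (Fin d₁) (Fin d₂) ℝ :=
    Matrix.of (fun (i : Fin d₁) (j : Fin d₂) => if (i : ℕ) = j then sv i else 0) with hD
  have hDD : Dᵀ * D = Matrix.diagonal (fun j => columnSV d₁ sv j ^ 2) := by
    ext a b
    simp only [Matrix.mul_apply, Matrix.transpose_apply, hD, Matrix.of_apply, columnSV]
    by_cases ha : (a : ℕ) < d₁
    · rw [Finset.sum_eq_single (⟨a, ha⟩ : Fin d₁)]
      · by_cases hab : a = b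
        · subst hab; simp [ha, sq]
        · have : (a : ℕ) ≠ b := fun h => hab (Fin.ext h)
          simp [hab, this]
      · intro i _ hi
        have : (i : ℕ) ≠ a := fun h => hi (Fin.ext h)
        simp [this]
      · simp
    · have h0 : ∀ i : Fin d₁, (i : ℕ) ≠ a := fun i h => ha (h ▸ i.2)
      by_cases hab : a = b
      · subst hab; simp [ha, h0]
      · simp [h0, hab]
  calc Mᵀ * M = V * (Dᵀ * (Uᵀ * U) * D) * Vᵀ := by
        rw [h.eq, ← hD]
        simp only [Matrix.transpose_mul, Matrix.transpose_transpose, Matrix.mul_assoc]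
    _ = _ := by rw [h.left_orthogonal, Matrix.mul_one, hDD]

theorem IsCompactSVD.transpose_mul_self {d₁ d₂ r : ℕ} {M : Matrix (Fin d₁) (Fin d₂) ℝ}
    {U : Matrix (Fin d₁) (Fin r) ℝ} {lam : Fin r → ℝ} {V : Matrix (Fin d₂) (Fin r) ℝ}
    (h : IsCompactSVD M U lam V) : Mᵀ * M = V * Matrix.diagonal (fun j => lam j ^ 2) * Vᵀ := by
  calc Mᵀ * M = V * (Matrix.diagonal lam * (Uᵀ * U) * Matrix.diagonal lam) * Vᵀ := by
        rw [h.eq]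
        simp only [Matrix.transpose_mul, Matrix.transpose_transpose, Matrix.diagonal_transpose,
          Matrix.mul_assoc]
    _ = _ := by
        rw [h.left_orthonormal, Matrix.mul_one, Matrix.diagonal_mul_diagonal]
        simp only [sq]

variable {m n ι : Type*} [Fintype m] [Fintype n] [Fintype ι] [DecidableEq ι]

theorem norm_toLp_sq (x : n → ℝ) : ‖WithLp.toLp 2 x‖ ^ 2 = x ⬝ᵥ x := by
  rw [EuclideanSpace.real_norm_sq_eq]
  simp [dotProduct, sq]

/-- Both kinds of decomposition enter the Weyl bounds only through this diagonalisation of the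
quadratic form x ↦ ‖Ax‖². -/
theorem norm_toLp_mulVec_sq (A : Matrix m n ℝ) (W : Matrix n ι ℝ) (f : ι → ℝ)
    (h : Aᵀ * A = W * Matrix.diagonal f * Wᵀ) (x : n → ℝ) :
    ‖WithLp.toLp 2 (A *ᵥ x)‖ ^ 2 = ∑ j, f j * (Wᵀ *ᵥ x) j ^ 2 := by
  have : (A *ᵥ x) ⬝ᵥ (A *ᵥ x) = x ⬝ᵥ ((Aᵀ * A) *ᵥ x) := by
    rw [← Matrix.mulVec_mulVec, Matrix.dotProduct_mulVec x, Matrix.vecMul_transpose]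
  rw [norm_toLp_sq, this, h, ← Matrix.mulVec_mulVec, ← Matrix.mulVec_mulVec,
    Matrix.dotProduct_mulVec, ← Matrix.mulVec_transpose, dotProduct]
  refine Finset.sum_congr rfl fun j _ => ?_
  rw [Matrix.mulVec_diagonal]
  ring

theorem norm_toLp_mulVec_of_isometry {W : Matrix n ι ℝ} (h : Wᵀ * W = 1) (c : ι → ℝ) :
    ‖WithLp.toLp 2 (W *ᵥ c)‖ ^ 2 = ∑ j, c j ^ 2 := by
  have := norm_toLp_mulVec_sq W (1 : Matrix ι ι ℝ) (fun _ => 1) (by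
    rw [h, Matrix.diagonal_one, Matrix.transpose_one, Matrix.mul_one, Matrix.mul_one]) c
  simpa using this

theorem norm_toLp_mulVec_le [DecidableEq n] (A : Matrix m n ℝ) (x : n → ℝ) :
    ‖WithLp.toLp 2 (A *ᵥ x)‖ ≤ ‖A‖ * ‖WithLp.toLp 2 x‖ :=
  A.l2_opNorm_mulVec (WithLp.toLp 2 x)

theorem exists_mulVec_eq_zero_of_card_lt {ι κ : Type*} [Fintype ι] [Fintype κ] (B : Matrix κ ι ℝ)
    (h : Fintype.card κ < Fintype.card ι) : ∃ c ≠ 0, B *ᵥ c = 0 := by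
  have := LinearMap.ker_ne_bot_of_finrank_lt (f := Matrix.mulVecLin B) (by simpa using h)
  obtain ⟨c, hc, hc0⟩ := Submodule.exists_mem_ne_zero_of_ne_bot this
  exact ⟨c, hc0, by simpa using hc⟩

/-- Two matrices of which the first expands a space that meets the kernel of `W₂ᵀ`, where the second
is bounded, are far apart. -/
theorem le_add_norm_sub_of_card_lt [DecidableEq n] {κ : Type*} [Fintype κ] {A B : Matrix m n ℝ}
    {W₁ : Matrix n ι ℝ}
    (W₂ : Matrix n κ ℝ) (hW : W₁ᵀ * W₁ = 1) (hcard : Fintype.card κ < Fintype.card ι) {α β : ℝ}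
    (hA : ∀ c, α * ‖WithLp.toLp 2 (W₁ *ᵥ c)‖ ≤ ‖WithLp.toLp 2 (A *ᵥ (W₁ *ᵥ c))‖)
    (hB : ∀ x, W₂ᵀ *ᵥ x = 0 → ‖WithLp.toLp 2 (B *ᵥ x)‖ ≤ β * ‖WithLp.toLp 2 x‖) :
    α ≤ β + ‖A - B‖ := by
  -- W₁ has more columns than there are constraints, so some nonzero x = W₁c satisfies W₂ᵀx = 0;
  -- comparing ‖Ax‖ with ‖Bx‖ + ‖(A - B)x‖ at this x suffices.
  obtain ⟨c, hc0, hc⟩ := exists_mulVec_eq_zero_of_card_lt (W₂ᵀ * W₁) hcard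
  set x := W₁ *ᵥ c with hx
  have hpos : 0 < ‖WithLp.toLp 2 x‖ := by
    have h1 := norm_toLp_mulVec_of_isometry hW c
    have h2 : 0 < ∑ j, c j ^ 2 := by
      obtain ⟨j, hj⟩ := Function.ne_iff.1 hc0
      exact Finset.sum_pos' (fun _ _ => sq_nonneg _) ⟨j, Finset.mem_univ _, by
        have : c j ≠ 0 := hj
        positivity⟩
    rw [← h1, ← hx] at h2
    exact lt_of_le_of_ne (norm_nonneg _) fun h0 => by simp [← h0] at h2
  have h1 := hA c
  have h2 := hB x (by rw [hx, Matrix.mulVec_mulVec, hc])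
  have h3 := norm_toLp_mulVec_le (A - B) x
  have h4 : ‖WithLp.toLp 2 (A *ᵥ x)‖ ≤ ‖WithLp.toLp 2 (B *ᵥ x)‖ + ‖WithLp.toLp 2 ((A - B) *ᵥ x)‖ := by
    refine le_trans (le_of_eq ?_) (norm_add_le _ _)
    rw [← WithLp.toLp_add, ← Matrix.add_mulVec, add_sub_cancel]
  rw [← hx] at h1
  have : α * ‖WithLp.toLp 2 x‖ ≤ (β + ‖A - B‖) * ‖WithLp.toLp 2 x‖ := by
    rw [add_mul]; linarith
  exact le_of_mul_le_mul_right this hpos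

theorem sum_sq_transpose_mulVec [DecidableEq n] {W : Matrix n n ℝ} (h : Wᵀ * W = 1) (x : n → ℝ) :
    ∑ j, (Wᵀ *ᵥ x) j ^ 2 = ‖WithLp.toLp 2 x‖ ^ 2 := by
  have h' := mul_eq_one_comm.1 h
  rw [← norm_toLp_mulVec_of_isometry h, Matrix.mulVec_mulVec, h', Matrix.one_mulVec]

theorem submatrix_isometry {ι κ : Type*} [DecidableEq ι] [DecidableEq κ]
    {W : Matrix n ι ℝ} (h : Wᵀ * W = 1) {e : κ → ι} (he : Function.Injective e) :
    (W.submatrix id e)ᵀ * W.submatrix id e = 1 := by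
  have : (W.submatrix id e)ᵀ * W.submatrix id e = (Wᵀ * W).submatrix e e := rfl
  rw [this, h, Matrix.submatrix_one _ he]

end SingularValues

/-! ### Weyl's inequality for the singular values -/

section Weyl

variable {d₁ d₂ r : ℕ} {M Mh : Matrix (Fin d₁) (Fin d₂) ℝ} {U : Matrix (Fin d₁) (Fin r) ℝ}
  {lam : Fin r → ℝ} {V : Matrix (Fin d₂) (Fin r) ℝ} {U' : Matrix (Fin d₁) (Fin d₁) ℝ}
  {sv : ℕ → ℝ} {V' : Matrix (Fin d₂) (Fin d₂) ℝ}

/-- Indices start at 0. M expands the r-dimensional range of V by at least l, while `Mh` is bounded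
by its j-th singular value on the orthogonal complement of its first j right singular vectors; j < r
makes the two spaces meet. -/
theorem le_columnSV_add_norm_sub (h : IsCompactSVD M U lam V) (h' : IsFullSVD Mh U' sv V')
    (h₁ : r ≤ d₁) {l : ℝ} (hl : 0 ≤ l) (hlam : ∀ i, l ≤ lam i) (j : Fin d₂) (hj : (j : ℕ) < r) :
    l ≤ columnSV d₁ sv j + ‖M - Mh‖ := by
  refine le_add_norm_sub_of_card_lt (W₁ := V)
    (V'.submatrix id (Fin.castLE j.2.le : Fin j → Fin d₂)) h.right_orthonormal (by simpa using hj)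
    (fun c => ?_) fun x hx => ?_
  · refine le_of_sq_le_sq ?_ (norm_nonneg _)
    rw [norm_toLp_mulVec_sq M V _ h.transpose_mul_self, mul_pow,
      norm_toLp_mulVec_of_isometry h.right_orthonormal, Finset.mul_sum, Matrix.mulVec_mulVec,
      h.right_orthonormal, Matrix.one_mulVec]
    gcongr with i
    exact hlam i
  · have hs : 0 ≤ columnSV d₁ sv j := by
      rw [columnSV]; split_ifs; exacts [h'.nonneg _, le_rfl]
    refine le_of_sq_le_sq ?_ (mul_nonneg hs (norm_nonneg _))
    rw [norm_toLp_mulVec_sq Mh V' _ h'.transpose_mul_self, mul_pow,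
      ← sum_sq_transpose_mulVec h'.right_orthogonal, Finset.mul_sum]
    refine Finset.sum_le_sum fun i _ => ?_
    by_cases hi : (i : ℕ) < j
    · have : (V'ᵀ *ᵥ x) i = 0 := congrFun hx ⟨i, hi⟩
      rw [this]; simp
    · have hjd : (j : ℕ) < d₁ := hj.trans_le h₁
      have h0 : 0 ≤ columnSV d₁ sv i := by
        rw [columnSV]; split_ifs; exacts [h'.nonneg _, le_rfl]
      have : columnSV d₁ sv i ≤ columnSV d₁ sv j := by
        rw [columnSV, columnSV, if_pos hjd]
        split_ifs
        exacts [h'.antitone (not_lt.1 hi), h'.nonneg _]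
      gcongr

/-- The roles are exchanged: `Mh` expands the span of its first j + 1 > r right singular vectors,
and M vanishes on the kernel of Vᵀ, so β = 0. The index bound must include j itself. -/
theorem columnSV_le_norm_sub (h : IsCompactSVD M U lam V) (h' : IsFullSVD Mh U' sv V')
    (j : Fin d₂) (hj : r ≤ (j : ℕ)) : columnSV d₁ sv j ≤ ‖Mh - M‖ := by
  by_cases hjd : (j : ℕ) < d₁
  swap
  · rw [columnSV, if_neg hjd]; exact norm_nonneg _
  have hinj : Function.Injective (Fin.castLE j.2 : Fin (j + 1) → Fin d₂) := Fin.castLE_injective _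
  have := le_add_norm_sub_of_card_lt (A := Mh) (B := M) (α := columnSV d₁ sv j) (β := 0)
    (W₁ := V'.submatrix id (Fin.castLE j.2 : Fin (j + 1) → Fin d₂)) V
    (submatrix_isometry h'.right_orthogonal hinj) (by simpa using Nat.lt_succ_of_le hj)
    (fun c => ?_) fun x hx => ?_
  · simpa using this
  · refine le_of_sq_le_sq ?_ (norm_nonneg _)
    set x := V'.submatrix id (Fin.castLE j.2 : Fin (j + 1) → Fin d₂) *ᵥ c with hx
    rw [norm_toLp_mulVec_sq Mh V' _ h'.transpose_mul_self, mul_pow,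
      ← sum_sq_transpose_mulVec h'.right_orthogonal, Finset.mul_sum]
    refine Finset.sum_le_sum fun i _ => ?_
    by_cases hi : (i : ℕ) ≤ j
    · have : columnSV d₁ sv j ≤ columnSV d₁ sv i := by
        rw [columnSV, columnSV, if_pos hjd, if_pos (hi.trans_lt hjd)]
        exact h'.antitone hi
      have hs : 0 ≤ columnSV d₁ sv j := by
        rw [columnSV, if_pos hjd]; exact h'.nonneg _
      gcongr
    · have : (V'ᵀ *ᵥ x) i = 0 := by
        have e : V'ᵀ * V'.submatrix id (Fin.castLE j.2 : Fin (j + 1) → Fin d₂)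
            = (1 : Matrix (Fin d₂) (Fin d₂) ℝ).submatrix id (Fin.castLE j.2) := by
          rw [← h'.right_orthogonal]; rfl
        rw [hx, Matrix.mulVec_mulVec, e, Matrix.mulVec, dotProduct]
        refine Finset.sum_eq_zero fun k _ => ?_
        rw [Matrix.submatrix_apply, id, Matrix.one_apply_ne, zero_mul]
        rintro rfl
        exact hi (Nat.lt_succ_iff.1 k.2)
      rw [this]; simp
  · rw [h.eq, ← Matrix.mulVec_mulVec, hx]
    simp

end Weyl

/-! ### Explicit contour integrals from a singular value decomposition -/

section ExplicitContour

theorem circleIntegral_sub_inv_eq_ite {ρ : ℝ} (hρ : 0 < ρ) {w : ℂ} (hw : ‖w‖ ≠ ρ) :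
    CircleIntegrable (fun z => (z - w)⁻¹) 0 ρ ∧
      (∮ z in C(0, ρ), (z - w)⁻¹) = if ‖w‖ < ρ then 2 * Real.pi * Complex.I else 0 := by
  have hne : ∀ z ∈ Metric.sphere (0 : ℂ) ρ, z - w ≠ 0 := fun z hz h => by
    rw [sub_eq_zero] at h
    subst h
    exact hw (by simpa using hz)
  refine ⟨ContinuousOn.circleIntegrable hρ.le (ContinuousOn.inv₀ (by fun_prop) hne), ?_⟩
  split_ifs with h
  · exact circleIntegral.integral_sub_inv_of_mem_ball (by simpa using h)
  · have hlt : ρ < ‖w‖ := lt_of_le_of_ne (not_lt.1 h) hw.symm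
    have hne' : ∀ z ∈ Metric.closedBall (0 : ℂ) ρ, z - w ≠ 0 := fun z hz h => by
      rw [sub_eq_zero] at h
      subst h
      exact absurd hlt (not_lt.2 (by simpa using hz))
    refine Complex.circleIntegral_eq_zero_of_differentiable_on_off_countable hρ.le
      Set.countable_empty (ContinuousOn.inv₀ (by fun_prop) hne') fun z hz => ?_
    exact DifferentiableAt.inv (by fun_prop) (hne' z (Metric.ball_subset_closedBall hz.1))

theorem sq_sub_sq_ne_zero_of_mem_sphere {ρ s : ℝ} (hs : |s| ≠ ρ) {z : ℂ}
    (hz : z ∈ Metric.sphere (0 : ℂ) ρ) : z ^ 2 - (s : ℂ) ^ 2 ≠ 0 := by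
  intro h
  have h1 : ‖z‖ ^ 2 = |s| ^ 2 := by
    rw [← norm_pow, sub_eq_zero.1 h, norm_pow, Complex.norm_real, Real.norm_eq_abs]
  have hz' : ‖z‖ = ρ := by simpa using hz
  exact hs (by
    rw [← hz']
    exact ((pow_left_inj₀ (norm_nonneg _) (abs_nonneg _) two_ne_zero).1 h1).symm)

/-- Partial fractions give the mean of 1/(z - s) and 1/(z + s), and the two poles lie on the same
side of the circle. The case s = 0 is included. -/
theorem circleIntegral_div_sq_sub_sq {ρ : ℝ} (hρ : 0 < ρ) {s : ℝ} (hs : |s| ≠ ρ) :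
    CircleIntegrable (fun z : ℂ => z * (z ^ 2 - (s : ℂ) ^ 2)⁻¹) 0 ρ ∧
      (∮ z in C(0, ρ), z * (z ^ 2 - (s : ℂ) ^ 2)⁻¹) =
        2 * Real.pi * Complex.I * (if |s| < ρ then 1 else 0) := by
  have hn : ‖(s : ℂ)‖ = |s| := by simp
  have hn' : ‖(-s : ℂ)‖ = |s| := by simp
  obtain ⟨i1, e1⟩ := circleIntegral_sub_inv_eq_ite hρ (w := s) (by rwa [hn])
  obtain ⟨i2, e2⟩ := circleIntegral_sub_inv_eq_ite hρ (w := -s) (by rwa [hn'])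
  have hne := fun z hz => sq_sub_sq_ne_zero_of_mem_sphere (ρ := ρ) hs (z := z) hz
  refine ⟨ContinuousOn.circleIntegrable hρ.le
    (ContinuousOn.mul (by fun_prop) (ContinuousOn.inv₀ (by fun_prop) hne)), ?_⟩
  have hE : Set.EqOn (fun z : ℂ => z * (z ^ 2 - (s : ℂ) ^ 2)⁻¹)
      (fun z => (1 / 2 : ℂ) * ((z - s)⁻¹ + (z - -s)⁻¹)) (Metric.sphere 0 ρ) := fun z hz => by
    have h := hne z hz
    rw [sq_sub_sq] at h
    have h1 : z - s ≠ 0 := right_ne_zero_of_mul h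
    have h2 : z - -s ≠ 0 := by rw [sub_neg_eq_add]; exact left_ne_zero_of_mul h
    have h3 : z + s ≠ 0 := left_ne_zero_of_mul h
    simp only [sq_sub_sq, sub_neg_eq_add]
    field_simp
    ring
  rw [circleIntegral.integral_congr hρ.le hE, circleIntegral.integral_const_mul,
    circleIntegral.integral_add i1 i2, e1, e2, hn, hn']
  split_ifs <;> ring

variable {n : Type*} [Fintype n] [DecidableEq n]

/-- The inverse of `z² - W diag(τ²) Wᵀ`. -/
noncomputable def sqResolvent (W : Matrix n n ℝ) (τ : n → ℝ) (z : ℂ) : Matrix n n ℂ :=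
  mapC W * Matrix.diagonal (fun j => (z ^ 2 - (τ j : ℂ) ^ 2)⁻¹) * (mapC W)ᵀ

theorem sub_mul_sqResolvent {W : Matrix n n ℝ} (hW : Wᵀ * W = 1) {τ : n → ℝ} {z : ℂ}
    (hz : ∀ j, z ^ 2 - (τ j : ℂ) ^ 2 ≠ 0) :
    z ^ 2 • sqResolvent W τ z
      - complexify (W * Matrix.diagonal (fun j => τ j ^ 2) * Wᵀ) * sqResolvent W τ z = 1 := by
  have h1 := mapC_transpose_mul_self hW
  have h2 := mul_eq_one_comm.1 h1
  rw [complexify_mul_diagonal_mul_transpose, sqResolvent]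
  set C := mapC W
  set D := Matrix.diagonal fun j => (z ^ 2 - (τ j : ℂ) ^ 2)⁻¹ with hD
  set L := Matrix.diagonal fun j => ((τ j ^ 2 : ℝ) : ℂ) with hL
  have h3 : C * L * Cᵀ * (C * D * Cᵀ) = C * (L * D) * Cᵀ := by
    calc _ = C * L * (Cᵀ * C) * D * Cᵀ := by simp only [Matrix.mul_assoc]
      _ = _ := by rw [h1, Matrix.mul_one, Matrix.mul_assoc C L D]
  have h4 : z ^ 2 • D - L * D = 1 := by
    rw [hD, hL, Matrix.diagonal_mul_diagonal, ← Matrix.diagonal_smul, Matrix.diagonal_sub,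
      ← Matrix.diagonal_one]
    congr 1
    funext j
    simp only [Pi.smul_apply, smul_eq_mul, Complex.ofReal_pow]
    rw [← sub_mul, mul_inv_cancel₀ (hz j)]
  rw [h3, ← Matrix.smul_mul, ← Matrix.mul_smul, ← Matrix.sub_mul, ← Matrix.mul_sub, h4,
    Matrix.mul_one, h2]

theorem trace_mul_sqResolvent (Q W : Matrix n n ℝ) (τ : n → ℝ) (z : ℂ) :
    (complexify Q * (z • sqResolvent W τ z)).trace =
      ∑ j, ((Wᵀ * Q * W) j j : ℂ) * (z * (z ^ 2 - (τ j : ℂ) ^ 2)⁻¹) := by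
  have e : (complexify Q * (z • sqResolvent W τ z)).trace
      = z * (complexify (Wᵀ * Q * W) * Matrix.diagonal fun j => (z ^ 2 - (τ j : ℂ) ^ 2)⁻¹).trace := by
    have hc : complexify (Wᵀ * Q * W) = (mapC W)ᵀ * complexify Q * mapC W := by
      rw [map_mul, map_mul]; rfl
    rw [Matrix.mul_smul, Matrix.trace_smul, smul_eq_mul, sqResolvent, hc, ← Matrix.mul_assoc,
      Matrix.trace_mul_comm]
    simp only [Matrix.mul_assoc]
  rw [e, Matrix.trace, Finset.mul_sum]
  refine Finset.sum_congr rfl fun j _ => ?_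
  rw [Matrix.diag_apply, Matrix.mul_diagonal, complexify_apply]
  ring

/-- The contour acts as a spectral projection: only the columns of W with |τ j| inside the circle
survive. -/
theorem circleIntegral_trace_mul_sqResolvent (Q W : Matrix n n ℝ) {τ : n → ℝ} {ρ : ℝ} (hρ : 0 < ρ)
    (hτ : ∀ j, |τ j| ≠ ρ) :
    CircleIntegrable (fun z => (complexify Q * (z • sqResolvent W τ z)).trace) 0 ρ ∧
    (∮ z in C(0, ρ), (complexify Q * (z • sqResolvent W τ z)).trace) =
      2 * Real.pi * Complex.I * ((∑ j, if |τ j| < ρ then (Wᵀ * Q * W) j j else 0 : ℝ) : ℂ) := by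
  simp only [trace_mul_sqResolvent]
  have h := fun j => circleIntegral_div_sq_sub_sq hρ (hτ j)
  have hi : ∀ j : n, CircleIntegrable (fun z : ℂ => ((Wᵀ * Q * W) j j : ℂ) *
      (z * (z ^ 2 - (τ j : ℂ) ^ 2)⁻¹)) 0 ρ := fun j => (h j).1.const_smul (a := ((Wᵀ * Q * W) j j : ℂ))
  refine ⟨CircleIntegrable.fun_sum _ fun j _ => hi j, ?_⟩
  rw [circleIntegral.integral_fun_sum fun j _ => hi j, Complex.ofReal_sum, Finset.mul_sum]
  refine Finset.sum_congr rfl fun j _ => ?_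
  rw [circleIntegral.integral_const_mul, (h j).2]
  split_ifs <;> simp
  ring

theorem sum_ite_lt_eq_sum_castLE {d r : ℕ} (h : r ≤ d) (q : Fin d → ℝ) :
    (∑ j : Fin d, if r ≤ (j : ℕ) then q j else 0) = ∑ j, q j - ∑ i : Fin r, q (Fin.castLE h i) := by
  obtain ⟨m, rfl⟩ := Nat.exists_eq_add_of_le h
  rw [Fin.sum_univ_add, Fin.sum_univ_add]
  have h1 : ∀ i : Fin r, ¬ r ≤ ((Fin.castAdd m i : Fin (r + m)) : ℕ) := fun i => by simp
  have h2 : ∀ i : Fin m, r ≤ ((Fin.natAdd r i : Fin (r + m)) : ℕ) := fun i => by simp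
  simp only [h1, h2, if_true, if_false, Finset.sum_const_zero]
  have h3 : ∀ i : Fin r, Fin.castLE h i = Fin.castAdd m i := fun i => rfl
  simp only [h3]
  ring

end ExplicitContour

/-! ### Operator norms under complexification and dilation -/

section NormComparison

variable {m n : Type*} [Fintype m] [Fintype n]

theorem norm_toLp_re_le {ι : Type*} [Fintype ι] (v : EuclideanSpace ℂ ι) :
    ‖WithLp.toLp 2 (fun i => (v i).re)‖ ≤ ‖v‖ ∧ ‖WithLp.toLp 2 (fun i => (v i).im)‖ ≤ ‖v‖ := by
  constructor <;>
  · refine le_of_sq_le_sq ?_ (norm_nonneg _)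
    rw [EuclideanSpace.norm_sq_eq, EuclideanSpace.norm_sq_eq]
    refine Finset.sum_le_sum fun i _ => ?_
    have h1 := Complex.abs_re_le_norm (v i)
    have h2 := Complex.abs_im_le_norm (v i)
    simp only [Real.norm_eq_abs]
    gcongr

/-- Splitting a complex vector into real and imaginary parts loses a factor 2, which only affects
absolute constants. -/
theorem norm_mapC_le_two_mul [DecidableEq n] (A : Matrix m n ℝ) : ‖mapC A‖ ≤ 2 * ‖A‖ := by
  rw [Matrix.l2_opNorm_def]
  refine ContinuousLinearMap.opNorm_le_bound _ (by positivity) fun v => ?_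
  set a : n → ℝ := fun i => (v i).re
  set b : n → ℝ := fun i => (v i).im
  obtain ⟨ha, hb⟩ := norm_toLp_re_le v
  set ca : EuclideanSpace ℂ m := WithLp.toLp 2 fun i => ((A *ᵥ a) i : ℂ) with hca
  set cb : EuclideanSpace ℂ m := WithLp.toLp 2 fun i => ((A *ᵥ b) i : ℂ) with hcb
  have hn : ∀ x : m → ℝ, ‖(WithLp.toLp 2 fun i => (x i : ℂ) : EuclideanSpace ℂ m)‖ =
      ‖WithLp.toLp 2 x‖ := fun x => by
    simp [EuclideanSpace.norm_eq]
  have e : (Matrix.toEuclideanLin (mapC A)).toContinuousLinearMap v = ca + Complex.I • cb := by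
    ext i
    simp only [LinearMap.coe_toContinuousLinearMap', Matrix.toLpLin_apply, hca, hcb,
      PiLp.add_apply, PiLp.smul_apply, Matrix.mulVec, dotProduct, Matrix.map_apply, smul_eq_mul,
      Complex.ofReal_sum, Complex.ofReal_mul, Finset.mul_sum]
    rw [← Finset.sum_add_distrib]
    refine Finset.sum_congr rfl fun j _ => ?_
    conv_lhs => rw [← Complex.re_add_im (v j)]
    simp only [a, b]
    ring
  refine (le_of_eq (congrArg _ e)).trans ?_
  calc ‖ca + Complex.I • cb‖ ≤ ‖ca‖ + ‖cb‖ := by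
        refine (norm_add_le _ _).trans (le_of_eq ?_)
        rw [norm_smul, Complex.norm_I, one_mul]
    _ ≤ ‖A‖ * ‖v‖ + ‖A‖ * ‖v‖ := by
        rw [hca, hcb, hn, hn]
        exact add_le_add ((norm_toLp_mulVec_le A a).trans (by gcongr))
          ((norm_toLp_mulVec_le A b).trans (by gcongr))
    _ = 2 * ‖A‖ * ‖v‖ := by ring

theorem norm_complexify_dilation_le {d₁ d₂ : ℕ} (Z : Matrix (Fin d₁) (Fin d₂) ℝ) :
    ‖complexify (dilation Z)‖ ≤ 4 * ‖Z‖ := by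
  set E₁ : Matrix (Fin d₁ ⊕ Fin d₂) (Fin d₁) ℝ := Matrix.fromRows 1 0 with hE₁
  set E₂ : Matrix (Fin d₁ ⊕ Fin d₂) (Fin d₂) ℝ := Matrix.fromRows 0 1 with hE₂
  have h1 : E₁ᵀ * E₁ = 1 := by
    simp [hE₁, Matrix.transpose_fromRows, Matrix.fromCols_mul_fromRows]
  have h2 : E₂ᵀ * E₂ = 1 := by
    simp [hE₂, Matrix.transpose_fromRows, Matrix.fromCols_mul_fromRows]
  have e : dilation Z = E₁ * Z * E₂ᵀ + E₂ * Zᵀ * E₁ᵀ := by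
    simp only [hE₁, hE₂, dilation, Matrix.transpose_fromRows, Matrix.fromRows_mul]
    ext (i | i) (j | j) <;> simp
  have e' : complexify (dilation Z)
      = mapC E₁ * mapC Z * (mapC E₂)ᵀ + mapC E₂ * (mapC Z)ᴴ * (mapC E₁)ᵀ := by
    rw [e, map_add]
    congr 1 <;>
    · ext i j
      simp [complexify_apply, Matrix.mul_apply]
  have key : ∀ {p q : ℕ} (F : Matrix (Fin d₁ ⊕ Fin d₂) (Fin p) ℝ)
      (G : Matrix (Fin d₁ ⊕ Fin d₂) (Fin q) ℝ) (B : Matrix (Fin p) (Fin q) ℂ),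
      Fᵀ * F = 1 → Gᵀ * G = 1 → ‖mapC F * B * (mapC G)ᵀ‖ ≤ ‖B‖ := fun F G B hF hG =>
    calc _ ≤ ‖mapC F * B‖ * ‖(mapC G)ᵀ‖ := Matrix.l2_opNorm_mul _ _
      _ ≤ ‖mapC F‖ * ‖B‖ * ‖(mapC G)ᵀ‖ := by
        gcongr; exact Matrix.l2_opNorm_mul _ _
      _ ≤ 1 * ‖B‖ * 1 := by
        gcongr
        · exact norm_mapC_le_one hF
        · exact norm_mapC_transpose_le_one hG
      _ = ‖B‖ := by ring
  have h3 := norm_mapC_le_two_mul Z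
  have h4 := key E₁ E₂ (mapC Z) h1 h2
  have h5 := key E₂ E₁ (mapC Z)ᴴ h2 h1
  rw [Matrix.l2_opNorm_conjTranspose] at h5
  rw [e']
  refine (norm_add_le _ _).trans ?_
  linarith

end NormComparison

/-! ### Distance of projections through a trace -/

section ProjectionDistance

theorem frobSq_eq_trace {m n : Type*} [Fintype m] [Fintype n] (A : Matrix m n ℝ) :
    frobSq A = (Aᵀ * A).trace := by
  rw [frobSq, Finset.sum_comm]
  simp [Matrix.trace, Matrix.mul_apply, sq]

theorem frobSq_nonneg {m n : Type*} [Fintype m] [Fintype n] (A : Matrix m n ℝ) : 0 ≤ frobSq A :=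
  Finset.sum_nonneg fun _ _ => Finset.sum_nonneg fun _ _ => sq_nonneg _

variable {n : Type*} [Fintype n] {r : ℕ} {Uh U : Matrix n (Fin r) ℝ}

/-- Expanding the square leaves the two ranks, both r, minus twice the overlap. Half the distance is
thus the part of one projector lying outside the other, which the contour integral computes. -/
theorem frobSq_proj_sub_proj (hUh : Uhᵀ * Uh = 1) (hU : Uᵀ * U = 1) :
    frobSq (Uh * Uhᵀ - U * Uᵀ) = 2 * (r - (Uhᵀ * (U * Uᵀ) * Uh).trace) := by
  have t1 : (Uh * Uhᵀ).trace = r := by rw [Matrix.trace_mul_comm, hUh]; simp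
  have t2 : (U * Uᵀ).trace = r := by rw [Matrix.trace_mul_comm, hU]; simp
  have p1 : Uh * Uhᵀ * (Uh * Uhᵀ) = Uh * Uhᵀ := by
    rw [Matrix.mul_assoc, ← Matrix.mul_assoc Uhᵀ, hUh, Matrix.one_mul]
  have p2 : U * Uᵀ * (U * Uᵀ) = U * Uᵀ := by
    rw [Matrix.mul_assoc, ← Matrix.mul_assoc Uᵀ, hU, Matrix.one_mul]
  have c1 : (Uh * Uhᵀ * (U * Uᵀ)).trace = (Uhᵀ * (U * Uᵀ) * Uh).trace := by
    rw [Matrix.mul_assoc, Matrix.trace_mul_comm]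
  have c2 : (U * Uᵀ * (Uh * Uhᵀ)).trace = (Uhᵀ * (U * Uᵀ) * Uh).trace := by
    rw [Matrix.trace_mul_comm, c1]
  rw [frobSq_eq_trace]
  simp only [Matrix.transpose_sub, Matrix.transpose_mul, Matrix.transpose_transpose,
    Matrix.sub_mul, Matrix.mul_sub, Matrix.trace_sub, p1, p2, c1, c2, t1, t2]
  ring

theorem frobSq_proj_sub_proj_le (hUh : Uhᵀ * Uh = 1) (hU : Uᵀ * U = 1) :
    frobSq (Uh * Uhᵀ - U * Uᵀ) ≤ 2 * r := by
  have h : (Uhᵀ * (U * Uᵀ) * Uh).trace = frobSq (Uᵀ * Uh) := by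
    rw [frobSq_eq_trace]
    simp only [Matrix.transpose_mul, Matrix.transpose_transpose, Matrix.mul_assoc]
  rw [frobSq_proj_sub_proj hUh hU, h]
  linarith [frobSq_nonneg (Uᵀ * Uh)]

end ProjectionDistance

/-! ### Deterministic expansion of the distance -/

section SingularSubspaces

variable {d₁ d₂ r : ℕ} {M Mh : Matrix (Fin d₁) (Fin d₂) ℝ} {U : Matrix (Fin d₁) (Fin r) ℝ}
  {lam : Fin r → ℝ} {V : Matrix (Fin d₂) (Fin r) ℝ} {U' : Matrix (Fin d₁) (Fin d₁) ℝ}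
  {sv : ℕ → ℝ} {V' : Matrix (Fin d₂) (Fin d₂) ℝ}

/-- By Weyl, the top r singular values exceed l - l/2 and the others stay below l/2, so the circle
of radius l/2 separates them and meets none. -/
theorem columnSV_gap (h : IsCompactSVD M U lam V) (h' : IsFullSVD Mh U' sv V') (h₁ : r ≤ d₁)
    {l : ℝ} (hl : 0 < l) (hlam : ∀ i, l ≤ lam i) (hd : ‖Mh - M‖ < l / 2) (j : Fin d₂) :
    |columnSV d₁ sv j| ≠ l / 2 ∧ (|columnSV d₁ sv j| < l / 2 ↔ r ≤ (j : ℕ)) := by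
  have h0 : 0 ≤ columnSV d₁ sv j := by
    rw [columnSV]; split_ifs; exacts [h'.nonneg _, le_rfl]
  rw [abs_of_nonneg h0]
  rcases le_or_gt r (j : ℕ) with hj | hj
  · have := columnSV_le_norm_sub h h' j hj
    exact ⟨by linarith, fun _ => hj, fun _ => by linarith⟩
  · have := le_columnSV_add_norm_sub h h' h₁ hl.le hlam j hj
    rw [norm_sub_rev] at this
    exact ⟨by linarith, fun _ => by linarith, fun h => absurd hj (not_lt.2 h)⟩

theorem circleIntegral_trace_columnProj (h : IsCompactSVD M U lam V) (h' : IsFullSVD Mh U' sv V')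
    (h₁ : r ≤ d₁) (h₂ : r ≤ d₂) {l : ℝ} (hl : 0 < l) (hlam : ∀ i, l ≤ lam i)
    (hd : ‖Mh - M‖ < l / 2) {Vh : Matrix (Fin d₂) (Fin r) ℝ}
    (hVh : Vh = V'.submatrix id (Fin.castLE h₂)) :
    CircleIntegrable (fun z => (complexify (V * Vᵀ) *
      (z • sqResolvent V' (columnSV d₁ sv) z)).trace) 0 (l / 2) ∧
    (∮ z in C(0, l / 2), (complexify (V * Vᵀ) * (z • sqResolvent V' (columnSV d₁ sv) z)).trace) =
      2 * Real.pi * Complex.I * (frobSq (Vh * Vhᵀ - V * Vᵀ) / 2 : ℝ) := by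
  have hg := columnSV_gap h h' h₁ hl hlam hd
  obtain ⟨hi, he⟩ := circleIntegral_trace_mul_sqResolvent (V * Vᵀ) V' (half_pos hl)
    fun j => (hg j).1
  refine ⟨hi, ?_⟩
  have hVh1 : Vhᵀ * Vh = 1 := by
    rw [hVh]; exact submatrix_isometry h'.right_orthogonal (Fin.castLE_injective h₂)
  have ht : (∑ j, (V'ᵀ * (V * Vᵀ) * V') j j) = r := by
    have : (V'ᵀ * (V * Vᵀ) * V').trace = r := by
      rw [Matrix.trace_mul_comm, ← Matrix.mul_assoc, mul_eq_one_comm.1 h'.right_orthogonal,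
        Matrix.one_mul, Matrix.trace_mul_comm, h.right_orthonormal]
      simp
    exact this
  have hs : (∑ i : Fin r, (V'ᵀ * (V * Vᵀ) * V') (Fin.castLE h₂ i) (Fin.castLE h₂ i))
      = (Vhᵀ * (V * Vᵀ) * Vh).trace := by
    rw [hVh]; rfl
  rw [he, frobSq_proj_sub_proj hVh1 h.right_orthonormal]
  -- The columns inside the circle are those with index at least r, so the sum is the full trace r
  -- minus the overlap of the top r columns.
  simp only [fun j => (hg j).2]
  rw [sum_ite_lt_eq_sum_castLE h₂, ht, hs]
  congr 2
  ring

theorem dilVec_mul_diagonal_mul_transpose (U : Matrix (Fin d₁) (Fin r) ℝ) (lam : Fin r → ℝ)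
    (V : Matrix (Fin d₂) (Fin r) ℝ) :
    dilVec U V * Matrix.diagonal (dilVal lam) * (dilVec U V)ᵀ
      = dilation (U * Matrix.diagonal lam * Vᵀ) := by
  have hd : Matrix.diagonal (dilVal lam)
      = Matrix.fromBlocks (Matrix.diagonal lam) 0 0 (-Matrix.diagonal lam) := by
    rw [dilVal, ← Matrix.fromBlocks_diagonal, ← Matrix.diagonal_neg]
  have h2 : (Real.sqrt 2)⁻¹ * (Real.sqrt 2)⁻¹ = 1 / 2 := by
    rw [← mul_inv, Real.mul_self_sqrt zero_le_two]; norm_num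
  rw [hd, dilVec, Matrix.transpose_smul, Matrix.smul_mul, Matrix.smul_mul, Matrix.mul_smul,
    smul_smul, h2, Matrix.fromBlocks_transpose, Matrix.fromBlocks_multiply,
    Matrix.fromBlocks_multiply, dilation, Matrix.fromBlocks_smul]
  congr 1
  · simp only [Matrix.mul_zero, add_zero, zero_add, Matrix.mul_neg, Matrix.neg_mul,
      add_neg_cancel, smul_zero]
  · simp only [Matrix.mul_zero, add_zero, zero_add, Matrix.mul_neg, Matrix.neg_mul,
      Matrix.transpose_neg, neg_neg]
    rw [← two_smul ℝ, smul_smul]; norm_num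
  · simp only [Matrix.mul_zero, add_zero, zero_add, Matrix.mul_neg, Matrix.neg_mul,
      neg_neg, Matrix.transpose_mul, Matrix.transpose_transpose,
      Matrix.diagonal_transpose, Matrix.mul_assoc]
    rw [← two_smul ℝ, smul_smul]; norm_num
  · simp only [Matrix.mul_zero, add_zero, zero_add, Matrix.mul_neg, Matrix.neg_mul,
      Matrix.transpose_neg, neg_neg, add_neg_cancel, smul_zero]

theorem complexify_dilation (Mh : Matrix (Fin d₁) (Fin d₂) ℝ) :
    complexify (dilation Mh) = Matrix.fromBlocks 0 (mapC Mh) (mapC Mh)ᵀ 0 := by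
  ext (i | i) (j | j) <;> simp [complexify_apply, dilation]

/-- The resolvent of the dilation in terms of the two squared resolvents. -/
theorem sub_complexify_dilation_mul {z : ℂ} {K₁ : Matrix (Fin d₁) (Fin d₁) ℂ}
    {K₂ : Matrix (Fin d₂) (Fin d₂) ℂ}
    (hK₁ : z ^ 2 • K₁ - complexify (Mh * Mhᵀ) * K₁ = 1)
    (hK₂ : z ^ 2 • K₂ - complexify (Mhᵀ * Mh) * K₂ = 1) :
    (z • 1 - complexify (dilation Mh)) *
      Matrix.fromBlocks (z • K₁) (mapC Mh * K₂) ((mapC Mh)ᵀ * K₁) (z • K₂) = 1 := by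
  have c1 : complexify (Mh * Mhᵀ) = mapC Mh * (mapC Mh)ᵀ := by
    ext i j; simp [complexify_apply, Matrix.mul_apply]
  have c2 : complexify (Mhᵀ * Mh) = (mapC Mh)ᵀ * mapC Mh := by
    ext i j; simp [complexify_apply, Matrix.mul_apply]
  rw [c1] at hK₁
  rw [c2] at hK₂
  rw [complexify_dilation, ← Matrix.fromBlocks_one, Matrix.fromBlocks_smul, sub_eq_add_neg,
    Matrix.fromBlocks_neg, Matrix.fromBlocks_add, Matrix.fromBlocks_multiply]
  congr 1
  · refine Eq.trans ?_ hK₁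
    simp [smul_smul, sq, Matrix.mul_assoc, sub_eq_add_neg]
  · simp
  · simp
  · refine Eq.trans ?_ hK₂
    simp [smul_smul, sq, Matrix.mul_assoc, sub_eq_add_neg, add_comm]

/-- The projector is block diagonal, so it sees only the diagonal blocks of the resolvent of the
dilation, and their two contour integrals add up to half the distance. The dilation of Z has norm at
most 4‖Z‖ ≤ l/12, and Θ has 2r columns, which gives 12r. -/
theorem abs_distSq_add_le_of_norm_le {Z : Matrix (Fin d₁) (Fin d₂) ℝ}
    {Uh : Matrix (Fin d₁) (Fin r) ℝ} {Vh : Matrix (Fin d₂) (Fin r) ℝ}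
    (h : IsCompactSVD M U lam V) (ht : IsTopSingularVectors (M + Z) Uh Vh) {l : ℝ} (hl : 0 < l)
    (hlam : ∀ i, l ≤ lam i) (hZ : ‖Z‖ ≤ l / 48) (N : ℕ) :
    |distSq Uh Vh U V / 2 + ∑ k ∈ Finset.range N, frobInner (dilVec U V * (dilVec U V)ᵀ)
      (perturbTerm (dilVec U V) (dilVal lam) k (dilation Z))| ≤
      12 * r * (24 * ‖Z‖ / l) ^ N := by
  obtain ⟨U', sv, V', h₁, h₂, h', hUh, hVh⟩ := ht
  have hΘ := dilVec_transpose_mul_self h.left_orthonormal h.right_orthonormal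
  have hlam' : ∀ j, l ≤ |dilVal lam j| := by
    rintro (j | j) <;> simpa [dilVal, abs_of_pos (h.pos j)] using hlam j
  have hZ' := norm_complexify_dilation_le Z
  have hd : ‖M + Z - M‖ < l / 2 := by
    rw [add_sub_cancel_left]; linarith
  have hdT : ‖(M + Z)ᵀ - Mᵀ‖ < l / 2 := by
    rw [← Matrix.transpose_sub, ← Matrix.conjTranspose_eq_transpose_of_trivial,
      Matrix.l2_opNorm_conjTranspose]
    exact hd
  obtain ⟨i2, e2⟩ := circleIntegral_trace_columnProj h h' h₁ h₂ hl hlam hd hVh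
  obtain ⟨i1, e1⟩ := circleIntegral_trace_columnProj h.transpose h'.transpose h₂ h₁ hl hlam hdT hUh
  have g2 := columnSV_gap h h' h₁ hl hlam hd
  have g1 := columnSV_gap h.transpose h'.transpose h₂ hl hlam hdT
  have hdil : dilVec U V * Matrix.diagonal (dilVal lam) * (dilVec U V)ᵀ + dilation Z
      = dilation (M + Z) := by
    rw [dilVec_mul_diagonal_mul_transpose, ← h.eq]
    simp [dilation, Matrix.fromBlocks_add]
  set K₁ := sqResolvent U' (columnSV d₂ sv)
  set K₂ := sqResolvent V' (columnSV d₁ sv)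
  have htr : ∀ z, (complexify (dilVec U V * (dilVec U V)ᵀ) *
      Matrix.fromBlocks (z • K₁ z) (mapC (M + Z) * K₂ z) ((mapC (M + Z))ᵀ * K₁ z) (z • K₂ z)).trace
      = (complexify (U * Uᵀ) * (z • K₁ z)).trace + (complexify (V * Vᵀ) * (z • K₂ z)).trace := by
    intro z
    have : complexify (dilVec U V * (dilVec U V)ᵀ)
        = Matrix.fromBlocks (complexify (U * Uᵀ)) 0 0 (complexify (V * Vᵀ)) := by
      rw [dilVec_mul_transpose]
      ext (i | i) (j | j) <;> simp [complexify_apply]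
    rw [this, Matrix.fromBlocks_multiply, trace_fromBlocks_eq]
    simp
  have key := abs_add_sum_perturbTerm_le hΘ hl hlam' (dilation Z) (by linarith)
    (fun z => Matrix.fromBlocks (z • K₁ z) (mapC (M + Z) * K₂ z) ((mapC (M + Z))ᵀ * K₁ z)
      (z • K₂ z)) (fun z hz => by
        rw [hdil]
        refine sub_complexify_dilation_mul ?_ ?_
        · have := h'.transpose.transpose_mul_self
          rw [Matrix.transpose_transpose] at this
          rw [this]
          exact sub_mul_sqResolvent h'.left_orthogonal fun j =>
            sq_sub_sq_ne_zero_of_mem_sphere (g1 j).1 hz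
        · rw [h'.transpose_mul_self]
          exact sub_mul_sqResolvent h'.right_orthogonal fun j =>
            sq_sub_sq_ne_zero_of_mem_sphere (g2 j).1 hz) (distSq Uh Vh U V / 2)
    (by simp only [htr]; exact CircleIntegrable.fun_add i1 i2)
    (by
      simp only [htr]
      rw [circleIntegral.integral_add i1 i2, e1, e2, distSq]
      push_cast
      ring) N
  refine key.trans ?_
  have : (6 * ‖complexify (dilation Z)‖ / l) ^ N ≤ (24 * ‖Z‖ / l) ^ N :=
    pow_le_pow_left₀ (by positivity) ((div_le_div_iff_of_pos_right hl).2 (by linarith)) _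
  rw [Fintype.card_sum, Fintype.card_fin]
  push_cast
  calc ((r : ℝ) + r) * 6 * _ ≤ ((r : ℝ) + r) * 6 * (24 * ‖Z‖ / l) ^ N := by gcongr
    _ = _ := by ring

theorem IsTopSingularVectors.orthonormal {Uh : Matrix (Fin d₁) (Fin r) ℝ}
    {Vh : Matrix (Fin d₂) (Fin r) ℝ} (h : IsTopSingularVectors Mh Uh Vh) :
    Uhᵀ * Uh = 1 ∧ Vhᵀ * Vh = 1 := by
  obtain ⟨U', sv, V', h₁, h₂, h', rfl, rfl⟩ := h
  exact ⟨submatrix_isometry h'.left_orthogonal (Fin.castLE_injective h₁),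
    submatrix_isometry h'.right_orthogonal (Fin.castLE_injective h₂)⟩

theorem distSq_nonneg (Uh : Matrix (Fin d₁) (Fin r) ℝ) (Vh : Matrix (Fin d₂) (Fin r) ℝ)
    (U : Matrix (Fin d₁) (Fin r) ℝ) (V : Matrix (Fin d₂) (Fin r) ℝ) : 0 ≤ distSq Uh Vh U V :=
  add_nonneg (frobSq_nonneg _) (frobSq_nonneg _)

theorem IsTopSingularVectors.distSq_le {Uh : Matrix (Fin d₁) (Fin r) ℝ}
    {Vh : Matrix (Fin d₂) (Fin r) ℝ} (ht : IsTopSingularVectors Mh Uh Vh)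
    (hU : Uᵀ * U = 1) (hV : Vᵀ * V = 1) : distSq Uh Vh U V ≤ 4 * r := by
  have h1 := frobSq_proj_sub_proj_le ht.orthonormal.1 hU
  have h2 := frobSq_proj_sub_proj_le ht.orthonormal.2 hV
  rw [distSq]
  linarith

/-- The spectral projector expansion with a sixth order remainder, for arbitrary perturbations. -/
theorem abs_distSq_add_le {Z : Matrix (Fin d₁) (Fin d₂) ℝ}
    {Uh : Matrix (Fin d₁) (Fin r) ℝ} {Vh : Matrix (Fin d₂) (Fin r) ℝ}
    (h : IsCompactSVD M U lam V) (ht : IsTopSingularVectors (M + Z) Uh Vh) {l : ℝ} (hl : 0 < l)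
    (hlam : ∀ i, l ≤ lam i) :
    |distSq Uh Vh U V / 2 + ∑ k ∈ Finset.range 6, frobInner (dilVec U V * (dilVec U V)ᵀ)
      (perturbTerm (dilVec U V) (dilVal lam) k (dilation Z))| ≤
      2000000 * r * (48 * ‖Z‖ / l) ^ 6 := by
  rcases le_or_gt ‖Z‖ (l / 48) with hZ | hZ
  · refine (abs_distSq_add_le_of_norm_le h ht hl hlam hZ 6).trans ?_
    gcongr <;> norm_num
  -- For large Z there is no cancellation to exploit: with y ≥ 1 each term is at most a multiple of
  -- r y^6. The total constant is 2 + 2 · 518770, below 2000000.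
  · have hy : 1 ≤ 48 * ‖Z‖ / l := by
      rw [le_div_iff₀ hl]; linarith
    set y := 48 * ‖Z‖ / l with hydef
    have hΘ := dilVec_transpose_mul_self h.left_orthonormal h.right_orthonormal
    have hlam' : ∀ j, l ≤ |dilVal lam j| := by
      rintro (j | j) <;> simpa [dilVal, abs_of_pos (h.pos j)] using hlam j
    have hx : ‖complexify (dilation Z)‖ / l ≤ y := by
      rw [hydef]
      gcongr
      linarith [norm_complexify_dilation_le Z, norm_nonneg Z]
    have hk : ∀ k ∈ Finset.range 6, |frobInner (dilVec U V * (dilVec U V)ᵀ)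
        (perturbTerm (dilVec U V) (dilVal lam) k (dilation Z))| ≤
        2 * r * y ^ 6 * (2 ^ (k + 1) * (k + 1) ^ k) := by
      intro k hk
      refine (abs_frobInner_perturbTerm_le hΘ hl hlam' (dilation Z) k).trans ?_
      have h1 : (‖complexify (dilation Z)‖ / l) ^ k ≤ y ^ 6 :=
        (pow_le_pow_left₀ (by positivity) hx k).trans
          (pow_le_pow_right₀ hy (Finset.mem_range.1 hk).le)
      rw [Fintype.card_sum, Fintype.card_fin]
      push_cast
      calc ((r : ℝ) + r) * (2 ^ (k + 1) * (k + 1) ^ k) * _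
          ≤ ((r : ℝ) + r) * (2 ^ (k + 1) * (k + 1) ^ k) * y ^ 6 := by gcongr
        _ = _ := by ring
    have hy6 : (r : ℝ) ≤ r * y ^ 6 := le_mul_of_one_le_right (by positivity) (one_le_pow₀ hy)
    have h0 := distSq_nonneg Uh Vh U V
    have h4 := ht.distSq_le h.left_orthonormal h.right_orthonormal
    have hs := (Finset.abs_sum_le_sum_abs _ _).trans (Finset.sum_le_sum hk)
    rw [← Finset.mul_sum] at hs
    have hnum : ∑ k ∈ Finset.range 6, ((2 : ℝ) ^ (k + 1) * ((k : ℝ) + 1) ^ k) = 518770 := by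
      simp only [Finset.sum_range_succ, Finset.sum_range_zero]; norm_num
    rw [hnum] at hs
    refine (abs_add_le _ _).trans ?_
    rw [abs_of_nonneg (by positivity : 0 ≤ distSq Uh Vh U V / 2)]
    have : 0 ≤ (r : ℝ) * y ^ 6 := by positivity
    linarith

end SingularSubspaces

/-! ### Parity and continuity of the perturbation terms -/

section Symmetry

variable {n ι : Type*} [Fintype n] [DecidableEq n] [Fintype ι] [DecidableEq ι]

theorem interlacedCoeff_neg {n : Type*} [Fintype n] (c : ℕ → Matrix n n ℝ) (X : Matrix n n ℝ)
    (k m : ℕ) :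
    interlacedCoeff c (-X) k m = (-1 : ℝ) ^ k • interlacedCoeff c X k m := by
  induction k generalizing m with
  | zero => simp [interlacedCoeff]
  | succ k ih =>
    simp only [interlacedCoeff, ih, Finset.smul_sum]
    refine Finset.sum_congr rfl fun p _ => ?_
    rw [Matrix.mul_smul, Matrix.mul_smul, Matrix.neg_mul, Matrix.mul_neg, pow_succ, smul_neg,
      mul_neg_one, neg_smul]

theorem frobInner_perturbTerm_neg (Θ : Matrix n ι ℝ) (lam : ι → ℝ) (k : ℕ) (X : Matrix n n ℝ) :
    frobInner (Θ * Θᵀ) (perturbTerm Θ lam k (-X)) =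
      (-1) ^ k * frobInner (Θ * Θᵀ) (perturbTerm Θ lam k X) := by
  simp only [frobInner_proj, perturbTerm_eq_neg_interlacedCoeff, interlacedCoeff_neg,
    Matrix.mul_smul, Matrix.trace_neg, Matrix.trace_smul, smul_eq_mul, mul_neg]

theorem continuous_interlacedCoeff {n : Type*} [Fintype n] (c : ℕ → Matrix n n ℝ) (k m : ℕ) :
    Continuous fun X => interlacedCoeff c X k m := by
  induction k generalizing m with
  | zero => simp only [interlacedCoeff]; exact continuous_const
  | succ k ih =>
    simp only [interlacedCoeff]
    exact continuous_finsetSum _ fun p _ =>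
      continuous_const.matrix_mul (continuous_id.matrix_mul (ih _))

theorem continuous_frobInner_perturbTerm (Θ : Matrix n ι ℝ) (lam : ι → ℝ) (k : ℕ) :
    Continuous fun X => frobInner (Θ * Θᵀ) (perturbTerm Θ lam k X) := by
  simp only [frobInner_proj, perturbTerm_eq_neg_interlacedCoeff]
  exact (continuous_const.matrix_mul (continuous_interlacedCoeff _ k k).neg).matrix_trace

/-- Each coordinate law is symmetric; together with the parity of the k-th term in X this removes
all odd orders. -/
theorem integral_comp_neg_stdGaussianPi {ι : Type*} [Fintype ι] (f : (ι → ℝ) → ℝ) :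
    ∫ z, f (-z) ∂(stdGaussianPi ι) = ∫ z, f z ∂(stdGaussianPi ι) := by
  have h : MeasurePreserving (fun z : ι → ℝ => -z) (stdGaussianPi ι) (stdGaussianPi ι) :=
    measurePreserving_pi _ _ (f := fun _ x => -x) fun _ =>
      ⟨measurable_neg, by rw [gaussianReal_map_neg, neg_zero]⟩
  exact h.integral_comp (MeasurableEquiv.neg (ι → ℝ)).measurableEmbedding f

end Symmetry

/-! ### Expectation of the truncated expansion -/

section Expansion

variable {d₁ d₂ r : ℕ} {U : Matrix (Fin d₁) (Fin r) ℝ} {V : Matrix (Fin d₂) (Fin r) ℝ}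
  {lam : Fin r → ℝ}

theorem continuous_frobInner_perturbTerm_dilation (U : Matrix (Fin d₁) (Fin r) ℝ)
    (V : Matrix (Fin d₂) (Fin r) ℝ) (lam : Fin r → ℝ) (k : ℕ) :
    Continuous fun z : Fin d₁ × Fin d₂ → ℝ => frobInner (dilVec U V * (dilVec U V)ᵀ)
      (perturbTerm (dilVec U V) (dilVal lam) k (dilation (matOf z))) :=
  (continuous_frobInner_perturbTerm _ _ k).comp
    (Continuous.matrix_fromBlocks continuous_const continuous_matOf
      continuous_matOf.matrix_transpose continuous_const)

theorem dilation_neg (Z : Matrix (Fin d₁) (Fin d₂) ℝ) : dilation (-Z) = -dilation Z := by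
  simp [dilation, Matrix.fromBlocks_neg]

/-- A term of order k ≤ 6 is dominated by a constant times 1 + (4‖Z‖/l)^6, so the sixth moment
suffices. -/
theorem integrable_perturbTerm (hU : Uᵀ * U = 1) (hV : Vᵀ * V = 1) (hlam : ∀ i, 0 < lam i)
    {l : ℝ} (hl : 0 < l) (hll : ∀ i, l ≤ lam i) (hd : 0 < max d₁ d₂) {k : ℕ} (hk : k ≤ 6) :
    Integrable (fun z => frobInner (dilVec U V * (dilVec U V)ᵀ)
      (perturbTerm (dilVec U V) (dilVal lam) k (dilation (matOf z))))
      (stdGaussianPi (Fin d₁ × Fin d₂)) := by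
  have h6 := (integrable_norm_matOf_pow_six_and_integral_le hd (le_max_left d₁ d₂)
    (le_max_right d₁ d₂)).1
  set C : ℝ := (Fintype.card (Fin r ⊕ Fin r)) * (2 ^ (k + 1) * (k + 1) ^ k) with hC
  refine Integrable.mono' ((((integrable_const (1 : ℝ)).add
    (h6.const_mul ((4 / l) ^ 6))).const_mul C))
    (continuous_frobInner_perturbTerm_dilation U V lam k).aestronglyMeasurable
    (Filter.Eventually.of_forall fun z => ?_)
  have hlam' : ∀ j, l ≤ |dilVal lam j| := by
    rintro (j | j) <;> simpa [dilVal, abs_of_pos (hlam j)] using hll j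
  refine (abs_frobInner_perturbTerm_le (dilVec_transpose_mul_self hU hV) hl hlam' _ k).trans ?_
  rw [← hC]
  refine mul_le_mul_of_nonneg_left ?_ (by positivity)
  simp only [Pi.add_apply]
  set x := ‖complexify (dilation (matOf z))‖ / l with hx
  have hx0 : 0 ≤ x := by positivity
  have hx4 : x ≤ 4 / l * ‖matOf z‖ := by
    rw [hx, div_mul_eq_mul_div]
    exact (div_le_div_iff_of_pos_right hl).2 (norm_complexify_dilation_le _)
  rw [← mul_pow]
  rcases le_total x 1 with h | h
  · have h1 := pow_le_one₀ (n := k) hx0 h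
    have : 0 ≤ (4 / l * ‖(matOf z : Matrix (Fin d₁) (Fin d₂) ℝ)‖) ^ 6 := by positivity
    linarith
  · have h1 := pow_le_pow_right₀ h hk
    have h2 := pow_le_pow_left₀ hx0 hx4 6
    linarith

theorem hasExpectation_perturbTerm_odd (hU : Uᵀ * U = 1) (hV : Vᵀ * V = 1) (hlam : ∀ i, 0 < lam i)
    {l : ℝ} (hl : 0 < l) (hll : ∀ i, l ≤ lam i) (hd : 0 < max d₁ d₂) {k : ℕ} (hk : k ≤ 6)
    (ho : Odd k) :
    HasExpectation (fun z => frobInner (dilVec U V * (dilVec U V)ᵀ)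
      (perturbTerm (dilVec U V) (dilVal lam) k (dilation (matOf z)))) 0
      (stdGaussianPi (Fin d₁ × Fin d₂)) := by
  refine ⟨integrable_perturbTerm hU hV hlam hl hll hd hk, ?_⟩
  have h := integral_comp_neg_stdGaussianPi fun z : Fin d₁ × Fin d₂ → ℝ =>
    frobInner (dilVec U V * (dilVec U V)ᵀ)
      (perturbTerm (dilVec U V) (dilVal lam) k (dilation (matOf z)))
  have e : ∀ z : Fin d₁ × Fin d₂ → ℝ, matOf (-z) = -matOf z := fun z => rfl
  simp only [e, dilation_neg, frobInner_perturbTerm_neg, ho.neg_one_pow, neg_one_mul,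
    integral_neg] at h
  linarith

theorem hasExpectation_sum_perturbTerm (hU : Uᵀ * U = 1) (hV : Vᵀ * V = 1)
    (hlam : ∀ i, 0 < lam i) {l : ℝ} (hl : 0 < l) (hll : ∀ i, l ≤ lam i) (hd : 0 < max d₁ d₂) :
    HasExpectation (fun z => ∑ k ∈ Finset.range 6, frobInner (dilVec U V * (dilVec U V)ᵀ)
      (perturbTerm (dilVec U V) (dilVal lam) k (dilation (matOf z))))
      (((d₁ - d₂) ^ 2 - (d₁ + d₂ - 2 * r)) * (diagNegPow lam 4).trace
        - (d₁ + d₂ - 2 * r) * (diagNegPow lam 2).trace) (stdGaussianPi (Fin d₁ × Fin d₂)) := by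
  -- The order 0 term pairs the projector with its own complement.
  have h0 : ∀ z : Fin d₁ × Fin d₂ → ℝ, frobInner (dilVec U V * (dilVec U V)ᵀ)
      (perturbTerm (dilVec U V) (dilVal lam) 0 (dilation (matOf z))) = 0 := fun z => by
    rw [frobInner_proj, perturbTerm_eq_neg_interlacedCoeff, interlacedCoeff, resolventCoeff,
      Matrix.mul_neg, proj_mul_specPow_zero (dilVec_transpose_mul_self hU hV), neg_zero,
      Matrix.trace_zero]
  have ho := fun k hk ho => hasExpectation_perturbTerm_odd hU hV hlam hl hll hd (k := k) hk ho
  have h := ((((ho 1 (by norm_num) (by decide)).add (hasExpectation_perturbTerm_two hU hV lam)).add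
    (ho 3 (by norm_num) (by decide))).add (hasExpectation_perturbTerm_four hU hV lam)).add
    (ho 5 (by norm_num) (by decide))
  simp only [Finset.sum_range_succ, Finset.sum_range_zero, h0, zero_add]
  convert h using 1
  ring

end Expansion

/-! ### Transfer from the product measure to the given probability space -/

section Law

theorem IsStdGaussianMatrix.aemeasurable_and_map_eq {Ω : Type*} [MeasurableSpace Ω] {d₁ d₂ : ℕ}
    {Z : Ω → Matrix (Fin d₁) (Fin d₂) ℝ} {P : Measure Ω} [IsProbabilityMeasure P]
    (h : IsStdGaussianMatrix Z P) :
    AEMeasurable (fun ω (p : Fin d₁ × Fin d₂) => Z ω p.1 p.2) P ∧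
      P.map (fun ω (p : Fin d₁ × Fin d₂) => Z ω p.1 p.2) = stdGaussianPi (Fin d₁ × Fin d₂) := by
  have hm : ∀ p : Fin d₁ × Fin d₂, AEMeasurable (fun ω => Z ω p.1 p.2) P := fun p =>
    (h.hasLaw p.1 p.2).aemeasurable
  refine ⟨aemeasurable_pi_lambda _ hm, ?_⟩
  rw [(iIndepFun_iff_map_fun_eq_pi_map hm).1 h.indep]
  congr 1
  funext p
  exact (h.hasLaw p.1 p.2).map_eq

theorem IsStdGaussianMatrix.hasExpectation {Ω : Type*} [MeasurableSpace Ω] {d₁ d₂ : ℕ}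
    {Z : Ω → Matrix (Fin d₁) (Fin d₂) ℝ} {P : Measure Ω} [IsProbabilityMeasure P]
    (h : IsStdGaussianMatrix Z P) {f : Matrix (Fin d₁) (Fin d₂) ℝ → ℝ} {c : ℝ}
    (hf : HasExpectation (fun z => f (matOf z)) c (stdGaussianPi (Fin d₁ × Fin d₂))) :
    HasExpectation (fun ω => f (Z ω)) c P := by
  obtain ⟨hm, he⟩ := h.aemeasurable_and_map_eq
  obtain ⟨hi, hc⟩ := hf
  rw [← he] at hi hc
  refine ⟨(integrable_map_measure hi.aestronglyMeasurable hm).1 hi, ?_⟩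
  rw [integral_map hm hi.aestronglyMeasurable] at hc
  exact hc

end Law

/-! ### Assembly of the estimates -/

section Main

variable {d₁ d₂ r : ℕ}

theorem le_of_transpose_mul_self_eq_one {d : ℕ} {U : Matrix (Fin d) (Fin r) ℝ} (h : Uᵀ * U = 1) :
    r ≤ d := by
  by_contra hlt
  obtain ⟨c, hc0, hc⟩ := exists_mulVec_eq_zero_of_card_lt U (by simpa using hlt)
  apply hc0
  rw [← Matrix.one_mulVec c, ← h, ← Matrix.mulVec_mulVec, hc, Matrix.mulVec_zero]

theorem frobSq_diagNegPow (lam : Fin r → ℝ) (k : ℕ) :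
    frobSq (diagNegPow lam k) = (diagNegPow lam (k * 2)).trace := by
  rw [frobSq_eq_trace]
  simp [diagNegPow, Matrix.diagonal_transpose, Matrix.diagonal_mul_diagonal, Matrix.trace_diagonal,
    pow_mul, sq]

theorem trace_diagNegPow_le {lam : Fin r → ℝ} {l : ℝ} (hl : 0 < l) (hll : ∀ i, l ≤ lam i) (k : ℕ) :
    0 ≤ (diagNegPow lam k).trace ∧ (diagNegPow lam k).trace ≤ r / l ^ k := by
  have hlam : ∀ i, 0 < lam i := fun i => hl.trans_le (hll i)
  rw [diagNegPow, Matrix.trace_diagonal]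
  refine ⟨Finset.sum_nonneg fun i _ => by have := hlam i; positivity, ?_⟩
  calc ∑ i, (lam i ^ k)⁻¹ ≤ ∑ _i : Fin r, (l ^ k)⁻¹ := by
        refine Finset.sum_le_sum fun i _ => ?_
        have := hll i
        gcongr
    _ = r / l ^ k := by simp [div_eq_mul_inv]

/-- The size of the difference between the fourth order expectation and its leading part. -/
theorem codim_mul_trace_le {U : Matrix (Fin d₁) (Fin r) ℝ} {V : Matrix (Fin d₂) (Fin r) ℝ}
    (hU : Uᵀ * U = 1) (hV : Vᵀ * V = 1) (hr : 0 < r) {lam : Fin r → ℝ} {l : ℝ} (hl : 0 < l)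
    (hll : ∀ i, l ≤ lam i) :
    0 ≤ ((d₁ : ℝ) + d₂ - 2 * r) * (diagNegPow lam 4).trace ∧
    ((d₁ : ℝ) + d₂ - 2 * r) * (diagNegPow lam 4).trace
      ≤ 2 * ((r : ℝ) ^ 2 * (max d₁ d₂ : ℕ) / l ^ 4) := by
  obtain ⟨h0, h1⟩ := trace_diagNegPow_le hl hll 4
  have hr1 : (r : ℝ) ≤ d₁ := by exact_mod_cast le_of_transpose_mul_self_eq_one hU
  have hr2 : (r : ℝ) ≤ d₂ := by exact_mod_cast le_of_transpose_mul_self_eq_one hV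
  have hm1 : (d₁ : ℝ) ≤ (max d₁ d₂ : ℕ) := by exact_mod_cast le_max_left d₁ d₂
  have hm2 : (d₂ : ℝ) ≤ (max d₁ d₂ : ℕ) := by exact_mod_cast le_max_right d₁ d₂
  have hr' : (1 : ℝ) ≤ r := by exact_mod_cast hr
  set D : ℝ := ((max d₁ d₂ : ℕ) : ℝ)
  have hD : 0 ≤ D := by linarith
  refine ⟨mul_nonneg (by linarith) h0, ?_⟩
  calc ((d₁ : ℝ) + d₂ - 2 * r) * (diagNegPow lam 4).trace ≤ (2 * D) * (r / l ^ 4) :=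
        mul_le_mul (by linarith) h1 h0 (by linarith)
    _ = 2 * ((r : ℝ) * D / l ^ 4) := by ring
    -- The factor r is weakened to r² using r ≥ 1.
    _ ≤ 2 * ((r : ℝ) ^ 2 * D / l ^ 4) := by
        gcongr
        nlinarith

theorem IsCompactSVD.last_le {M : Matrix (Fin d₁) (Fin d₂) ℝ} {U : Matrix (Fin d₁) (Fin r) ℝ}
    {lam : Fin r → ℝ} {V : Matrix (Fin d₂) (Fin r) ℝ} (h : IsCompactSVD M U lam V) (hr : 0 < r)
    (i : Fin r) : lam ⟨r - 1, Nat.sub_lt hr one_pos⟩ ≤ lam i :=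
  h.antitone (by
    rw [Fin.le_def]
    have := i.2
    simp only
    omega)

theorem aemeasurable_distSq {Ω : Type*} [MeasurableSpace Ω] {P : Measure Ω}
    {Uh : Ω → Matrix (Fin d₁) (Fin r) ℝ} {Vh : Ω → Matrix (Fin d₂) (Fin r) ℝ}
    (U : Matrix (Fin d₁) (Fin r) ℝ) (V : Matrix (Fin d₂) (Fin r) ℝ)
    (hUh : ∀ i j, AEMeasurable (fun ω => Uh ω i j) P)
    (hVh : ∀ i j, AEMeasurable (fun ω => Vh ω i j) P) :
    AEMeasurable (fun ω => distSq (Uh ω) (Vh ω) U V) P := by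
  simp only [distSq, frobSq, Matrix.sub_apply, Matrix.mul_apply, Matrix.transpose_apply]
  fun_prop

/-- The pointwise expansion is integrated: the truncated sum has a known mean and the remainder is a
multiple of E‖Z‖⁶. The singular vectors need not be functions of Z; boundedness of the distance by
4r makes it integrable. -/
theorem hasExpectation_distSq_bound {Ω : Type*} [MeasurableSpace Ω] {P : Measure Ω}
    [IsProbabilityMeasure P] {M : Matrix (Fin d₁) (Fin d₂) ℝ} {U : Matrix (Fin d₁) (Fin r) ℝ}
    {lam : Fin r → ℝ} {V : Matrix (Fin d₂) (Fin r) ℝ} {Z : Ω → Matrix (Fin d₁) (Fin d₂) ℝ}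
    {Uh : Ω → Matrix (Fin d₁) (Fin r) ℝ} {Vh : Ω → Matrix (Fin d₂) (Fin r) ℝ}
    (h : IsCompactSVD M U lam V) (hZ : IsStdGaussianMatrix Z P)
    (hUh : ∀ i j, AEMeasurable (fun ω => Uh ω i j) P)
    (hVh : ∀ i j, AEMeasurable (fun ω => Vh ω i j) P)
    (ht : ∀ᵐ ω ∂P, IsTopSingularVectors (M + Z ω) (Uh ω) (Vh ω)) (hd : 0 < max d₁ d₂)
    {l : ℝ} (hl : 0 < l) (hll : ∀ i, l ≤ lam i) :
    Integrable (fun ω => distSq (Uh ω) (Vh ω) U V) P ∧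
    |(∫ ω, distSq (Uh ω) (Vh ω) U V ∂P) / 2
      + (((d₁ - d₂) ^ 2 - (d₁ + d₂ - 2 * r)) * (diagNegPow lam 4).trace
        - (d₁ + d₂ - 2 * r) * (diagNegPow lam 2).trace)| ≤
      2000000 * 48 ^ 6 * sixthMomentConst * r * ((max d₁ d₂ : ℕ) / l ^ 2) ^ 3 := by
  have hi : Integrable (fun ω => distSq (Uh ω) (Vh ω) U V) P := by
    refine Integrable.of_bound (aemeasurable_distSq U V hUh hVh).aestronglyMeasurable
      (4 * r : ℝ) ?_
    filter_upwards [ht] with ω hω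
    rw [Real.norm_of_nonneg (distSq_nonneg _ _ _ _)]
    exact hω.distSq_le h.left_orthonormal h.right_orthonormal
  refine ⟨hi, ?_⟩
  obtain ⟨hGi, hGe⟩ := hZ.hasExpectation (f := fun X => ∑ k ∈ Finset.range 6,
    frobInner (dilVec U V * (dilVec U V)ᵀ) (perturbTerm (dilVec U V) (dilVal lam) k (dilation X)))
    (hasExpectation_sum_perturbTerm h.left_orthonormal h.right_orthonormal h.pos hl hll hd)
  obtain ⟨hm, hmle⟩ := integrable_norm_matOf_pow_six_and_integral_le hd (le_max_left d₁ d₂)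
    (le_max_right d₁ d₂)
  obtain ⟨hNi, hNe⟩ := hZ.hasExpectation (f := fun X => ‖X‖ ^ 6) ⟨hm, rfl⟩
  rw [← hGe, ← integral_div, ← integral_add (hi.div_const 2) hGi, ← Real.norm_eq_abs]
  calc _ ≤ ∫ ω, 2000000 * r * (48 / l) ^ 6 * ‖Z ω‖ ^ 6 ∂P := by
        refine norm_integral_le_of_norm_le (hNi.const_mul _) ?_
        filter_upwards [ht] with ω hω
        refine (abs_distSq_add_le h hω hl hll).trans (le_of_eq ?_)
        ring
    _ = 2000000 * r * (48 / l) ^ 6 * ∫ ω, ‖Z ω‖ ^ 6 ∂P := integral_const_mul _ _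
    _ ≤ 2000000 * r * (48 / l) ^ 6 * (sixthMomentConst * (max d₁ d₂ : ℕ) ^ 3) := by
        rw [hNe]
        exact mul_le_mul_of_nonneg_left hmle (by positivity)
    _ = _ := by
        field_simp

end Main

theorem lemma4p2 :
    (∃ C₂ : ℝ, 0 < C₂ ∧
      ∀ (d₁ d₂ r : ℕ) (hr : 0 < r) (M : Matrix (Fin d₁) (Fin d₂) ℝ)
        (U : Matrix (Fin d₁) (Fin r) ℝ) (lam : Fin r → ℝ) (V : Matrix (Fin d₂) (Fin r) ℝ)
        (Ω : Type*) [MeasurableSpace Ω] (P : Measure Ω) [IsProbabilityMeasure P]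
        (Z : Ω → Matrix (Fin d₁) (Fin d₂) ℝ),
        IsCompactSVD M U lam V → IsStdGaussianMatrix Z P →
        Integrable (fun ω => frobInner (dilVec U V * (dilVec U V).transpose)
          (perturbTerm (dilVec U V) (dilVal lam) 4 (dilation (Z ω)))) P ∧
        |(∫ ω, frobInner (dilVec U V * (dilVec U V).transpose)
            (perturbTerm (dilVec U V) (dilVal lam) 4 (dilation (Z ω))) ∂P)
            - ((d₁ : ℝ) - (d₂ : ℝ)) ^ 2 * frobSq (diagNegPow lam 2)|
          ≤ C₂ * ((r : ℝ) ^ 2 * (max d₁ d₂ : ℕ) / lam ⟨r - 1, Nat.sub_lt hr one_pos⟩ ^ 4)) ∧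
    (∃ C₁ : ℝ, 0 < C₁ ∧ ∃ C₂ : ℝ, 0 < C₂ ∧ ∃ C₃ : ℝ, 0 < C₃ ∧
      ∀ (d₁ d₂ r : ℕ) (hr : 0 < r) (M : Matrix (Fin d₁) (Fin d₂) ℝ)
        (U : Matrix (Fin d₁) (Fin r) ℝ) (lam : Fin r → ℝ) (V : Matrix (Fin d₂) (Fin r) ℝ)
        (Ω : Type*) [MeasurableSpace Ω] (P : Measure Ω) [IsProbabilityMeasure P]
        (Z : Ω → Matrix (Fin d₁) (Fin d₂) ℝ)
        (Uh : Ω → Matrix (Fin d₁) (Fin r) ℝ) (Vh : Ω → Matrix (Fin d₂) (Fin r) ℝ),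
        IsCompactSVD M U lam V → IsStdGaussianMatrix Z P →
        (∀ i j, AEMeasurable (fun ω => Uh ω i j) P) →
        (∀ i j, AEMeasurable (fun ω => Vh ω i j) P) →
        (∀ᵐ ω ∂P, IsTopSingularVectors (M + Z ω) (Uh ω) (Vh ω)) →
        C₁ * Real.sqrt (max d₁ d₂ : ℕ) ≤ lam ⟨r - 1, Nat.sub_lt hr one_pos⟩ →
        Integrable (fun ω => distSq (Uh ω) (Vh ω) U V) P ∧
        |(∫ ω, distSq (Uh ω) (Vh ω) U V ∂P)
            - 2 * (((d₁ : ℝ) + (d₂ : ℝ) - 2 * (r : ℝ)) * frobSq (diagNegPow lam 1)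
              - ((d₁ : ℝ) - (d₂ : ℝ)) ^ 2 * frobSq (diagNegPow lam 2))|
          ≤ C₂ * ((r : ℝ) ^ 2 * (max d₁ d₂ : ℕ) / lam ⟨r - 1, Nat.sub_lt hr one_pos⟩ ^ 4)
            + C₃ * (r : ℝ) *
              ((max d₁ d₂ : ℕ) / lam ⟨r - 1, Nat.sub_lt hr one_pos⟩ ^ 2) ^ 3) := by
  -- The constant 2 comes from d⋆ ≤ 2 d_max. In the second part both constants double, because the
  -- expansion concerns half the squared distance.
  refine ⟨⟨2, two_pos, ?_⟩, 1, one_pos, 4, by norm_num,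
    2 * (2000000 * 48 ^ 6 * sixthMomentConst), by unfold sixthMomentConst; norm_num, ?_⟩
  · intro d₁ d₂ r hr M U lam V Ω _ P _ Z h hZ
    have hl := h.pos ⟨r - 1, Nat.sub_lt hr one_pos⟩
    have hll := h.last_le hr
    obtain ⟨hi, he⟩ := hZ.hasExpectation (f := fun X => frobInner (dilVec U V * (dilVec U V)ᵀ)
      (perturbTerm (dilVec U V) (dilVal lam) 4 (dilation X)))
      (hasExpectation_perturbTerm_four h.left_orthonormal h.right_orthonormal lam)
    obtain ⟨h0, h1⟩ := codim_mul_trace_le h.left_orthonormal h.right_orthonormal hr hl hll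
    refine ⟨hi, ?_⟩
    rw [he, frobSq_diagNegPow]
    -- The fourth order mean is known exactly, so the only error is d⋆ tr Λ⁻⁴.
    have e : ((d₁ - d₂ : ℝ) ^ 2 - (d₁ + d₂ - 2 * r)) * (diagNegPow lam 4).trace
        - ((d₁ : ℝ) - d₂) ^ 2 * (diagNegPow lam (2 * 2)).trace
        = -(((d₁ : ℝ) + d₂ - 2 * r) * (diagNegPow lam 4).trace) := by ring
    rw [e, abs_neg, abs_of_nonneg h0]
    exact h1
  · intro d₁ d₂ r hr M U lam V Ω _ P _ Z Uh Vh h hZ hUh hVh ht _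
    have hl := h.pos ⟨r - 1, Nat.sub_lt hr one_pos⟩
    have hll := h.last_le hr
    have hd : 0 < max d₁ d₂ :=
      (hr.trans_le (le_of_transpose_mul_self_eq_one h.left_orthonormal)).trans_le (le_max_left _ _)
    obtain ⟨hi, hb⟩ := hasExpectation_distSq_bound h hZ hUh hVh ht hd hl hll
    obtain ⟨h0, h1⟩ := codim_mul_trace_le h.left_orthonormal h.right_orthonormal hr hl hll
    refine ⟨hi, ?_⟩
    rw [frobSq_diagNegPow, frobSq_diagNegPow]
    simp only [one_mul, Nat.reduceMul]
    rw [abs_le] at hb ⊢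
    constructor <;> linarith
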